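/- Let $k$ be a commutative ring containing $\mathbb{Q}$. An $L_\infty$-algebra over $k$ is a $\mathbb{Z}$-graded $k$-module $L$ with graded antisymmetric multilinear maps $\mu_n:\bigwedge^n L\to L$ of degree $2-n$ ($n\ge 0$) such that the coderivation $Q$ of $S(L[1])$ with components $Q_n=(-1)^{n(n-1)/2}\downarrow\circ\,\mu_n\circ\uparrow^n$ satisfies $Q^2=0$. An $L_\infty$-morphism $f:L\to L'$ is a sequence of maps $f_n:\bigwedge^nL\to L'$ of degree $1-n$ ($n\ge 1$) such that the coalgebra map $F:S(L[1])\to S(L'[1])$ with $F(1)=1$ and components $F_n=(-1)^{n(n-1)/2}\downarrow\circ f_n\circ\uparrow^n$ satisfies $F\circ Q=Q'\circ F$; morphisms are composed by composing these coalgebra maps. Call $f$ split injective (split surjective) if $f_1$ has a left (right) inverse that is a degree $0$ homomorphism of graded $k$-modules, and an $L_\infty$-quasi-isomorphism if $\mu_0=0$ and $\mu'_0=0$ and $f_1:(L,\mu_1)\to(L',\mu_1')$ is a quasi-isomorphism of complexes. Call $(L,\mu_1)$ split if there is a $k$-linear map $\eta:L\to L$ of degree $-1$ with $\mu_1\eta\mu_1=\mu_1$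 (when $\mu_0=0$, this is automatic if $k$ is a field). Let $$\begin{array}{ccc} A & \xrightarrow{\;c\;} & C\\ {\scriptstyle f}\downarrow & & \downarrow{\scriptstyle e}\\ B & \xrightarrow{\;d\;} & D\end{array}$$ be a commutative square of $L_\infty$-algebras and $L_\infty$-morphisms, where $f$ is split injective and $e$ is split surjective. Suppose that - $f$ is an $L_\infty$-quasi-isomorphism and the complexes $(A,\mu_1^A)$ and $(B,\mu_1^B)$ are split, or - $e$ is an $L_\infty$-quasi-isomorphism and the complexes $(C,\mu_1^C)$ and $(D,\mu_1^D)$ are split. (If $k$ is a field of characteristic zero, this says just that $f$ or $e$ is an $L_\infty$-quasi-isomorphism.) Then there is an $L_\infty$-morphism $g:B\to C$ with $g\circ f=c$ and $e\circ g=d$. -/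

import Mathlib

/-! Graded modules, `L_∞`-algebras and `L_∞`-morphisms over a commutative ring containing `ℚ`. -/

universe u v w x y

namespace LInf

/-- A `ℤ`-graded `k`-module, presented as a module that is the internal direct sum of its
homogeneous parts `deg i`. -/
structure GradedModule (k : Type u) [CommRing k] where
  carrier : Type v
  [addCommGroup : AddCommGroup carrier]
  [module : Module k carrier]
  deg : ℤ → Submodule k carrier
  [decomposition : DirectSum.Decomposition deg]

attribute [instance] GradedModule.addCommGroup GradedModule.module GradedModule.decomposition

/-- A sequence of multilinear maps `V × ⋯ × V → W`, one for each number `n ≥ 0` of arguments. -/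
abbrev MultiFamily (k : Type u) [CommRing k] (V : Type v) (W : Type w)
    [AddCommGroup V] [Module k V] [AddCommGroup W] [Module k W] :=
  ∀ n : ℕ, MultilinearMap k (fun _ : Fin n => V) W

/-- The Koszul sign `ε(σ, w)` of homogeneous `w₁, …, wₙ` of degrees `d`, i.e. the sign with
`w_{σ 1} ⊙ ⋯ ⊙ w_{σ n} = ε(σ, w) w₁ ⊙ ⋯ ⊙ wₙ`: a factor `(-1)^{d_a d_b}` for every inversion. -/
def koszulSign {n : ℕ} (σ : Equiv.Perm (Fin n)) (d : Fin n → ℤ) : ℤˣ :=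
  ∏ p ∈ Finset.univ.filter (fun p : Fin n × Fin n => p.1 < p.2 ∧ σ p.2 < σ p.1),
    (d (σ p.1) * d (σ p.2)).negOnePow

/-- `σ ∈ Sh(k, n)`: `σ` is increasing on the first `k` and on the last `n - k` indices. -/
def IsShuffle {n : ℕ} (k : ℕ) (σ : Equiv.Perm (Fin n)) : Prop :=
  ∀ i j : Fin n, i < j → ((j : ℕ) < k ∨ k ≤ (i : ℕ)) → σ i < σ j

instance {n : ℕ} (k : ℕ) (σ : Equiv.Perm (Fin n)) : Decidable (IsShuffle k σ) := by
  unfold IsShuffle; infer_instance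

section Formulas

variable {k : Type u} [CommRing k]
  {V : Type v} {V' : Type w} {V'' : Type x}
  [AddCommGroup V] [Module k V] [AddCommGroup V'] [Module k V'] [AddCommGroup V''] [Module k V'']

/-- For a coalgebra map or coderivation `G` on `S(V)` with components `Gₙ : V^{⊙ n} → V'`, and a
coderivation `Q` of `S(V)` of odd degree with components `Qₙ : V^{⊙ n} → V`, the component
`(G ∘ Q)ₙ` at homogeneous `w₁, …, wₙ` of degrees `d`:
`∑_{p + l = n + 1} ∑_{σ ∈ Sh(p, n)} ε(σ) G_l (Q_p (w_{σ 1}, …, w_{σ p}), w_{σ (p+1)}, …, w_{σ n})`,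
with `p ≥ 0`, `l ≥ 1`. -/
def compCoder (G : MultiFamily k V V') (Q : MultiFamily k V V)
    (n : ℕ) (d : Fin n → ℤ) (w : Fin n → V) : V' :=
  ∑ p : Fin (n + 1), ∑ σ ∈ Finset.univ.filter (fun σ : Equiv.Perm (Fin n) => IsShuffle p σ),
    koszulSign σ d • G (n - p + 1)
      (Fin.cons (Q p (fun i => w (σ ⟨i, by omega⟩)))
        (fun j : Fin (n - p) => w (σ ⟨p + j, by omega⟩)))

/-- For a coalgebra map `F : S(V) → S(V')` of degree `0` with components `Fₙ : V^{⊙ n} → V'`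
(`n ≥ 1`), and a map `G` with components `Gₙ : V'^{⊙ n} → V''`, the component `(G ∘ F)ₙ` at
homogeneous `w₁, …, wₙ` of degrees `d`: the sum over all ordered decompositions
`n = i₁ + ⋯ + i_l` into positive integers of `G_l ∘ F_I`, where
`F_I = (1 / (i₁! ⋯ i_l! l!)) (F_{i₁} ⊙ ⋯ ⊙ F_{i_l}) ∘ ∑_{σ ∈ Σₙ} σ`. -/
def compMap [Algebra ℚ k] (G : MultiFamily k V' V'') (F : MultiFamily k V V')
    (n : ℕ) (d : Fin n → ℤ) (w : Fin n → V) : V'' :=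
  ∑ c : Composition n,
    algebraMap ℚ k ((c.length.factorial * ∏ i, (c.blocksFun i).factorial : ℕ) : ℚ)⁻¹ •
      ∑ σ : Equiv.Perm (Fin n), koszulSign σ d •
        G c.length (fun i => F (c.blocksFun i) (fun j => w (σ (c.embedding i j))))

end Formulas

namespace GradedModule

variable {k : Type u} [CommRing k]

/-- The linear involution `x ↦ (-1)^{deg x} x`. -/
noncomputable def parity (L : GradedModule.{u, v} k) : L.carrier →ₗ[k] L.carrier :=
  (DirectSum.toModule k ℤ L.carrier (fun i => ((i.negOnePow : ℤˣ) : ℤ) • (L.deg i).subtype)) ∘ₗ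
    (DirectSum.decomposeLinearEquiv L.deg).toLinearMap

/-- On an element of degree `i`, `parity` is multiplication by `(-1)^i`. -/
theorem parity_apply (L : GradedModule.{u, v} k) {i : ℤ} {x : L.carrier} (hx : x ∈ L.deg i) :
    L.parity x = i.negOnePow • x := by
  have h := DirectSum.decompose_of_mem L.deg hx
  simp only [parity, LinearMap.comp_apply, LinearEquiv.coe_coe,
    DirectSum.decomposeLinearEquiv_apply, h]
  erw [DirectSum.toModule_lof]
  simp [Units.smul_def]

/-- `φ` is homogeneous: `φₙ` has degree `s n`. -/
def IsHomogeneous (L : GradedModule.{u, v} k) (L' : GradedModule.{u, w} k)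
    (φ : MultiFamily k L.carrier L'.carrier) (s : ℕ → ℤ) : Prop :=
  ∀ (n : ℕ) (d : Fin n → ℤ) (a : Fin n → L.carrier), (∀ j, a j ∈ L.deg (d j)) →
    φ n a ∈ L'.deg (∑ j, d j + s n)

/-- `φ` is graded antisymmetric, i.e. `φₙ` is a linear map on `⋀ⁿ L`:
`φₙ(a_{σ 1}, …, a_{σ n}) = χ(σ, a) φₙ(a₁, …, aₙ)` with `χ(σ, a) = sign σ · ε(σ, a)`. -/
def IsAntisymm (L : GradedModule.{u, v} k) (L' : GradedModule.{u, w} k)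
    (φ : MultiFamily k L.carrier L'.carrier) : Prop :=
  ∀ (n : ℕ) (d : Fin n → ℤ) (a : Fin n → L.carrier), (∀ j, a j ∈ L.deg (d j)) →
    ∀ σ : Equiv.Perm (Fin n),
      φ n (fun j => a (σ j)) = (Equiv.Perm.sign σ * koszulSign σ d) • φ n a

/-- Decalage. The shift `L[1]` has the same underlying module, and its part of degree `i` is
`L.deg (i + 1)`. A family `φₙ : ⋀ⁿ L → L'` induces the family
`Φₙ = (-1)^{n(n-1)/2} ↓ ∘ φₙ ∘ ↑ⁿ : L[1]^{⊙ n} → L'[1]`, that is,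
`Φₙ(↓a₁, …, ↓aₙ) = (-1)^{(n-1) a₁ + ⋯ + 1 · a_{n-1}} ↓φₙ(a₁, …, aₙ)`. -/
noncomputable def decalage (L : GradedModule.{u, v} k) {V : Type w} [AddCommGroup V] [Module k V]
    (φ : MultiFamily k L.carrier V) : MultiFamily k L.carrier V :=
  fun n => (φ n).compLinearMap (fun j : Fin n => L.parity ^ (n - 1 - (j : ℕ)))

/-- `w₁, …, wₙ` are homogeneous elements of the shift `L[1]`, of degrees `d₁, …, dₙ` there. -/
def IsShiftHomogeneous (L : GradedModule.{u, v} k) {n : ℕ} (d : Fin n → ℤ)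
    (w : Fin n → L.carrier) : Prop :=
  ∀ j, w j ∈ L.deg (d j + 1)

end GradedModule

/-- An `L_∞`-algebra: a graded module `L` with graded antisymmetric maps `μₙ : ⋀ⁿ L → L` of degree
`2 - n` for `n ≥ 0`, such that the coderivation `Q` of `S(L[1])` whose components `Qₙ` are induced
by `μₙ` satisfies `Q² = 0` (equivalently, all components `(Q²)ₙ` of the coderivation `Q²`
vanish). -/
structure LInftyAlgebra (k : Type u) [CommRing k] extends GradedModule.{u, v} k where
  μ : MultiFamily k carrier carrier
  μ_homogeneous : toGradedModule.IsHomogeneous toGradedModule μ (fun n => 2 - (n : ℤ))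
  μ_antisymm : toGradedModule.IsAntisymm toGradedModule μ
  codifferential : ∀ (n : ℕ) (d : Fin n → ℤ) (w : Fin n → carrier),
    toGradedModule.IsShiftHomogeneous d w →
    compCoder (toGradedModule.decalage μ) (toGradedModule.decalage μ) n d w = 0

namespace LInftyAlgebra

variable {k : Type u} [CommRing k]

/-- The components `Qₙ` of the codifferential of `S(L[1])`. -/
noncomputable def Q (L : LInftyAlgebra.{u, v} k) : MultiFamily k L.carrier L.carrier :=
  L.toGradedModule.decalage L.μ

/-- The linear map `μ₁ : L → L`. -/
def d (L : LInftyAlgebra.{u, v} k) : L.carrier →ₗ[k] L.carrier :=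
  (MultilinearMap.ofSubsingleton k L.carrier L.carrier (0 : Fin 1)).symm (L.μ 1)

/-- `μ₀ = 0`; in this case `(L, μ₁)` is a complex. -/
def IsFlat (L : LInftyAlgebra.{u, v} k) : Prop := L.μ 0 = 0

/-- `(L, μ₁)` is split: there is `η : L → L` of degree `-1` with `μ₁ η μ₁ = μ₁`. -/
def IsSplit (L : LInftyAlgebra.{u, v} k) : Prop :=
  ∃ η : L.carrier →ₗ[k] L.carrier,
    (∀ (i : ℤ), ∀ a ∈ L.deg i, η a ∈ L.deg (i - 1)) ∧ ∀ a, L.d (η (L.d a)) = L.d a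

end LInftyAlgebra

/-- An `L_∞`-morphism `L → L'`: graded antisymmetric maps `fₙ : ⋀ⁿ L → L'` of degree `1 - n`
(`f₀ = 0`) such that the coalgebra map `F : S(L[1]) → S(L'[1])` with `F(1) = 1` whose components
`Fₙ` are induced by `fₙ` satisfies `Q' ∘ F = F ∘ Q`, expressed on components. -/
structure LInftyHom {k : Type u} [CommRing k] [Algebra ℚ k]
    (L : LInftyAlgebra.{u, v} k) (L' : LInftyAlgebra.{u, w} k) where
  f : MultiFamily k L.carrier L'.carrier
  f_zero : f 0 = 0
  f_homogeneous : L.toGradedModule.IsHomogeneous L'.toGradedModule f (fun n => 1 - (n : ℤ))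
  f_antisymm : L.toGradedModule.IsAntisymm L'.toGradedModule f
  commutes : ∀ (n : ℕ) (d : Fin n → ℤ) (w : Fin n → L.carrier),
    L.toGradedModule.IsShiftHomogeneous d w →
    compMap L'.Q (L.toGradedModule.decalage f) n d w =
      compCoder (L.toGradedModule.decalage f) L.Q n d w

namespace LInftyHom

variable {k : Type u} [CommRing k] [Algebra ℚ k]
  {L : LInftyAlgebra.{u, v} k} {L' : LInftyAlgebra.{u, w} k} {L'' : LInftyAlgebra.{u, x} k}

/-- The components `Fₙ : L[1]^{⊙ n} → L'[1]` of the coalgebra map given by an `L_∞`-morphism. -/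
noncomputable def F (f : LInftyHom L L') : MultiFamily k L.carrier L'.carrier :=
  L.toGradedModule.decalage f.f

/-- The `n`-th component of the composite `g ∘ f` of `L_∞`-morphisms, as a function of homogeneous
elements `w₁, …, wₙ` of `L[1]` of degrees `d`. -/
noncomputable def compAt (g : LInftyHom L' L'') (f : LInftyHom L L')
    (n : ℕ) (d : Fin n → ℤ) (w : Fin n → L.carrier) : L''.carrier :=
  compMap g.F f.F n d w

/-- `g ∘ f = h`. -/
def CompEq (g : LInftyHom L' L'') (f : LInftyHom L L') (h : LInftyHom L L'') : Prop :=
  ∀ (n : ℕ) (d : Fin n → ℤ) (w : Fin n → L.carrier),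
    L.toGradedModule.IsShiftHomogeneous d w → compAt g f n d w = h.F n w

/-- `g ∘ f = g' ∘ f'`. -/
def SquareCommutes {M : LInftyAlgebra.{u, y} k} (g : LInftyHom L' L'') (f : LInftyHom L L')
    (g' : LInftyHom M L'') (f' : LInftyHom L M) : Prop :=
  ∀ (n : ℕ) (d : Fin n → ℤ) (w : Fin n → L.carrier),
    L.toGradedModule.IsShiftHomogeneous d w → compAt g f n d w = compAt g' f' n d w

/-- The linear part `f₁ : L → L'`. -/
def linear (f : LInftyHom L L') : L.carrier →ₗ[k] L'.carrier :=
  (MultilinearMap.ofSubsingleton k L.carrier L'.carrier (0 : Fin 1)).symm (f.f 1)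

/-- `f₁` is split injective: it has a left inverse homomorphism of graded modules. -/
def IsSplitInjective (f : LInftyHom L L') : Prop :=
  ∃ p : L'.carrier →ₗ[k] L.carrier,
    (∀ (i : ℤ), ∀ b ∈ L'.deg i, p b ∈ L.deg i) ∧ ∀ a, p (f.linear a) = a

/-- `f₁` is split surjective: it has a right inverse homomorphism of graded modules. -/
def IsSplitSurjective (f : LInftyHom L L') : Prop :=
  ∃ s : L'.carrier →ₗ[k] L.carrier,
    (∀ (i : ℤ), ∀ b ∈ L'.deg i, s b ∈ L.deg i) ∧ ∀ b, f.linear (s b) = b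

/-- `f` is an `L_∞`-quasi-isomorphism: `μ₀ = 0` on both sides, and `f₁ : (L, μ₁) → (L', μ'₁)` is a
quasi-isomorphism of complexes, i.e. the induced map
`ker μ₁ / im μ₁ → ker μ'₁ / im μ'₁` is injective and surjective. -/
def IsQuasiIso (f : LInftyHom L L') : Prop :=
  L.IsFlat ∧ L'.IsFlat ∧
    (∀ a, L.d a = 0 → (∃ b, L'.d b = f.linear a) → ∃ a', L.d a' = a) ∧
    (∀ b, L'.d b = 0 → ∃ a, L.d a = 0 ∧ ∃ b', f.linear a - b = L'.d b')

end LInftyHom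

end LInf

/-! All computations take place in tensor coalgebras rather than symmetric ones. For `V = L[1]` the
tensor algebra with deconcatenation is a coalgebra in which maps are computed by recursion on the
first letter. A degree 0 family extends uniquely to a coalgebra map (`hat`), and a degree 1 family
to a sign-twisted coderivation (`cod`). The symmetric coalgebra is modelled by the range of the
unnormalized signed symmetrization `sym`. By `delta_sym`, `cod_sym` and `IsCo.sym_cons`, the
deconcatenation formulas restrict there to the shuffle formulas of the symmetric coalgebra. So `Q² =
0`, `Q'F = FQ` and equality of morphisms become equalities on symmetric tensors (`EqSym`), and the
dictionary with the given formulas is `compMap_eq` and `compCoder_eq`.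

The lifting problem is first made strict. Since `f₁` is split injective, `f` is its linear part
followed by a coalgebra automorphism of the target. Since `e₁` is split surjective, `e` is an
automorphism of the source followed by its linear part. Conjugating the codifferentials of `B` and
`C` by these automorphisms makes both vertical maps linear (`exists_lift`).

Linear algebra with the splittings turns the quasi-isomorphism into contraction data. If `e` is the
quasi-isomorphism, there is a section `s` and a homotopy `h` with values in `ker e` and `dh + hd = 1
- se` (`exists_section_homotopy`). If `f` is, there is a retraction `p` and a homotopy `h` that
kills the image of `f`, with `dh + hd = 1 - fp` (`exists_retraction_homotopy`).

If `ker e` is contractible, the functional `κ = δ h pr + h pr Q` is an `L_∞`-morphism from `C` to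
the complex `ker e`, and `(e, κ)` is an isomorphism of `C` with the product of `D` and that complex.
A lift then amounts to extending `κ ∘ c` from `A` to `B`. The contraction writes this map as a
boundary; its primitive is extended along `p`, and the boundary of the extension is the required
map.

If `f` is a deformation retract, the lift is built by obstruction theory, one number of arguments at
a time. The lowest term `E` of the failure to be a morphism is closed, is killed by `e`, and
vanishes on the image of `A`. The contraction of `B` onto `A` extends to tensor powers
(`lcod_tensHomotopy`). Composing it with `E` and averaging gives a correction that removes `E` and
disturbs neither triangle (`IsPreLift.step`). The components stabilize, so the limit exists. -/

set_option linter.unusedSectionVars false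

open TensorProduct

namespace LInf

namespace Tens

/-! ### The tensor coalgebra: deconcatenation, convolution, coalgebra maps, coderivations -/

section Basic

variable {k : Type u} [CommRing k] {V : Type v} [AddCommGroup V] [Module k V]
  {W : Type w} [AddCommGroup W] [Module k W] {U : Type x} [AddCommGroup U] [Module k U]

local notation "𝓲" => TensorAlgebra.ι k

/-- Induction on tensors by left multiplication with vectors. -/
theorem left_induction {C : TensorAlgebra k V → Prop} (one : C 1)
    (mul : ∀ v x, C x → C (𝓲 v * x)) (add : ∀ x y, C x → C y → C (x + y))
    (smul : ∀ (r : k) x, C x → C (r • x)) (x : TensorAlgebra k V) : C x := by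
  have key : ∀ y, C y → C (x * y) := by
    induction x using TensorAlgebra.induction with
    | algebraMap r => intro y hy; rw [← Algebra.smul_def]; exact smul r y hy
    | ι v => exact mul v
    | mul a b ha hb => intro y hy; rw [mul_assoc]; exact ha _ (hb _ hy)
    | add a b ha hb => intro y hy; rw [add_mul]; exact add _ _ (ha _ hy) (hb _ hy)
  simpa using key 1 one

/-- Tensors are built by multiplying by letters from the left, so maps obeying the same recursion on
the first letter agree. -/
theorem ext_left {M : Type*} [AddCommGroup M] [Module k M] {f g : TensorAlgebra k V →ₗ[k] M}
    (one : f 1 = g 1) (mul : ∀ v x, f x = g x → f (𝓲 v * x) = g (𝓲 v * x)) : f = g := by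
  ext x
  induction x using left_induction with
  | one => exact one
  | mul v x h => exact mul v x h
  | add x y hx hy => simp [hx, hy]
  | smul r x hx => simp [hx]

/-- The counit of the tensor coalgebra. -/
noncomputable def eps : TensorAlgebra k V →ₗ[k] k := TensorAlgebra.algebraMapInv.toLinearMap

@[simp] theorem eps_one : eps (1 : TensorAlgebra k V) = 1 := by simp [eps]

@[simp] theorem eps_ι_mul (v : V) (x : TensorAlgebra k V) : eps (𝓲 v * x) = 0 := by
  simp [eps, TensorAlgebra.algebraMapInv]

@[simp] theorem eps_ι (v : V) : eps (𝓲 v) = 0 := by simpa using eps_ι_mul v 1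

/-- Left multiplication by a vector. -/
noncomputable def lmul : V →ₗ[k] TensorAlgebra k V →ₗ[k] TensorAlgebra k V :=
  LinearMap.mul k (TensorAlgebra k V) ∘ₗ 𝓲

@[simp] theorem lmul_apply (v : V) (x : TensorAlgebra k V) : lmul v x = 𝓲 v * x := rfl

/-- The linear map that sends `1` to `m` and replaces left multiplication by `v` with `φ v`. -/
noncomputable def fold {M : Type*} [AddCommGroup M] [Module k M] (φ : V →ₗ[k] Module.End k M)
    (m : M) : TensorAlgebra k V →ₗ[k] M :=
  LinearMap.applyₗ m ∘ₗ (TensorAlgebra.lift k φ).toLinearMap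

@[simp] theorem fold_one {M : Type*} [AddCommGroup M] [Module k M] (φ : V →ₗ[k] Module.End k M)
    (m : M) : fold φ m 1 = m := by simp [fold]

@[simp] theorem fold_ι_mul {M : Type*} [AddCommGroup M] [Module k M]
    (φ : V →ₗ[k] Module.End k M) (m : M) (v : V) (x : TensorAlgebra k V) :
    fold φ m (𝓲 v * x) = φ v (fold φ m x) := by simp [fold]

/-- The recursion step of the projection onto tensors of length one. -/
noncomputable def prStep : V →ₗ[k] Module.End k (V × k) :=
  LinearMap.mk₂ k (fun (v : V) (p : V × k) => (p.2 • v, (0 : k)))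
    (by simp) (by intro c m n; ext; exacts [smul_comm _ _ _, by simp]) (by simp [add_smul])
    (by simp [mul_smul])

@[simp] theorem prStep_apply (v : V) (p : V × k) : prStep v p = (p.2 • v, (0 : k)) := rfl

/-- The projection onto tensors of length one. -/
noncomputable def pr : TensorAlgebra k V →ₗ[k] V := LinearMap.fst k V k ∘ₗ fold prStep (0, 1)

@[simp] theorem pr_one : pr (1 : TensorAlgebra k V) = 0 := by simp [pr]

@[simp] theorem pr_ι_mul (v : V) (x : TensorAlgebra k V) : pr (𝓲 v * x) = eps x • v := by
  -- The second component of the fold carries the counit, which detects whether the rest of the word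
  -- is empty.
  have h : LinearMap.snd k V k ∘ₗ fold prStep (0, 1) = eps := by
    apply ext_left <;> simp
  have := LinearMap.congr_fun h x
  simp only [LinearMap.comp_apply, LinearMap.snd_apply] at this
  simp [pr, this]

@[simp] theorem pr_ι (v : V) : pr (𝓲 v) = v := by simpa using pr_ι_mul v (1 : TensorAlgebra k V)

/-- The recursion step of the deconcatenation coproduct. -/
noncomputable def deltaStep :
    V →ₗ[k] Module.End k ((TensorAlgebra k V ⊗[k] TensorAlgebra k V) × TensorAlgebra k V) :=
  LinearMap.mk₂ k (fun (v : V) p =>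
      ((lmul v).rTensor (TensorAlgebra k V) p.1 + 1 ⊗ₜ[k] (𝓲 v * p.2), 𝓲 v * p.2))
    (by intros; simp [LinearMap.rTensor_add, add_mul, tmul_add]; abel)
    (by intros; simp [LinearMap.rTensor_smul])
    (by intros; simp [mul_add, tmul_add]; abel)
    (by intros; simp)

@[simp] theorem deltaStep_apply (v : V)
    (p : (TensorAlgebra k V ⊗[k] TensorAlgebra k V) × TensorAlgebra k V) :
    deltaStep v p =
      ((lmul v).rTensor (TensorAlgebra k V) p.1 + 1 ⊗ₜ[k] (𝓲 v * p.2), 𝓲 v * p.2) := rfl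

/-- The deconcatenation coproduct. -/
noncomputable def delta : TensorAlgebra k V →ₗ[k] TensorAlgebra k V ⊗[k] TensorAlgebra k V :=
  LinearMap.fst k _ _ ∘ₗ fold deltaStep (1 ⊗ₜ[k] 1, 1)

@[simp] theorem delta_one : delta (1 : TensorAlgebra k V) = 1 ⊗ₜ[k] 1 := by simp [delta]

/-- A cut of `v x` lies either before `v` or at a cut of `x`, with `v` joined to the left factor.
The recursion needs the tensor itself, which is the second component of the fold. -/
theorem delta_ι_mul (v : V) (x : TensorAlgebra k V) :
    delta (𝓲 v * x) = 1 ⊗ₜ[k] (𝓲 v * x) + (lmul v).rTensor (TensorAlgebra k V) (delta x) := by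
  have h : LinearMap.snd k _ _ ∘ₗ fold (deltaStep (k := k) (V := V)) (1 ⊗ₜ[k] 1, 1) =
      LinearMap.id := by
    apply ext_left
    · simp
    · intro v x hx
      simp only [LinearMap.comp_apply, LinearMap.snd_apply] at hx
      simp [hx]
  have h2 := LinearMap.congr_fun h x
  simp only [LinearMap.comp_apply, LinearMap.snd_apply, LinearMap.id_apply] at h2
  simp only [delta, LinearMap.comp_apply, fold_ι_mul, deltaStep_apply, LinearMap.fst_apply, h2]
  rw [add_comm]

theorem delta_ι (v : V) : delta (𝓲 v) = 1 ⊗ₜ[k] 𝓲 v + 𝓲 v ⊗ₜ[k] 1 := by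
  simpa using delta_ι_mul v (1 : TensorAlgebra k V)

section Conv

variable {A : Type*} [Ring A] [Algebra k A]

/-- The convolution product of two linear maps out of the tensor coalgebra. -/
noncomputable def conv (a b : TensorAlgebra k V →ₗ[k] A) : TensorAlgebra k V →ₗ[k] A :=
  LinearMap.mul' k A ∘ₗ TensorProduct.map a b ∘ₗ delta

theorem conv_apply (a b : TensorAlgebra k V →ₗ[k] A) (x : TensorAlgebra k V) :
    conv a b x = LinearMap.mul' k A (TensorProduct.map a b (delta x)) := rfl

@[simp] theorem conv_one (a b : TensorAlgebra k V →ₗ[k] A) : conv a b 1 = a 1 * b 1 := by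
  simp [conv]

/-- The recursion behind most inductions below. It replaces the first factor `a` by `a ∘ₗ lmul v`,
which is why those inductions are stated for all first factors at once. -/
theorem conv_ι_mul (a b : TensorAlgebra k V →ₗ[k] A) (v : V) (x : TensorAlgebra k V) :
    conv a b (𝓲 v * x) = a 1 * b (𝓲 v * x) + conv (a ∘ₗ lmul v) b x := by
  simp only [conv_apply, delta_ι_mul, map_add, map_tmul, LinearMap.mul'_apply]
  rw [LinearMap.rTensor, ← LinearMap.comp_apply (TensorProduct.map a b), ← TensorProduct.map_comp,
    LinearMap.comp_id]

theorem conv_add_left (a a' b : TensorAlgebra k V →ₗ[k] A) :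
    conv (a + a') b = conv a b + conv a' b := by
  ext x; simp [conv_apply, TensorProduct.map_add_left]

theorem conv_add_right (a b b' : TensorAlgebra k V →ₗ[k] A) :
    conv a (b + b') = conv a b + conv a b' := by
  ext x; simp [conv_apply, TensorProduct.map_add_right]

theorem conv_neg_left (a b : TensorAlgebra k V →ₗ[k] A) : conv (-a) b = - conv a b := by
  rw [eq_neg_iff_add_eq_zero, ← conv_add_left]
  ext x; simp [conv_apply]

theorem conv_neg_right (a b : TensorAlgebra k V →ₗ[k] A) : conv a (-b) = - conv a b := by
  rw [eq_neg_iff_add_eq_zero, ← conv_add_right]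
  ext x; simp [conv_apply]

@[simp] theorem conv_zero_left (b : TensorAlgebra k V →ₗ[k] A) : conv 0 b = 0 := by
  ext x; simp [conv_apply]

@[simp] theorem conv_zero_right (b : TensorAlgebra k V →ₗ[k] A) : conv b 0 = 0 := by
  ext x; simp [conv_apply]

theorem conv_mulLeft (r : A) (a b : TensorAlgebra k V →ₗ[k] A) (x : TensorAlgebra k V) :
    conv (LinearMap.mulLeft k r ∘ₗ a) b x = r * conv a b x := by
  simp only [conv_apply]
  generalize delta x = t
  induction t using TensorProduct.induction_on with
  | zero => simp
  | tmul a b => simp [mul_assoc]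
  | add a b ha hb => simp only [map_add, ha, hb, mul_add]

/-- The unit of the convolution algebra. -/
noncomputable def convUnit : TensorAlgebra k V →ₗ[k] A := (Algebra.linearMap k A) ∘ₗ eps

@[simp] theorem convUnit_one : convUnit (1 : TensorAlgebra k V) = (1 : A) := by simp [convUnit]

@[simp] theorem convUnit_ι_mul (v : V) (x : TensorAlgebra k V) :
    convUnit (𝓲 v * x) = (0 : A) := by simp [convUnit]

@[simp] theorem convUnit_comp_lmul (v : V) :
    (convUnit : TensorAlgebra k V →ₗ[k] A) ∘ₗ lmul v = 0 := by ext x; simp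

theorem convUnit_conv (a : TensorAlgebra k V →ₗ[k] A) : conv convUnit a = a := by
  apply ext_left
  · simp
  · intro v x _; simp [conv_ι_mul]

/-- The factor `f ∘ₗ pr` sees only the cut after the first letter. -/
theorem pr_conv (f : V →ₗ[k] A) (a : TensorAlgebra k V →ₗ[k] A) (v : V) (x : TensorAlgebra k V) :
    conv (f ∘ₗ pr) a (𝓲 v * x) = f v * a x := by
  have : (f ∘ₗ pr) ∘ₗ lmul v = LinearMap.mulLeft k (f v) ∘ₗ convUnit := by
    ext y; simp [convUnit, Algebra.algebraMap_eq_smul_one]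
  rw [conv_ι_mul, this, conv_mulLeft, convUnit_conv]
  simp

end Conv

/-- A word is empty or its first letter times the rest. Precomposed with a coalgebra map or a
coderivation, this identity becomes the recursion that determines the operator from its projection.
-/
theorem convUnit_add_pr_conv :
    (convUnit + conv ((𝓲) ∘ₗ pr) LinearMap.id : TensorAlgebra k V →ₗ[k] TensorAlgebra k V) =
      LinearMap.id := by
  apply ext_left
  · simp [convUnit]
  · intro v x _
    simp [pr_conv]

/-- The algebra map of tensor algebras induced by a linear map. -/
noncomputable def tmap (p : V →ₗ[k] W) : TensorAlgebra k V →ₐ[k] TensorAlgebra k W :=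
  TensorAlgebra.lift k ((𝓲) ∘ₗ p)

@[simp] theorem tmap_ι (p : V →ₗ[k] W) (v : V) : tmap p (𝓲 v) = 𝓲 (p v) := by simp [tmap]

theorem tmap_id : tmap (LinearMap.id : V →ₗ[k] V) = AlgHom.id k _ := by
  apply TensorAlgebra.hom_ext; ext v; simp

theorem tmap_tmap (q : W →ₗ[k] U) (p : V →ₗ[k] W) (x : TensorAlgebra k V) :
    tmap q (tmap p x) = tmap (q ∘ₗ p) x := by
  rw [← AlgHom.comp_apply]; congr 1
  apply TensorAlgebra.hom_ext; ext v; simp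

@[simp] theorem eps_tmap (p : V →ₗ[k] W) (x : TensorAlgebra k V) : eps (tmap p x) = eps x := by
  have : eps ∘ₗ (tmap p).toLinearMap = eps := by apply ext_left <;> simp
  exact LinearMap.congr_fun this x

@[simp] theorem pr_tmap (p : V →ₗ[k] W) (x : TensorAlgebra k V) : pr (tmap p x) = p (pr x) := by
  have : pr ∘ₗ (tmap p).toLinearMap = p ∘ₗ pr := by apply ext_left <;> simp
  exact LinearMap.congr_fun this x

/-- A linear map of tensor coalgebras compatible with the coproducts and the units. -/
structure IsCo (Φ : TensorAlgebra k V →ₗ[k] TensorAlgebra k W) : Prop where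
  delta : ∀ x, delta (Φ x) = TensorProduct.map Φ Φ (delta x)
  one : Φ 1 = 1
  eps : ∀ x, eps (Φ x) = eps x

/-- A coderivation of a tensor coalgebra, twisted by the coalgebra map `tmap p`. -/
def IsCod (p : V →ₗ[k] V) (Φ : TensorAlgebra k V →ₗ[k] TensorAlgebra k V) : Prop :=
  ∀ x, delta (Φ x) = TensorProduct.map Φ LinearMap.id (delta x) +
    TensorProduct.map (tmap p).toLinearMap Φ (delta x)

theorem isCo_tmap (p : V →ₗ[k] W) : IsCo (tmap p).toLinearMap where
  delta := by
    intro x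
    have : delta ∘ₗ (tmap p).toLinearMap =
        TensorProduct.map (tmap p).toLinearMap (tmap p).toLinearMap ∘ₗ delta := by
      apply ext_left
      · simp
      · intro v x hx
        simp only [LinearMap.comp_apply, AlgHom.toLinearMap_apply, map_mul, tmap_ι] at hx ⊢
        simp only [delta_ι_mul, map_add, map_tmul, hx]
        congr 1
        · simp
        · generalize delta x = t
          induction t using TensorProduct.induction_on with
          | zero => simp
          | tmul a b => simp
          | add a b ha hb => simp only [map_add, ha, hb]
    exact LinearMap.congr_fun this x
  one := by simp
  eps := by simp

theorem IsCo.comp {Ψ : TensorAlgebra k W →ₗ[k] TensorAlgebra k U}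
    {Φ : TensorAlgebra k V →ₗ[k] TensorAlgebra k W} (hΨ : IsCo Ψ) (hΦ : IsCo Φ) :
    IsCo (Ψ ∘ₗ Φ) where
  delta x := by
    rw [LinearMap.comp_apply, hΨ.delta, hΦ.delta, TensorProduct.map_comp, LinearMap.comp_apply]
  one := by simp [hΦ.one, hΨ.one]
  eps x := by simp [hΦ.eps, hΨ.eps]

section ConvComp

variable {A : Type*} [Ring A] [Algebra k A]

theorem IsCo.conv_comp {Φ : TensorAlgebra k V →ₗ[k] TensorAlgebra k W} (hΦ : IsCo Φ)
    (a b : TensorAlgebra k W →ₗ[k] A) : conv a b ∘ₗ Φ = conv (a ∘ₗ Φ) (b ∘ₗ Φ) := by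
  ext x
  simp only [conv_apply, LinearMap.comp_apply, hΦ.delta, TensorProduct.map_comp]

theorem IsCod.conv_comp {p : V →ₗ[k] V} {Φ : TensorAlgebra k V →ₗ[k] TensorAlgebra k V}
    (hΦ : IsCod p Φ) (a b : TensorAlgebra k V →ₗ[k] A) :
    conv a b ∘ₗ Φ = conv (a ∘ₗ Φ) b + conv (a ∘ₗ (tmap p).toLinearMap) (b ∘ₗ Φ) := by
  ext x
  simp only [conv_apply, LinearMap.comp_apply, hΦ x, TensorProduct.map_comp, map_add,
    LinearMap.add_apply]
  congr 2
  rw [← LinearMap.comp_apply, ← TensorProduct.map_comp, LinearMap.comp_id]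

theorem IsCo.convUnit_comp {Φ : TensorAlgebra k V →ₗ[k] TensorAlgebra k W} (hΦ : IsCo Φ) :
    (convUnit : TensorAlgebra k W →ₗ[k] A) ∘ₗ Φ = convUnit := by
  ext x; simp [convUnit, hΦ.eps]

end ConvComp

/-- A coalgebra map is recovered from its projection to tensors of length one. -/
theorem IsCo.eq_conv {Φ : TensorAlgebra k V →ₗ[k] TensorAlgebra k W} (hΦ : IsCo Φ) :
    Φ = convUnit + conv ((𝓲) ∘ₗ pr ∘ₗ Φ) Φ := by
  conv_lhs => rw [← LinearMap.id_comp Φ, ← convUnit_add_pr_conv, LinearMap.add_comp,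
    hΦ.conv_comp, hΦ.convUnit_comp]
  rfl

theorem mul'_comp_eps (x : TensorAlgebra k V) :
    LinearMap.mul' k k (TensorProduct.map eps eps (delta x)) = eps x := by
  have : conv (A := k) (eps : TensorAlgebra k V →ₗ[k] k) eps = eps := by
    apply ext_left
    · simp
    · intro v x _
      have : (Tens.eps : TensorAlgebra k V →ₗ[k] k) ∘ₗ lmul v = 0 := by ext; simp
      simp [conv_ι_mul, this]
  exact LinearMap.congr_fun this x

/-- The counit is idempotent for convolution; composing this identity with `Φ` gives `ε Φ = ε Φ + ε
Φ`. -/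
theorem IsCod.eps {p : V →ₗ[k] V} {Φ : TensorAlgebra k V →ₗ[k] TensorAlgebra k V}
    (hΦ : IsCod p Φ) (x : TensorAlgebra k V) : Tens.eps (Φ x) = 0 := by
  have e1 : conv (A := k) Tens.eps Tens.eps = (Tens.eps : TensorAlgebra k V →ₗ[k] k) := by
    ext x; exact mul'_comp_eps x
  have hu : (convUnit : TensorAlgebra k V →ₗ[k] k) = Tens.eps := by
    ext x; simp [convUnit]
  have e2 := hΦ.conv_comp (A := k) Tens.eps Tens.eps
  have e3 : (Tens.eps : TensorAlgebra k V →ₗ[k] k) ∘ₗ (tmap p).toLinearMap = Tens.eps := by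
    ext x; simp
  have e4 : ∀ a : TensorAlgebra k V →ₗ[k] k, conv a Tens.eps = a := by
    intro a
    ext x
    induction x using left_induction generalizing a with
    | one => simp
    | mul v x h => simp [conv_ι_mul, h]
    | add x y hx hy => simp [hx, hy]
    | smul r x hx => simp [hx]
  rw [e1, e3, ← hu, convUnit_conv, hu, e4] at e2
  have := LinearMap.congr_fun e2 x
  simpa using this

/-- A coderivation is recovered from its projection to tensors of length one. -/
theorem IsCod.eq_conv {p : V →ₗ[k] V} {Φ : TensorAlgebra k V →ₗ[k] TensorAlgebra k V}
    (hΦ : IsCod p Φ) :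
    Φ = conv ((𝓲) ∘ₗ pr ∘ₗ Φ) LinearMap.id + conv ((𝓲) ∘ₗ p ∘ₗ pr) Φ := by
  conv_lhs => rw [← LinearMap.id_comp Φ, ← convUnit_add_pr_conv, LinearMap.add_comp,
    hΦ.conv_comp]
  have h : (convUnit : TensorAlgebra k V →ₗ[k] TensorAlgebra k V) ∘ₗ Φ = 0 := by
    ext x; simp [convUnit, hΦ.eps]
  have h2 : ((𝓲) ∘ₗ pr) ∘ₗ (tmap p).toLinearMap = ((𝓲) ∘ₗ p ∘ₗ pr) := by
    ext x; simp
  rw [h, h2, zero_add]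
  rfl

end Basic

/-! ### Cofreeness: operators cogenerated by their projections -/

section Existence

variable {k : Type u} [CommRing k] {V : Type v} [AddCommGroup V] [Module k V]
  {W : Type w} [AddCommGroup W] [Module k W] {U : Type x} [AddCommGroup U] [Module k U]

local notation "𝓲" => TensorAlgebra.ι k

/-- Each cut contributes a letter times a value of `b`. Its length-one part is the letter times the
counit of the right factor, so only the cut at the very end survives. -/
theorem pr_conv_eq (F : TensorAlgebra k V →ₗ[k] W)
    {b : TensorAlgebra k V →ₗ[k] TensorAlgebra k W} (hb : ∀ x, eps (b x) = eps x)
    (x : TensorAlgebra k V) : pr (conv (𝓲 ∘ₗ F) b x) = F x := by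
  induction x using left_induction generalizing F with
  | one => simp [hb]
  | mul v x h =>
    have := h (F ∘ₗ lmul v)
    simp only [conv_ι_mul, map_add, LinearMap.comp_apply, pr_ι_mul, hb, eps_ι_mul, zero_smul,
      zero_add]
    exact this
  | add x y hx hy => simp [hx, hy]
  | smul r x hx => simp [hx]

theorem IsCo.ι_mul {Φ : TensorAlgebra k V →ₗ[k] TensorAlgebra k W} (hΦ : IsCo Φ)
    (v : V) (x : TensorAlgebra k V) :
    Φ (𝓲 v * x) = conv (𝓲 ∘ₗ pr ∘ₗ Φ ∘ₗ lmul v) Φ x := by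
  conv_lhs => rw [hΦ.eq_conv]
  simp [conv_ι_mul, hΦ.one]
  rfl

theorem IsCo.ext {Φ Ψ : TensorAlgebra k V →ₗ[k] TensorAlgebra k W} (hΦ : IsCo Φ) (hΨ : IsCo Ψ)
    (h : ∀ x, pr (Φ x) = pr (Ψ x)) : Φ = Ψ := by
  -- The value on `v x` is a convolution with a new first factor evaluated at `x`, so the claim is
  -- carried for every first factor `G`.
  have key : ∀ x, (∀ G : TensorAlgebra k V →ₗ[k] W,
      conv (𝓲 ∘ₗ G) Φ x = conv (𝓲 ∘ₗ G) Ψ x) ∧ Φ x = Ψ x := by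
    intro x
    induction x using left_induction with
    | one => simp [hΦ.one, hΨ.one]
    | mul v x hx =>
      have h1 : Φ (𝓲 v * x) = Ψ (𝓲 v * x) := by
        have : pr ∘ₗ Φ ∘ₗ lmul v = pr ∘ₗ Ψ ∘ₗ lmul v := by ext y; simp [h]
        rw [hΦ.ι_mul, hΨ.ι_mul, this, hx.1]
      refine ⟨fun G => ?_, h1⟩
      rw [conv_ι_mul, conv_ι_mul, h1]
      congr 1
      exact hx.1 (G ∘ₗ lmul v)
    | add x y hx hy => exact ⟨fun G => by simp [hx.1, hy.1], by simp [hx.2, hy.2]⟩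
    | smul r x hx => exact ⟨fun G => by simp [hx.1], by simp [hx.2]⟩
  ext x
  exact (key x).2

theorem IsCod.ext {p : V →ₗ[k] V} {Φ Ψ : TensorAlgebra k V →ₗ[k] TensorAlgebra k V}
    (hΦ : IsCod p Φ) (hΨ : IsCod p Ψ) (h : ∀ x, pr (Φ x) = pr (Ψ x)) : Φ = Ψ := by
  have e : pr ∘ₗ Φ = pr ∘ₗ Ψ := by ext x; simp [h]
  apply ext_left
  · rw [hΦ.eq_conv, hΨ.eq_conv]; simp [h]
  · intro v x hx
    rw [hΦ.eq_conv, hΨ.eq_conv, e]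
    simp only [LinearMap.add_apply]
    rw [← LinearMap.comp_assoc pr p 𝓲, pr_conv, pr_conv, hx]

/-- Transport of a coderivation along a coalgebra map with a one-sided inverse; the sign twist is
transported with it. -/
theorem IsCo.comp_isCod {p : W →ₗ[k] W} {q : V →ₗ[k] V}
    {Φ : TensorAlgebra k V →ₗ[k] TensorAlgebra k W}
    {Ψ : TensorAlgebra k W →ₗ[k] TensorAlgebra k V} (hΦ : IsCo Φ) (hΨ : IsCo Ψ)
    {D : TensorAlgebra k W →ₗ[k] TensorAlgebra k W} (hD : IsCod p D)
    (h : Ψ ∘ₗ Φ = LinearMap.id)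
    (hq : Ψ ∘ₗ (tmap p).toLinearMap ∘ₗ Φ = (tmap q).toLinearMap) : IsCod q (Ψ ∘ₗ D ∘ₗ Φ) := by
  intro x
  have h1 : ∀ b, Ψ (Φ b) = b := LinearMap.congr_fun h
  have h2 : ∀ b, Ψ (tmap p (Φ b)) = tmap q b := LinearMap.congr_fun hq
  simp only [LinearMap.comp_apply, hΨ.delta, hD _, hΦ.delta]
  generalize Tens.delta x = t
  induction t using TensorProduct.induction_on with
  | zero => simp
  | tmul a b => simp [h1, h2]
  | add a b ha hb => simp only [map_add] at ha hb ⊢; rw [add_add_add_comm, ha, hb]; abel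

/-- The recursion step of the coalgebra map cogenerated by `F`. -/
noncomputable def hatStep (F : TensorAlgebra k V →ₗ[k] W) :
    V →ₗ[k] Module.End k (TensorAlgebra k V ⊗[k] TensorAlgebra k W) :=
  LinearMap.mk₂ k (fun v t => (lmul v).rTensor (TensorAlgebra k W) t +
      𝓲 v ⊗ₜ[k] LinearMap.mul' k (TensorAlgebra k W) ((𝓲 ∘ₗ F).rTensor (TensorAlgebra k W) t))
    (by intros; simp [LinearMap.rTensor_add, add_tmul]; abel)
    (by intros; simp [LinearMap.rTensor_smul, smul_tmul'])
    (by intros; simp [tmul_add]; abel)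
    (by intros; simp)

theorem hatStep_apply (F : TensorAlgebra k V →ₗ[k] W) (v : V)
    (t : TensorAlgebra k V ⊗[k] TensorAlgebra k W) :
    hatStep F v t = (lmul v).rTensor (TensorAlgebra k W) t +
      𝓲 v ⊗ₜ[k] LinearMap.mul' k (TensorAlgebra k W)
        ((𝓲 ∘ₗ F).rTensor (TensorAlgebra k W) t) := rfl

/-- The coalgebra map cogenerated by `F`. -/
noncomputable def hat (F : TensorAlgebra k V →ₗ[k] W) :
    TensorAlgebra k V →ₗ[k] TensorAlgebra k W :=
  convUnit + LinearMap.mul' k (TensorAlgebra k W) ∘ₗ (𝓲 ∘ₗ F).rTensor (TensorAlgebra k W) ∘ₗ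
    fold (hatStep F) (1 ⊗ₜ[k] 1)

section

variable (F : TensorAlgebra k V →ₗ[k] W) (hF : F 1 = 0)

include hF

/-- The recursion for `hat` needs its values on all right factors of a word at once. The fold
therefore carries the sum of `x' ⊗ hat F x''` over the cuts of a word with nonempty left factor; the
last term only adjusts the starting value at the empty word. -/
theorem fold_hatStep (x : TensorAlgebra k V) :
    fold (hatStep F) (1 ⊗ₜ[k] 1) x =
      (hat F).lTensor (TensorAlgebra k V) (delta x) - 1 ⊗ₜ[k] hat F x +
        1 ⊗ₜ[k] convUnit x := by
  induction x using left_induction with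
  | one => simp [hat, hF]
  | mul v x h =>
    have h2 : LinearMap.mul' k (TensorAlgebra k W) ((𝓲 ∘ₗ F).rTensor (TensorAlgebra k W)
        (fold (hatStep F) (1 ⊗ₜ[k] 1) x)) = hat F x - convUnit x := by simp [hat]
    have h3 : ∀ t : TensorAlgebra k V ⊗[k] TensorAlgebra k V,
        (lmul v).rTensor (TensorAlgebra k W) ((hat F).lTensor (TensorAlgebra k V) t) =
        (hat F).lTensor (TensorAlgebra k V) ((lmul v).rTensor (TensorAlgebra k V) t) := by
      intro t
      induction t using TensorProduct.induction_on with
      | zero => simp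
      | tmul a b => simp
      | add a b ha hb => simp only [map_add, ha, hb]
    rw [fold_ι_mul, hatStep_apply, h2, h, delta_ι_mul]
    simp [tmul_sub, h3]
  | add x y hx hy => simp only [map_add, hx, hy, tmul_add]; abel
  | smul r x hx => simp [hx, smul_sub]

/-- Splitting off the first block; blocks are nonempty because `F 1 = 0`. -/
theorem hat_eq : hat F = convUnit + conv (𝓲 ∘ₗ F) (hat F) := by
  conv_lhs => rw [hat]
  congr 1
  ext x
  simp only [LinearMap.comp_apply, fold_hatStep F hF, conv_apply]
  simp only [map_add, map_sub, LinearMap.rTensor_tmul, LinearMap.comp_apply, hF, map_zero,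
    zero_tmul, sub_zero, add_zero]
  generalize Tens.delta x = t
  congr 1
  induction t using TensorProduct.induction_on with
  | zero => simp
  | tmul a b => simp
  | add a b ha hb => simp only [map_add, ha, hb]

theorem hat_one : hat F 1 = 1 := by
  rw [hat_eq F hF]; simp [hF]

theorem hat_ι_mul (v : V) (x : TensorAlgebra k V) :
    hat F (𝓲 v * x) = conv (𝓲 ∘ₗ F ∘ₗ lmul v) (hat F) x := by
  conv_lhs => rw [hat_eq F hF]
  simp [conv_ι_mul, hF]
  rfl

theorem isCo_hat : IsCo (hat F) where
  delta := by
    -- Each block is sent to a single letter, so a cut of the image lies between blocks. The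
    -- companion claim allows an arbitrary `G` on the first block, since the induction alters that
    -- block.
    have key : ∀ x, (∀ G : TensorAlgebra k V →ₗ[k] W, delta (conv (𝓲 ∘ₗ G) (hat F) x) =
        1 ⊗ₜ[k] conv (𝓲 ∘ₗ G) (hat F) x +
          TensorProduct.map (conv (𝓲 ∘ₗ G) (hat F)) (hat F) (delta x)) ∧
        delta (hat F x) = TensorProduct.map (hat F) (hat F) (delta x) := by
      intro x
      induction x using left_induction with
      | one =>
        refine ⟨fun G => ?_, by simp [hat_one F hF]⟩
        simp [hat_one F hF, delta_ι]
      | mul v x hx =>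
        have comp : ∀ f : TensorAlgebra k V →ₗ[k] TensorAlgebra k W, ∀ t,
            TensorProduct.map f (hat F) ((lmul v).rTensor (TensorAlgebra k V) t) =
            TensorProduct.map (f ∘ₗ lmul v) (hat F) t := by
          intro f t
          rw [LinearMap.rTensor, ← LinearMap.comp_apply (TensorProduct.map _ _),
            ← TensorProduct.map_comp, LinearMap.comp_id]
        have h1 : delta (hat F (𝓲 v * x)) =
            TensorProduct.map (hat F) (hat F) (delta (𝓲 v * x)) := by
          have : hat F ∘ₗ lmul v = conv (𝓲 ∘ₗ F ∘ₗ lmul v) (hat F) := by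
            ext y; exact hat_ι_mul F hF v y
          rw [delta_ι_mul, map_add, map_tmul, hat_one F hF, comp, this, hat_ι_mul F hF, hx.1]
        refine ⟨fun G => ?_, h1⟩
        have e : conv (𝓲 ∘ₗ G) (hat F) ∘ₗ lmul v =
            LinearMap.mulLeft k (𝓲 (G 1)) ∘ₗ hat F ∘ₗ lmul v +
              conv (𝓲 ∘ₗ G ∘ₗ lmul v) (hat F) := by
          ext y; simp [conv_ι_mul]; rfl
        have e2 : ∀ t, TensorProduct.map (LinearMap.mulLeft k (𝓲 (G 1)) ∘ₗ hat F ∘ₗ lmul v)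
            (hat F) t = (lmul (G 1)).rTensor (TensorAlgebra k W)
              (TensorProduct.map (hat F ∘ₗ lmul v) (hat F) t) := by
          intro t
          induction t using TensorProduct.induction_on with
          | zero => simp
          | tmul a b => simp
          | add a b ha hb => simp only [map_add, ha, hb]
        have e3 := hx.1 (G ∘ₗ lmul v)
        rw [conv_ι_mul, map_add, LinearMap.comp_apply 𝓲 G, delta_ι_mul, h1, LinearMap.comp_assoc,
          e3, delta_ι_mul]
        simp only [map_add, map_tmul, comp, e, TensorProduct.map_add_left, LinearMap.add_apply, e2,
          LinearMap.rTensor_tmul, hat_one F hF, tmul_add, conv_one, lmul_apply,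
          LinearMap.comp_apply]
        abel
      | add x y hx hy =>
        exact ⟨fun G => by simp only [map_add, hx.1, hy.1, tmul_add]; abel,
          by simp only [map_add, hx.2, hy.2]⟩
      | smul r x hx => exact ⟨fun G => by simp [hx.1], by simp [hx.2]⟩
    exact fun x => (key x).2
  one := hat_one F hF
  eps := by
    have : eps ∘ₗ hat F = eps := by
      apply ext_left
      · simp [hat_one F hF]
      · intro v x _
        have : ∀ x, ∀ G : TensorAlgebra k V →ₗ[k] W, eps (conv (𝓲 ∘ₗ G) (hat F) x) = 0 := by
          intro x
          induction x using left_induction with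
          | one => simp
          | mul v x hx =>
            intro G
            have := hx (G ∘ₗ lmul v)
            simp only [conv_ι_mul, map_add, LinearMap.comp_apply, eps_ι_mul, zero_add]
            exact this
          | add x y hx hy => intro G; simp [hx, hy]
          | smul r x hx => intro G; simp [hx]
        simp only [LinearMap.comp_apply, hat_ι_mul F hF, eps_ι_mul]
        exact this x _
    exact LinearMap.congr_fun this

theorem pr_hat (x : TensorAlgebra k V) : pr (hat F x) = F x := by
  rw [hat_eq F hF, LinearMap.add_apply, map_add, pr_conv_eq _ (isCo_hat F hF).eps]
  simp [convUnit, Algebra.algebraMap_eq_smul_one]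

end

/-- The `tmap p`-twisted coderivation cogenerated by `Q`. -/
noncomputable def cod (p : V →ₗ[k] V) (Q : TensorAlgebra k V →ₗ[k] V) :
    TensorAlgebra k V →ₗ[k] TensorAlgebra k V :=
  -- A sum over cuts into three factors: `Q` replaces the middle one by a letter, and the left one,
  -- which `Q` has passed, is twisted by `p`.
  conv (tmap p).toLinearMap (conv (𝓲 ∘ₗ Q) LinearMap.id)

@[simp] theorem cod_one (p : V →ₗ[k] V) (Q : TensorAlgebra k V →ₗ[k] V) :
    cod p Q 1 = 𝓲 (Q 1) := by simp [cod]

theorem cod_ι_mul (p : V →ₗ[k] V) (Q : TensorAlgebra k V →ₗ[k] V) (v : V)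
    (x : TensorAlgebra k V) :
    cod p Q (𝓲 v * x) = conv (𝓲 ∘ₗ Q) LinearMap.id (𝓲 v * x) + 𝓲 (p v) * cod p Q x := by
  have : (tmap p).toLinearMap ∘ₗ lmul v =
      LinearMap.mulLeft k (𝓲 (p v)) ∘ₗ (tmap p).toLinearMap := by ext y; simp
  simp [cod, conv_ι_mul _ _ v x, this, conv_mulLeft]

theorem isCod_cod (p : V →ₗ[k] V) (Q : TensorAlgebra k V →ₗ[k] V) : IsCod p (cod p Q) := by
  have comp : ∀ (v : V) (f g : TensorAlgebra k V →ₗ[k] TensorAlgebra k V), ∀ t,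
      TensorProduct.map f g ((lmul v).rTensor (TensorAlgebra k V) t) =
      TensorProduct.map (f ∘ₗ lmul v) g t := by
    intro v f g t
    rw [LinearMap.rTensor, ← LinearMap.comp_apply (TensorProduct.map _ _),
      ← TensorProduct.map_comp, LinearMap.comp_id]
  have e2 : ∀ (r : V) (f g : TensorAlgebra k V →ₗ[k] TensorAlgebra k V) t,
      TensorProduct.map (LinearMap.mulLeft k (𝓲 r) ∘ₗ f) g t =
        (lmul r).rTensor (TensorAlgebra k V) (TensorProduct.map f g t) := by
    intro r f g t
    induction t using TensorProduct.induction_on with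
    | zero => simp
    | tmul a b => simp
    | add a b ha hb => simp only [map_add, ha, hb]
  have key : ∀ x, ∀ G : TensorAlgebra k V →ₗ[k] V, delta (conv (𝓲 ∘ₗ G) LinearMap.id x) =
      1 ⊗ₜ[k] conv (𝓲 ∘ₗ G) LinearMap.id x +
        TensorProduct.map (conv (𝓲 ∘ₗ G) LinearMap.id) LinearMap.id (delta x) := by
    intro x
    induction x using left_induction with
    | one => intro G; simp [delta_ι]
    | mul v x hx =>
      intro G
      have e : conv (𝓲 ∘ₗ G) LinearMap.id ∘ₗ lmul v =
          LinearMap.mulLeft k (𝓲 (G 1)) ∘ₗ lmul v +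
            conv (𝓲 ∘ₗ G ∘ₗ lmul v) LinearMap.id := by
        ext y; simp [conv_ι_mul]; rfl
      have e3 := hx (G ∘ₗ lmul v)
      rw [conv_ι_mul, map_add, LinearMap.comp_apply 𝓲 G, LinearMap.comp_assoc, e3, delta_ι_mul,
        LinearMap.id_apply, delta_ι_mul]
      simp only [map_add, map_tmul, comp, e, TensorProduct.map_add_left, LinearMap.add_apply, e2,
          LinearMap.rTensor_tmul, tmul_add, conv_one, lmul_apply, LinearMap.comp_apply,
          LinearMap.id_apply, mul_one]
      have e4 : (lmul v).rTensor (TensorAlgebra k V) (delta x) =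
        TensorProduct.map (lmul v) LinearMap.id (delta x) := rfl
      rw [e4]
      abel
    | add x y hx hy => intro G; simp only [map_add, hx, hy, tmul_add]; abel
    | smul r x hx => intro G; simp [hx]
  intro x
  induction x using left_induction with
  | one => simp [delta_ι, add_comm]
  | mul v x hx =>
    have e : cod p Q ∘ₗ lmul v = conv (𝓲 ∘ₗ Q) LinearMap.id ∘ₗ lmul v +
        LinearMap.mulLeft k (𝓲 (p v)) ∘ₗ cod p Q := by
      ext y; simp [cod_ι_mul]
    have e5 : (tmap p).toLinearMap ∘ₗ lmul v =
      LinearMap.mulLeft k (𝓲 (p v)) ∘ₗ (tmap p).toLinearMap := by ext y; simp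
    conv_lhs => rw [cod_ι_mul, map_add, key, delta_ι_mul (p v), hx]
    rw [delta_ι_mul]
    simp only [map_add, map_tmul, comp, e, e5, TensorProduct.map_add_left, LinearMap.add_apply, e2,
      cod_one, LinearMap.id_apply, conv_one, LinearMap.comp_apply, mul_one, cod_ι_mul, tmul_add,
      AlgHom.toLinearMap_apply, map_one]
    abel
  | add x y hx hy => simp only [map_add, hx, hy]; abel
  | smul r x hx => simp [hx]

theorem pr_cod (p : V →ₗ[k] V) (Q : TensorAlgebra k V →ₗ[k] V) (x : TensorAlgebra k V) :
    pr (cod p Q x) = Q x := by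
  have : pr ∘ₗ cod p Q = Q := by
    apply ext_left
    · simp
    · intro v x _
      simp only [LinearMap.comp_apply, cod_ι_mul, map_add, pr_ι_mul, (isCod_cod p Q).eps,
        zero_smul, add_zero]
      exact pr_conv_eq _ (by simp) _
  exact LinearMap.congr_fun this x

end Existence

/-- The sign `(-1)^i` as a scalar. -/
def sg (k : Type u) [CommRing k] (i : ℤ) : k := ((i.negOnePow : ℤˣ) : ℤ)

/-! ### Signs -/

section Sign

variable {k : Type u} [CommRing k]

theorem sg_add (i j : ℤ) : sg k (i + j) = sg k i * sg k j := by
  simp [sg, Int.negOnePow_add]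

@[simp] theorem sg_zero : sg k 0 = 1 := by simp [sg]

@[simp] theorem sg_one : sg k 1 = -1 := by simp [sg]

theorem sg_even {i : ℤ} (h : Even i) : sg k i = 1 := by simp [sg, Int.negOnePow_even i h]

theorem sg_odd {i : ℤ} (h : ¬ Even i) : sg k i = -1 := by
  simp [sg, Int.negOnePow_odd i (Int.not_even_iff_odd.1 h)]

@[simp] theorem sg_mul_self (i : ℤ) : sg k i * sg k i = 1 := by
  rw [← sg_add]; exact sg_even ⟨i, rfl⟩

theorem sg_congr {i j : ℤ} (h : Even (i - j)) : sg k i = sg k j := by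
  have : sg k i = sg k (i - j) * sg k j := by rw [← sg_add]; simp
  rw [this, sg_even h, one_mul]

theorem units_smul_eq {M : Type*} [AddCommGroup M] [Module k M] (c : ℤˣ) (m : M) :
    c • m = (((c : ℤˣ) : ℤ) : k) • m := by
  rw [Units.smul_def, Int.cast_smul_eq_zsmul]

theorem negOnePow_smul {M : Type*} [AddCommGroup M] [Module k M] (i : ℤ) (m : M) :
    i.negOnePow • m = sg k i • m := units_smul_eq _ _

end Sign

/-- A grading of a module, together with its sign operator. -/
class SignGraded (k : Type u) [CommRing k] (V : Type v) [AddCommGroup V] [Module k V] where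
  hdeg : ℤ → Submodule k V
  par : V →ₗ[k] V
  par_apply : ∀ {i : ℤ} {x : V}, x ∈ hdeg i → par x = sg k i • x
  iSup_hdeg : ⨆ i, hdeg i = ⊤

/-- A homogeneous element together with its degree. -/
structure Letter (k : Type u) [CommRing k] (V : Type v) [AddCommGroup V] [Module k V]
    [SignGraded k V] where
  deg : ℤ
  val : V
  mem : val ∈ SignGraded.hdeg (k := k) deg

/-! ### Homogeneous words, degrees and unshuffles -/

section Words

variable {k : Type u} [CommRing k] {V : Type v} [AddCommGroup V] [Module k V] [SignGraded k V]
  {W : Type w} [AddCommGroup W] [Module k W] [SignGraded k W]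
  {M : Type*} [AddCommGroup M] [Module k M] {M' : Type*} [AddCommGroup M'] [Module k M']

local notation "𝓲" => TensorAlgebra.ι k

/-- The sign operator `x ↦ (-1)^{i deg x} x`. -/
noncomputable def psgn (i : ℤ) : V →ₗ[k] V := if Even i then LinearMap.id else SignGraded.par

theorem psgn_apply (i : ℤ) {j : ℤ} {x : V} (hx : x ∈ SignGraded.hdeg (k := k) j) :
    psgn (k := k) i x = sg k (i * j) • x := by
  unfold psgn
  split_ifs with h
  · rw [sg_even (h.mul_right j)]; simp
  · rw [SignGraded.par_apply hx]
    by_cases hj : Even j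
    · rw [sg_even hj, sg_even (hj.mul_left i)]
    · rw [sg_odd hj, sg_odd]
      rw [Int.even_mul]; tauto

/-- The word spelled by a list of letters. -/
noncomputable def wd : List (Letter k V) → TensorAlgebra k V
  | [] => 1
  | a :: l => 𝓲 a.val * wd l

@[simp] theorem wd_nil : wd ([] : List (Letter k V)) = 1 := rfl

@[simp] theorem wd_cons (a : Letter k V) (l : List (Letter k V)) :
    wd (a :: l) = 𝓲 a.val * wd l := rfl

/-- The total degree of a list of letters. -/
def tdeg : List (Letter k V) → ℤ
  | [] => 0
  | a :: l => a.deg + tdeg l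

@[simp] theorem tdeg_nil : tdeg ([] : List (Letter k V)) = 0 := rfl

@[simp] theorem tdeg_cons (a : Letter k V) (l : List (Letter k V)) :
    tdeg (a :: l) = a.deg + tdeg l := rfl

/-- Only spanning by homogeneous elements is used here, not independence of the graded parts. -/
theorem letter_induction {C : V → Prop} (h0 : C 0) (hl : ∀ a : Letter k V, C a.val)
    (add : ∀ x y, C x → C y → C (x + y)) (v : V) : C v := by
  have hv : v ∈ ⨆ i, SignGraded.hdeg (k := k) (V := V) i := by
    rw [SignGraded.iSup_hdeg]; trivial
  induction hv using Submodule.iSup_induction' with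
  | mem i x hx => exact hl ⟨i, x, hx⟩
  | zero => exact h0
  | add x y _ _ hx hy => exact add _ _ hx hy

theorem span_wd : Submodule.span k (Set.range (wd : List (Letter k V) → TensorAlgebra k V)) = ⊤ := by
  rw [eq_top_iff]
  rintro x -
  induction x using left_induction with
  | one => exact Submodule.subset_span ⟨[], rfl⟩
  | mul v x hx =>
    induction hx using Submodule.span_induction with
    | mem x hx =>
      obtain ⟨l, rfl⟩ := hx
      refine letter_induction (k := k) (C := fun v => 𝓲 v * wd l ∈ _) ?_ ?_ ?_ v
      · simp
      · exact fun a => Submodule.subset_span ⟨a :: l, rfl⟩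
      · intro x y hx hy; rw [map_add, add_mul]; exact add_mem hx hy
    | zero => simp
    | add x y _ _ hx hy => rw [mul_add]; exact add_mem hx hy
    | smul r x _ hx => rw [mul_smul_comm]; exact Submodule.smul_mem _ _ hx
  | add x y hx hy => exact add_mem hx hy
  | smul r x hx => exact Submodule.smul_mem _ _ hx

theorem wd_induction {C : TensorAlgebra k V → Prop} (hw : ∀ l, C (wd l)) (h0 : C 0)
    (add : ∀ x y, C x → C y → C (x + y))
    (smul : ∀ (r : k) x, C x → C (r • x)) (x : TensorAlgebra k V) : C x := by
  have hx : x ∈ Submodule.span k (Set.range (wd : List (Letter k V) → TensorAlgebra k V)) := by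
    rw [span_wd]; trivial
  induction hx using Submodule.span_induction with
  | mem x hx => obtain ⟨l, rfl⟩ := hx; exact hw l
  | zero => exact h0
  | add x y _ _ hx hy => exact add _ _ hx hy
  | smul r x _ hx => exact smul _ _ hx

theorem ext_wd {f g : TensorAlgebra k V →ₗ[k] M} (h : ∀ l : List (Letter k V), f (wd l) = g (wd l)) :
    f = g := by
  ext x
  induction x using wd_induction with
  | hw l => exact h l
  | h0 => simp
  | add x y hx hy => simp [hx, hy]
  | smul r x hx => simp [hx]

variable (k V) in
/-- The tensors of total degree `i`. -/
def gr (i : ℤ) : Submodule k (TensorAlgebra k V) :=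
  Submodule.span k {x | ∃ l : List (Letter k V), tdeg l = i ∧ wd l = x}

theorem wd_mem_gr (l : List (Letter k V)) : wd l ∈ gr k V (tdeg l) :=
  Submodule.subset_span ⟨l, rfl, rfl⟩

theorem one_mem_gr : (1 : TensorAlgebra k V) ∈ gr k V 0 := wd_mem_gr []

theorem ι_mul_mem_gr {i j : ℤ} {v : V} (hv : v ∈ SignGraded.hdeg (k := k) i)
    {x : TensorAlgebra k V} (hx : x ∈ gr k V j) : 𝓲 v * x ∈ gr k V (i + j) := by
  induction hx using Submodule.span_induction with
  | mem x hx =>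
    obtain ⟨l, rfl, rfl⟩ := hx
    exact wd_mem_gr (⟨i, v, hv⟩ :: l)
  | zero => simp
  | add x y _ _ hx hy => rw [mul_add]; exact add_mem hx hy
  | smul r x _ hx => rw [mul_smul_comm]; exact Submodule.smul_mem _ _ hx

theorem ι_mem_gr {i : ℤ} {v : V} (hv : v ∈ SignGraded.hdeg (k := k) i) : 𝓲 v ∈ gr k V i := by
  simpa using ι_mul_mem_gr hv one_mem_gr

/-- An operator on tensors is homogeneous of degree `s`. -/
def Deg (s : ℤ) (Φ : TensorAlgebra k V →ₗ[k] TensorAlgebra k W) : Prop :=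
  ∀ i, ∀ x ∈ gr k V i, Φ x ∈ gr k W (i + s)

/-- A linear map out of the tensors is homogeneous of degree `s`. -/
def FDeg (s : ℤ) (F : TensorAlgebra k V →ₗ[k] W) : Prop :=
  ∀ i, ∀ x ∈ gr k V i, F x ∈ SignGraded.hdeg (k := k) (i + s)

/-- A linear map is homogeneous of degree `s`. -/
def LDeg (s : ℤ) (F : V →ₗ[k] W) : Prop :=
  ∀ i, ∀ x ∈ SignGraded.hdeg (k := k) (V := V) i, F x ∈ SignGraded.hdeg (k := k) (i + s)

theorem deg_of_wd {s : ℤ} {Φ : TensorAlgebra k V →ₗ[k] TensorAlgebra k W}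
    (h : ∀ l, Φ (wd l) ∈ gr k W (tdeg l + s)) : Deg s Φ := by
  intro i x hx
  induction hx using Submodule.span_induction with
  | mem x hx => obtain ⟨l, rfl, rfl⟩ := hx; exact h l
  | zero => simp
  | add x y _ _ hx hy => rw [map_add]; exact add_mem hx hy
  | smul r x _ hx => rw [map_smul]; exact Submodule.smul_mem _ _ hx

theorem fdeg_of_wd {s : ℤ} {F : TensorAlgebra k V →ₗ[k] W}
    (h : ∀ l, F (wd l) ∈ SignGraded.hdeg (k := k) (tdeg l + s)) : FDeg s F := by
  intro i x hx
  induction hx using Submodule.span_induction with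
  | mem x hx => obtain ⟨l, rfl, rfl⟩ := hx; exact h l
  | zero => simp
  | add x y _ _ hx hy => rw [map_add]; exact add_mem hx hy
  | smul r x _ hx => rw [map_smul]; exact Submodule.smul_mem _ _ hx

theorem fdeg_pr : FDeg 0 (pr : TensorAlgebra k V →ₗ[k] V) := by
  apply fdeg_of_wd
  rintro (_ | ⟨a, _ | ⟨b, l⟩⟩)
  · simp
  · simpa using a.mem
  · simp

theorem FDeg.add {s : ℤ} {F G : TensorAlgebra k V →ₗ[k] W} (hF : FDeg s F) (hG : FDeg s G) :
    FDeg s (F + G) := fun i x hx => add_mem (hF i x hx) (hG i x hx)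

theorem FDeg.sub {s : ℤ} {F G : TensorAlgebra k V →ₗ[k] W} (hF : FDeg s F) (hG : FDeg s G) :
    FDeg s (F - G) := fun i x hx => sub_mem (hF i x hx) (hG i x hx)

theorem FDeg.smul {s : ℤ} {F : TensorAlgebra k V →ₗ[k] W} (r : k) (hF : FDeg s F) :
    FDeg s (r • F) := fun i x hx => Submodule.smul_mem _ _ (hF i x hx)

theorem Deg.comp {U : Type x} [AddCommGroup U] [Module k U] [SignGraded k U] {s t r : ℤ}
    {Ψ : TensorAlgebra k W →ₗ[k] TensorAlgebra k U}
    {Φ : TensorAlgebra k V →ₗ[k] TensorAlgebra k W} (hΨ : Deg t Ψ) (hΦ : Deg s Φ)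
    (h : s + t = r) : Deg r (Ψ ∘ₗ Φ) := by
  subst h
  intro i x hx
  rw [← add_assoc]
  exact hΨ _ _ (hΦ _ _ hx)

theorem FDeg.comp {U : Type x} [AddCommGroup U] [Module k U] [SignGraded k U] {s t r : ℤ}
    {Ψ : TensorAlgebra k W →ₗ[k] U}
    {Φ : TensorAlgebra k V →ₗ[k] TensorAlgebra k W} (hΨ : FDeg t Ψ) (hΦ : Deg s Φ)
    (h : s + t = r) : FDeg r (Ψ ∘ₗ Φ) := by
  subst h
  intro i x hx
  rw [← add_assoc]
  exact hΨ _ _ (hΦ _ _ hx)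

theorem LDeg.comp_fdeg {U : Type x} [AddCommGroup U] [Module k U] [SignGraded k U] {s t r : ℤ}
    {Ψ : W →ₗ[k] U} {Φ : TensorAlgebra k V →ₗ[k] W} (hΨ : LDeg t Ψ) (hΦ : FDeg s Φ)
    (h : s + t = r) : FDeg r (Ψ ∘ₗ Φ) := by
  subst h
  intro i x hx
  rw [← add_assoc]
  exact hΨ _ _ (hΦ _ _ hx)

theorem LDeg.comp {U : Type x} [AddCommGroup U] [Module k U] [SignGraded k U] {s t r : ℤ}
    {Ψ : W →ₗ[k] U} {Φ : V →ₗ[k] W} (hΨ : LDeg t Ψ) (hΦ : LDeg s Φ)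
    (h : s + t = r) : LDeg r (Ψ ∘ₗ Φ) := by
  subst h
  intro i x hx
  rw [← add_assoc]
  exact hΨ _ _ (hΦ _ _ hx)

theorem deg_tmap {p : V →ₗ[k] W} (hp : LDeg 0 p) : Deg 0 (tmap p).toLinearMap := by
  apply deg_of_wd
  intro l
  induction l with
  | nil => simpa using one_mem_gr
  | cons a l h =>
    have := ι_mul_mem_gr (hp _ _ a.mem) h
    simpa [add_assoc] using this

theorem ldeg_psgn (i : ℤ) : LDeg 0 (psgn i : V →ₗ[k] V) := by
  intro j x hx
  rw [psgn_apply i hx, add_zero]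
  exact Submodule.smul_mem _ _ hx

/-- This makes `psgn s` the right twist for coderivations of degree `s`: moving such an operator
past a left factor of degree `j` costs the Koszul sign `(-1)^{sj}`. -/
theorem tmap_psgn (i : ℤ) {j : ℤ} {x : TensorAlgebra k V} (hx : x ∈ gr k V j) :
    tmap (psgn i) x = sg k (i * j) • x := by
  induction hx using Submodule.span_induction with
  | mem x hx =>
    obtain ⟨l, rfl, rfl⟩ := hx
    induction l with
    | nil => simp
    | cons a l h =>
      simp [h, psgn_apply i a.mem, mul_add, sg_add, mul_smul]
      rw [smul_comm]
  | zero => simp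
  | add x y _ _ hx hy => rw [map_add, hx, hy, smul_add]
  | smul r x _ hx => rw [map_smul, hx, smul_comm]

theorem FDeg.comp_lmul {s : ℤ} {F : TensorAlgebra k V →ₗ[k] W} (hF : FDeg s F) (a : Letter k V) :
    FDeg (a.deg + s) (F ∘ₗ lmul a.val) := by
  intro i x hx
  have := hF _ _ (ι_mul_mem_gr a.mem hx)
  rw [show i + (a.deg + s) = a.deg + i + s by ring]
  exact this

/-- The assumption on `Ψ` concerns only suffixes of `l`, so that for `Ψ = hat F` it can be supplied
by induction on length. -/
theorem conv_mem_gr {s t : ℤ} {G : TensorAlgebra k V →ₗ[k] W} (hG : FDeg s G)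
    {Ψ : TensorAlgebra k V →ₗ[k] TensorAlgebra k W} (l : List (Letter k V))
    (hΨ : ∀ l', l' <:+ l → Ψ (wd l') ∈ gr k W (tdeg l' + t)) :
    conv (𝓲 ∘ₗ G) Ψ (wd l) ∈ gr k W (tdeg l + (s + t)) := by
  induction l generalizing G s with
  | nil =>
    have h1 := ι_mul_mem_gr (hG 0 1 one_mem_gr) (hΨ [] (by simp))
    simpa [add_assoc] using h1
  | cons a l h =>
    have h1 := ι_mul_mem_gr (hG 0 1 one_mem_gr) (hΨ (a :: l) (by simp))
    have h2 := h (hG.comp_lmul a) (fun l' hl' => hΨ l' (hl'.trans (by simp)))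
    rw [wd_cons, conv_ι_mul]
    refine add_mem ?_ ?_
    · rw [show tdeg (a :: l) + (s + t) = 0 + s + (tdeg (a :: l) + t) by ring]
      exact h1
    · rw [show tdeg (a :: l) + (s + t) = tdeg l + (a.deg + s + t) by rw [tdeg_cons]; ring]
      exact h2

theorem deg_hat {F : TensorAlgebra k V →ₗ[k] W} (h1 : F 1 = 0) (hF : FDeg 0 F) :
    Deg 0 (hat F) := by
  apply deg_of_wd
  intro l
  induction hn : l.length using Nat.strong_induction_on generalizing l with
  | _ n ih =>
    cases l with
    | nil => simpa [hat_one F h1] using one_mem_gr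
    | cons a l =>
      rw [wd_cons, hat_ι_mul F h1]
      have := conv_mem_gr (t := 0) (hF.comp_lmul a) (Ψ := hat F) l (fun l' hl' => ih l'.length
        (by have := hl'.length_le; simp at hn; omega) l' rfl)
      convert this using 2
      simp; ring

theorem deg_cod {p : V →ₗ[k] V} (hp : LDeg 0 p) {s : ℤ} {Q : TensorAlgebra k V →ₗ[k] V}
    (hQ : FDeg s Q) : Deg s (cod p Q) := by
  apply deg_of_wd
  intro l
  induction l with
  | nil => simpa using ι_mem_gr (hQ 0 1 one_mem_gr)
  | cons a l h =>
    rw [wd_cons, cod_ι_mul]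
    refine add_mem ?_ ?_
    · have := conv_mem_gr (t := 0) hQ (Ψ := LinearMap.id) (a :: l)
        (fun l' _ => by simpa using wd_mem_gr l')
      simpa using this
    · have := ι_mul_mem_gr (hp _ _ a.mem) h
      simpa [add_assoc] using this

/-! ### Unshuffles -/

/-- The signed sum of `X l₁ l₂` over all ways to distribute the letters of a list over two
lists. -/
noncomputable def unsh : List (Letter k V) → (List (Letter k V) → List (Letter k V) → M) → M
  | [], X => X [] []
  | a :: l, X => unsh l (fun l₁ l₂ => X (a :: l₁) l₂) +
      -- To reach the second list, the letter `a` passes all of `l₁`.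
      unsh l (fun l₁ l₂ => sg k (a.deg * tdeg l₁) • X l₁ (a :: l₂))

theorem map_unsh (f : M →ₗ[k] M') (l : List (Letter k V)) (X : List (Letter k V) → _ → M) :
    f (unsh l X) = unsh l (fun l₁ l₂ => f (X l₁ l₂)) := by
  induction l generalizing X with
  | nil => rfl
  | cons a l h => simp [unsh, h]

theorem unsh_congr (l : List (Letter k V)) {X Y : List (Letter k V) → List (Letter k V) → M}
    (h : ∀ l₁ l₂, l₁.length + l₂.length = l.length → tdeg l₁ + tdeg l₂ = tdeg l →
      X l₁ l₂ = Y l₁ l₂) : unsh l X = unsh l Y := by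
  induction l generalizing X Y with
  | nil => exact h [] [] rfl rfl
  | cons a l ih =>
    simp only [unsh]
    congr 1
    · exact ih fun l₁ l₂ h1 h2 => h _ _ (by simp; omega) (by simp; omega)
    · exact ih fun l₁ l₂ h1 h2 => by rw [h _ _ (by simp; omega) (by simp; omega)]

theorem unsh_add (l : List (Letter k V)) (X Y : List (Letter k V) → List (Letter k V) → M) :
    unsh l (fun l₁ l₂ => X l₁ l₂ + Y l₁ l₂) = unsh l X + unsh l Y := by
  induction l generalizing X Y with
  | nil => rfl
  | cons a l h => simp [unsh, h]; abel

theorem unsh_smul (r : k) (l : List (Letter k V))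
    (X : List (Letter k V) → List (Letter k V) → M) :
    unsh l (fun l₁ l₂ => r • X l₁ l₂) = r • unsh l X :=
  (map_unsh (r • LinearMap.id) l X).symm

theorem unsh_zero (l : List (Letter k V)) :
    unsh l (fun _ _ => (0 : M)) = 0 := by
  induction l with
  | nil => rfl
  | cons a l h => simp [unsh, h]

theorem unsh_eq_right (l : List (Letter k V)) {X : List (Letter k V) → List (Letter k V) → M}
    (h : ∀ a l₁ l₂, X l₁ (a :: l₂) = 0) : unsh l X = X l [] := by
  induction l generalizing X with
  | nil => rfl
  | cons a l ih =>
    simp only [unsh, h, smul_zero, unsh_zero, add_zero]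
    rw [ih (by simp [h])]

theorem unsh_mem (S : Submodule k M) (l : List (Letter k V))
    {X : List (Letter k V) → List (Letter k V) → M}
    (h : ∀ l₁ l₂, l₁.length + l₂.length = l.length → tdeg l₁ + tdeg l₂ = tdeg l →
      X l₁ l₂ ∈ S) : unsh l X ∈ S := by
  induction l generalizing X with
  | nil => exact h [] [] rfl rfl
  | cons a l ih =>
    refine add_mem (ih fun l₁ l₂ h1 h2 => h _ _ (by simp; omega) (by simp; omega))
      (ih fun l₁ l₂ h1 h2 => Submodule.smul_mem _ _ (h _ _ (by simp; omega) (by simp; omega)))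

/-- Graded cocommutativity of iterated unshuffles. -/
theorem unsh_swap (l : List (Letter k V))
    (X : List (Letter k V) → List (Letter k V) → List (Letter k V) → M) :
    unsh l (fun l₁ l' => unsh l' (fun l₂ l₃ => X l₁ l₂ l₃)) =
      unsh l (fun l₁ l' => unsh l' (fun l₂ l₃ => sg k (tdeg l₁ * tdeg l₂) • X l₂ l₁ l₃)) := by
  induction l generalizing X with
  | nil => simp [unsh]
  | cons a l ih =>
    simp only [unsh, smul_add, ← unsh_smul, unsh_add, smul_smul, tdeg_cons]
    rw [ih (fun l₁ l₂ l₃ => X (a :: l₁) l₂ l₃),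
      ih (fun l₁ l₂ l₃ => sg k (a.deg * tdeg l₁) • X l₁ (a :: l₂) l₃),
      ih (fun l₁ l₂ l₃ => (sg k (a.deg * tdeg l₁) * sg k (a.deg * tdeg l₂)) • X l₁ l₂ (a :: l₃))]
    -- The head letter has three possible destinations; exchanging the first two lists exchanges the
    -- first two cases.
    rw [add_left_comm]
    congr 1
    · congr 1; ext l₁ l'; congr 1; ext l₂ l₃
      rw [smul_smul, ← sg_add]; congr 2; ring
    congr 1
    · congr 1; ext l₁ l'; congr 1; ext l₂ l₃
      rw [← sg_add]; congr 1; apply sg_congr; exact ⟨-(a.deg * tdeg l₁), by ring⟩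
    · congr 1; ext l₁ l'; congr 1; ext l₂ l₃
      rw [smul_smul]; congr 1; ring

end Words

section ConvSmul

variable {k : Type u} [CommRing k] {V : Type v} [AddCommGroup V] [Module k V]

theorem conv_smul_right {A : Type*} [Ring A] [Algebra k A] (r : k)
    (a b : TensorAlgebra k V →ₗ[k] A) : conv a (r • b) = r • conv a b := by
  ext x; simp [conv_apply, TensorProduct.map_smul_right]

end ConvSmul

/-! ### Symmetric tensors inside the tensor coalgebra -/

section Symmetric

variable {k : Type u} [CommRing k] [Algebra ℚ k]
  {V : Type v} [AddCommGroup V] [Module k V] [SignGraded k V]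
  {W : Type w} [AddCommGroup W] [Module k W] [SignGraded k W]
  {M : Type*} [AddCommGroup M] [Module k M]

local notation "𝓲" => TensorAlgebra.ι k

/-- The scalar one half. -/
noncomputable def half (k : Type u) [CommRing k] [Algebra ℚ k] : k := algebraMap ℚ k (1 / 2)

theorem half_add_half : half k + half k = 1 := by
  rw [half, ← map_add]; norm_num

/-- Signed insertion of a vector in all places of a tensor. -/
noncomputable def ins : V →ₗ[k] Module.End k (TensorAlgebra k V) where
  -- The even and odd parts of `v`, each inserted with its own sign twist; this gives a formula
  -- linear in `v`.
  toFun v := conv LinearMap.id (lmul (half k • (v + SignGraded.par (k := k) v))) +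
    conv (tmap (SignGraded.par : V →ₗ[k] V)).toLinearMap (lmul (half k • (v - SignGraded.par (k := k) v)))
  map_add' v w := by
    rw [add_add_add_comm, ← conv_add_right, ← conv_add_right, ← map_add, ← map_add,
      ← smul_add, ← smul_add]
    congr 4
    · rw [map_add]; abel_nf
    · rw [map_add]; abel_nf
  map_smul' r v := by
    simp only [map_smul, ← smul_add, ← smul_sub, smul_comm _ r, conv_smul_right, RingHom.id_apply]

theorem ins_apply (v : V) : ins (k := k) v =
    conv LinearMap.id (lmul (half k • (v + SignGraded.par (k := k) v))) +
    conv (tmap (SignGraded.par : V →ₗ[k] V)).toLinearMap (lmul (half k • (v - SignGraded.par (k := k) v))) := rfl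

theorem ins_eq {i : ℤ} {v : V} (hv : v ∈ SignGraded.hdeg (k := k) i) :
    ins (k := k) v = conv (tmap (psgn i)).toLinearMap (lmul v) := by
  rw [ins_apply, SignGraded.par_apply hv]
  by_cases hi : Even i
  · rw [sg_even hi, one_smul, sub_self, smul_zero, map_zero, conv_zero_right, add_zero, ← two_smul k,
      smul_smul, mul_two, half_add_half, one_smul, psgn, if_pos hi, tmap_id]
    rfl
  · rw [sg_odd hi, neg_one_smul, add_neg_cancel, smul_zero, map_zero, conv_zero_right, zero_add,
      sub_neg_eq_add, ← two_smul k, smul_smul, mul_two, half_add_half, one_smul, psgn, if_neg hi]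

/-- Insertion is the coderivation whose only component is the constant `v` in length zero, so
coproduct and degree statements follow from those for `cod`. -/
theorem ins_eq_cod {i : ℤ} {v : V} (hv : v ∈ SignGraded.hdeg (k := k) i) :
    ins (k := k) v = cod (psgn i) (LinearMap.toSpanSingleton k V v ∘ₗ eps) := by
  rw [ins_eq hv, cod]
  congr 1
  apply ext_left
  · simp
  · intro u x _
    have : 𝓲 ∘ₗ LinearMap.toSpanSingleton k V v ∘ₗ eps ∘ₗ lmul u = 0 := by ext; simp
    simp only [conv_ι_mul, LinearMap.comp_assoc, this]
    simp

@[simp] theorem ins_one (v : V) : ins v (1 : TensorAlgebra k V) = 𝓲 v := by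
  refine letter_induction (k := k) (C := fun v => ins v (1 : TensorAlgebra k V) = 𝓲 v)
    (by simp) (fun a => ?_) (fun x y hx hy => by simp [hx, hy]) v
  rw [ins_eq a.mem]; simp

theorem ins_ι_mul {i j : ℤ} {v u : V} (hv : v ∈ SignGraded.hdeg (k := k) i)
    (hu : u ∈ SignGraded.hdeg (k := k) j) (x : TensorAlgebra k V) :
    ins v (𝓲 u * x) = 𝓲 v * (𝓲 u * x) + sg k (i * j) • (𝓲 u * ins v x) := by
  rw [ins_eq_cod hv, cod_ι_mul, psgn_apply i hu, map_smul, smul_mul_assoc]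
  congr 1
  have : 𝓲 ∘ₗ LinearMap.toSpanSingleton k V v ∘ₗ eps ∘ₗ lmul u = 0 := by ext; simp
  simp only [conv_ι_mul, LinearMap.comp_assoc, this]
  simp

theorem ins_letter (a b : Letter k V) (x : TensorAlgebra k V) :
    ins a.val (𝓲 b.val * x) =
      𝓲 a.val * (𝓲 b.val * x) + sg k (a.deg * b.deg) • (𝓲 b.val * ins a.val x) :=
  ins_ι_mul a.mem b.mem x

theorem deg_ins {i : ℤ} {v : V} (hv : v ∈ SignGraded.hdeg (k := k) i) :
    Deg i (ins v : Module.End k (TensorAlgebra k V)) := by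
  rw [ins_eq_cod hv]
  apply deg_cod (ldeg_psgn i)
  apply fdeg_of_wd
  rintro (_ | ⟨a, l⟩)
  · simpa using hv
  · simp

/-- Insertions commute up to the Koszul sign; this is the source of the graded symmetry of `sym`. -/
theorem ins_comm (a b : Letter k V) (x : TensorAlgebra k V) :
    ins a.val (ins b.val x) = sg k (a.deg * b.deg) • ins b.val (ins a.val x) := by
  induction x using wd_induction with
  | hw l =>
    induction l with
    | nil =>
      have h1 := ins_letter a b 1
      have h2 := ins_letter b a 1
      simp only [mul_one, ins_one] at h1 h2
      rw [wd_nil, ins_one, ins_one, h1, h2, smul_add, smul_smul, mul_comm b.deg a.deg,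
        sg_mul_self, one_smul, add_comm]
    | cons c l ih =>
      simp only [wd_cons, ins_letter, map_add, map_smul, ih, smul_add, mul_add, mul_smul_comm]
      rw [mul_comm b.deg a.deg]
      have e : sg k (a.deg * b.deg) * sg k (a.deg * b.deg) = 1 := sg_mul_self _
      linear_combination (norm := module) (-e) • (𝓲 a.val * (𝓲 b.val * (𝓲 c.val * wd l))) -
        (sg k (b.deg * c.deg) * e) • (𝓲 a.val * (𝓲 c.val * ins b.val (wd l)))
  | h0 => simp
  | add x y hx hy => simp [hx, hy]
  | smul r x hx => simp only [map_smul, hx]; rw [smul_comm]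

/-- Signed symmetrization of tensors, without normalization. -/
noncomputable def sym : TensorAlgebra k V →ₗ[k] TensorAlgebra k V := fold ins 1

@[simp] theorem sym_one : sym (1 : TensorAlgebra k V) = 1 := by simp [sym]

@[simp] theorem sym_ι_mul (v : V) (x : TensorAlgebra k V) : sym (𝓲 v * x) = ins v (sym x) := by
  simp [sym]

@[simp] theorem sym_ι (v : V) : sym (𝓲 v) = 𝓲 v := by
  simpa using sym_ι_mul v (1 : TensorAlgebra k V)

theorem sym_mem_gr (l : List (Letter k V)) : sym (wd l) ∈ gr k V (tdeg l) := by
  induction l with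
  | nil => simpa using one_mem_gr
  | cons a l h =>
    rw [wd_cons, sym_ι_mul, tdeg_cons, add_comm]
    exact deg_ins a.mem _ _ h

theorem deg_sym : Deg 0 (sym : TensorAlgebra k V →ₗ[k] TensorAlgebra k V) :=
  deg_of_wd fun l => by simpa using sym_mem_gr l

/-- Insertion of `a` is a twisted coderivation, so `a` enters the left factor, or the right one with
the sign of passing the left; this is the recursion of `unsh`. Deconcatenation thus restricts on
symmetrized words to the shuffle coproduct. -/
theorem delta_sym (l : List (Letter k V)) :
    delta (sym (wd l)) = unsh l (fun l₁ l₂ => sym (wd l₁) ⊗ₜ[k] sym (wd l₂)) := by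
  induction l with
  | nil => simp [unsh]
  | cons a l h =>
    have hc := isCod_cod (psgn a.deg) (LinearMap.toSpanSingleton k V a.val ∘ₗ eps)
    rw [← ins_eq_cod a.mem] at hc
    rw [wd_cons, sym_ι_mul, hc, h, map_unsh, map_unsh, unsh]
    congr 1
    · congr 1; ext l₁ l₂; simp
    · congr 1; ext l₁ l₂; simp [tmap_psgn _ (sym_mem_gr l₁), smul_tmul']

theorem conv_sym {A : Type*} [Ring A] [Algebra k A] (a b : TensorAlgebra k V →ₗ[k] A)
    (l : List (Letter k V)) :
    conv a b (sym (wd l)) = unsh l (fun l₁ l₂ => a (sym (wd l₁)) * b (sym (wd l₂))) := by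
  rw [conv_apply, delta_sym, map_unsh, map_unsh]
  simp

theorem ins_sym {i : ℤ} {v : V} (hv : v ∈ SignGraded.hdeg (k := k) i) (l : List (Letter k V)) :
    ins v (sym (wd l)) = unsh l (fun l₁ l₂ =>
      sg k (i * tdeg l₁) • (sym (wd l₁) * (𝓲 v * sym (wd l₂)))) := by
  rw [ins_eq hv, conv_sym]
  congr 1; ext l₁ l₂
  simp [tmap_psgn _ (sym_mem_gr l₁)]

/-- A coderivation on symmetric tensors. -/
theorem cod_sym {s : ℤ} {Q : TensorAlgebra k V →ₗ[k] V} (hQ : FDeg s Q) (l : List (Letter k V)) :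
    cod (psgn s) Q (sym (wd l)) =
      unsh l (fun l₁ l₂ => ins (Q (sym (wd l₁))) (sym (wd l₂))) := by
  have e1 : ∀ l₁ l₂ : List (Letter k V), ins (Q (sym (wd l₁))) (sym (wd l₂)) =
      unsh l₂ (fun m₁ m₂ => sg k ((tdeg l₁ + s) * tdeg m₁) •
        (sym (wd m₁) * (𝓲 (Q (sym (wd l₁))) * sym (wd m₂)))) :=
    fun l₁ l₂ => ins_sym (hQ _ _ (sym_mem_gr l₁)) l₂
  simp only [e1]
  -- Both sides distribute the letters over the part left of `Q`, the argument of `Q` and the part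
  -- right of it. One side selects the argument first, the other the left part.
  rw [unsh_swap, cod, conv_sym]
  congr 1; ext l₁ l'
  rw [conv_sym, AlgHom.toLinearMap_apply, tmap_psgn _ (sym_mem_gr l₁)]
  rw [← LinearMap.mulLeft_apply (R := k), map_unsh]
  congr 1; ext l₂ l₃
  simp only [LinearMap.mulLeft_apply, smul_mul_assoc, smul_smul, LinearMap.comp_apply,
    LinearMap.id_apply, ← sg_add]
  congr 1
  apply sg_congr
  exact ⟨-(tdeg l₁ * tdeg l₂), by ring⟩

/-- A coalgebra map on symmetric tensors. -/
theorem IsCo.sym_cons {Φ : TensorAlgebra k V →ₗ[k] TensorAlgebra k W} (hΦ : IsCo Φ)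
    (hd : Deg 0 Φ) (a : Letter k V) (l : List (Letter k V)) :
    Φ (sym (wd (a :: l))) =
      unsh l (fun l₁ l₂ => ins (pr (Φ (sym (wd (a :: l₁))))) (Φ (sym (wd l₂)))) := by
  have hrec : ∀ l : List (Letter k V), Φ (sym (wd l)) = convUnit (sym (wd l)) +
      unsh l (fun l₁ l₂ => 𝓲 (pr (Φ (sym (wd l₁)))) * Φ (sym (wd l₂))) := by
    intro l
    have : Φ (sym (wd l)) = (convUnit + conv (𝓲 ∘ₗ pr ∘ₗ Φ) Φ : _ →ₗ[k] _) (sym (wd l)) := by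
      rw [← hΦ.eq_conv]
    rw [this, LinearMap.add_apply, conv_sym]; rfl
  have heps : ∀ (a : Letter k V) (l : List (Letter k V)),
      (convUnit (sym (wd (a :: l))) : TensorAlgebra k W) = 0 := by
    intro a l
    simp [convUnit, ins_eq_cod a.mem, (isCod_cod _ _).eps]
  have hF : ∀ l : List (Letter k V), pr (Φ (sym (wd l))) ∈ SignGraded.hdeg (k := k) (tdeg l) := by
    intro l
    have := fdeg_pr _ _ (hd _ _ (sym_mem_gr l))
    simpa using this
  have hF0 : pr (Φ (sym (wd ([] : List (Letter k V))))) = 0 := by simp [hΦ.one]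
  induction hn : l.length using Nat.strong_induction_on generalizing l with
  | _ n ih =>
  subst hn
  -- both sides expand to double unshuffles
  have lhs : Φ (sym (wd (a :: l))) =
      unsh l (fun l₁ l₂ => 𝓲 (pr (Φ (sym (wd (a :: l₁))))) * Φ (sym (wd l₂))) +
      unsh l (fun l₁ l' => unsh l' (fun l₂ l₃ => sg k (a.deg * tdeg l₁) •
        (𝓲 (pr (Φ (sym (wd l₁)))) * ins (pr (Φ (sym (wd (a :: l₂))))) (Φ (sym (wd l₃)))))) := by
    rw [hrec, heps, zero_add, unsh]
    congr 1
    apply unsh_congr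
    intro l₁ l' h1 _
    cases l₁ with
    | nil => simp only [hF0, map_zero, zero_mul, smul_zero, unsh_zero]
    | cons b l₁ =>
      rw [ih l'.length (by simp at h1; omega) l' rfl, unsh_smul]
      congr 1
      exact map_unsh (LinearMap.mulLeft k (𝓲 (pr (Φ (sym (wd (b :: l₁))))))) _ _
  have rhs : ∀ l₁ l' : List (Letter k V), ins (pr (Φ (sym (wd (a :: l₁))))) (Φ (sym (wd l'))) =
      𝓲 (pr (Φ (sym (wd (a :: l₁))))) * Φ (sym (wd l')) +
      unsh l' (fun l₂ l₃ => sg k ((a.deg + tdeg l₁) * tdeg l₂) •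
        (𝓲 (pr (Φ (sym (wd l₂)))) * ins (pr (Φ (sym (wd (a :: l₁))))) (Φ (sym (wd l₃))))) := by
    intro l₁ l'
    have e : ∀ l₂ x, ins (pr (Φ (sym (wd (a :: l₁))))) (𝓲 (pr (Φ (sym (wd l₂)))) * x) =
        𝓲 (pr (Φ (sym (wd (a :: l₁))))) * (𝓲 (pr (Φ (sym (wd l₂)))) * x) +
        sg k ((a.deg + tdeg l₁) * tdeg l₂) •
          (𝓲 (pr (Φ (sym (wd l₂)))) * ins (pr (Φ (sym (wd (a :: l₁))))) x) :=
      fun l₂ x => ins_ι_mul (hF (a :: l₁)) (hF l₂) x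
    conv_lhs => rw [hrec l', map_add, map_unsh]
    simp only [e, unsh_add]
    rw [← add_assoc]
    congr 1
    conv_rhs => rw [hrec l', mul_add]
    congr 1
    · simp only [convUnit, LinearMap.comp_apply, Algebra.linearMap_apply,
        Algebra.algebraMap_eq_smul_one, map_smul, ins_one, mul_smul_comm, mul_one]
    · exact (map_unsh (LinearMap.mulLeft k (𝓲 (pr (Φ (sym (wd (a :: l₁))))))) _ _).symm
  refine Eq.trans ?_ (congrArg (unsh l) (funext fun l₁ => funext fun l' => (rhs l₁ l').symm))
  -- The first block either contains `a`, which matches term by term, or does not; then it has to be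
  -- exchanged with the block that contains `a`.
  rw [unsh_add, lhs, unsh_swap]
  congr 1
  congr 1; ext l₁ l'; congr 1; ext l₂ l₃
  rw [smul_smul, ← sg_add]
  congr 2
  ring

theorem ins_mem_range (v : V) {x : TensorAlgebra k V}
    (hx : x ∈ LinearMap.range (sym (k := k) (V := V))) :
    ins v x ∈ LinearMap.range (sym (k := k) (V := V)) := by
  obtain ⟨y, rfl⟩ := hx
  exact ⟨𝓲 v * y, by simp⟩

variable (k V) in
/-- The span of the symmetrizations of words of length less than `n`. -/
noncomputable def symLt (n : ℕ) : Submodule k (TensorAlgebra k V) :=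
  Submodule.span k {x | ∃ l : List (Letter k V), l.length < n ∧ sym (wd l) = x}

theorem sym_mem_symLt {n : ℕ} {l : List (Letter k V)} (h : l.length < n) :
    sym (wd l) ∈ symLt k V n := Submodule.subset_span ⟨l, h, rfl⟩

theorem symLt_mono {m n : ℕ} (h : m ≤ n) : symLt k V m ≤ symLt k V n := by
  apply Submodule.span_mono
  rintro x ⟨l, hl, rfl⟩
  exact ⟨l, by omega, rfl⟩

theorem ins_mem_symLt (v : V) {n : ℕ} {x : TensorAlgebra k V} (hx : x ∈ symLt k V n) :
    ins v x ∈ symLt k V (n + 1) := by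
  induction hx using Submodule.span_induction with
  | mem x hx =>
    obtain ⟨l, hl, rfl⟩ := hx
    refine letter_induction (k := k) (C := fun v => ins v (sym (wd l)) ∈ symLt k V (n + 1))
      (by simp) (fun a => ?_) (fun x y hx hy => ?_) v
    · rw [← sym_ι_mul, ← wd_cons]; exact sym_mem_symLt (by simpa using hl)
    · rw [map_add, LinearMap.add_apply]; exact add_mem hx hy
  | zero => simp
  | add x y _ _ hx hy => rw [map_add]; exact add_mem hx hy
  | smul r x _ hx => rw [map_smul]; exact Submodule.smul_mem _ _ hx

/-- Two linear maps agree on symmetric tensors. -/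
def EqSym (f g : TensorAlgebra k V →ₗ[k] M) : Prop := f ∘ₗ sym = g ∘ₗ sym

theorem EqSym.apply {f g : TensorAlgebra k V →ₗ[k] M} (h : EqSym f g) {x : TensorAlgebra k V}
    (hx : x ∈ LinearMap.range (sym (k := k) (V := V))) : f x = g x := by
  obtain ⟨y, rfl⟩ := hx
  exact LinearMap.congr_fun h y

theorem EqSym.of_wd {f g : TensorAlgebra k V →ₗ[k] M}
    (h : ∀ l : List (Letter k V), f (sym (wd l)) = g (sym (wd l))) : EqSym f g :=
  ext_wd h

theorem EqSym.wd {f g : TensorAlgebra k V →ₗ[k] M} (h : EqSym f g) (l : List (Letter k V)) :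
    f (sym (wd l)) = g (sym (wd l)) := LinearMap.congr_fun h _

theorem EqSym.refl (f : TensorAlgebra k V →ₗ[k] M) : EqSym f f := rfl

theorem EqSym.comp_left {M' : Type*} [AddCommGroup M'] [Module k M']
    {f g : TensorAlgebra k V →ₗ[k] M} (h : EqSym f g) (p : M →ₗ[k] M') :
    EqSym (p ∘ₗ f) (p ∘ₗ g) := by
  unfold EqSym at h ⊢
  rw [LinearMap.comp_assoc, h, LinearMap.comp_assoc]

/-- A linear map preserves symmetric tensors. -/
def PresSym (Φ : TensorAlgebra k V →ₗ[k] TensorAlgebra k W) : Prop :=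
  ∀ x ∈ LinearMap.range (sym (k := k) (V := V)), Φ x ∈ LinearMap.range (sym (k := k) (V := W))

theorem presSym_of_wd {Φ : TensorAlgebra k V →ₗ[k] TensorAlgebra k W}
    (h : ∀ l, Φ (sym (wd l)) ∈ LinearMap.range (sym (k := k) (V := W))) : PresSym Φ := by
  rintro _ ⟨y, rfl⟩
  induction y using wd_induction with
  | hw l => exact h l
  | h0 => simp
  | add x y hx hy => rw [map_add, map_add]; exact add_mem hx hy
  | smul r x hx => rw [map_smul, map_smul]; exact Submodule.smul_mem _ _ hx

theorem EqSym.comp_right {f g : TensorAlgebra k W →ₗ[k] M} (h : EqSym f g)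
    {Φ : TensorAlgebra k V →ₗ[k] TensorAlgebra k W} (hΦ : PresSym Φ) :
    EqSym (f ∘ₗ Φ) (g ∘ₗ Φ) := by
  ext1 y
  exact h.apply (hΦ _ ⟨y, rfl⟩)

theorem presSym_cod {s : ℤ} {Q : TensorAlgebra k V →ₗ[k] V} (hQ : FDeg s Q) :
    PresSym (cod (psgn s) Q) := by
  refine presSym_of_wd fun l => ?_
  rw [cod_sym hQ]
  exact unsh_mem _ _ fun l₁ l₂ _ _ => ins_mem_range _ ⟨_, rfl⟩

theorem IsCo.presSym {Φ : TensorAlgebra k V →ₗ[k] TensorAlgebra k W} (hΦ : IsCo Φ)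
    (hd : Deg 0 Φ) : PresSym Φ := by
  refine presSym_of_wd fun l => ?_
  induction hn : l.length using Nat.strong_induction_on generalizing l with
  | _ n ih =>
  subst hn
  cases l with
  | nil => exact ⟨1, by simp [hΦ.one]⟩
  | cons a l =>
    rw [hΦ.sym_cons hd]
    exact unsh_mem _ _ fun l₁ l₂ h _ =>
      ins_mem_range _ (ih l₂.length (by simp; omega) l₂ rfl)

/-- On symmetric tensors, a coalgebra map is determined by its projection. -/
theorem IsCo.eqSym {Φ Ψ : TensorAlgebra k V →ₗ[k] TensorAlgebra k W} (hΦ : IsCo Φ)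
    (hdΦ : Deg 0 Φ) (hΨ : IsCo Ψ) (hdΨ : Deg 0 Ψ) (h : EqSym (pr ∘ₗ Φ) (pr ∘ₗ Ψ)) :
    EqSym Φ Ψ := by
  apply EqSym.of_wd
  intro l
  induction hn : l.length using Nat.strong_induction_on generalizing l with
  | _ n ih =>
  subst hn
  cases l with
  | nil => simp [hΦ.one, hΨ.one]
  | cons a l =>
    rw [hΦ.sym_cons hdΦ, hΨ.sym_cons hdΨ]
    apply unsh_congr
    intro l₁ l₂ h1 _
    rw [ih l₂.length (by simp; omega) l₂ rfl]
    have := h.wd (a :: l₁)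
    simp only [LinearMap.comp_apply] at this
    rw [this]

end Symmetric

/-! ### Lowest-order terms -/

section Vanish

variable {k : Type u} [CommRing k] [Algebra ℚ k]
  {V : Type v} [AddCommGroup V] [Module k V] [SignGraded k V]
  {W : Type w} [AddCommGroup W] [Module k W]

/-- A coderivation along a coalgebra map: if its projection vanishes on symmetric tensors of
length less than `n`, it agrees with its projection on symmetric tensors of length `n`. -/
theorem eq_ι_pr_of_vanish {Θ Φ : TensorAlgebra k V →ₗ[k] TensorAlgebra k W}
    {θ ψ : TensorAlgebra k V →ₗ[k] W} (hΘ : Θ = conv (𝓲 ∘ₗ θ) Φ + conv (𝓲 ∘ₗ ψ) Θ)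
    (hΦ : Φ 1 = 1) (hψ : ψ 1 = 0) (n : ℕ)
    (h : ∀ l : List (Letter k V), l.length < n → θ (sym (wd l)) = 0) :
    ∀ l : List (Letter k V), l.length ≤ n → Θ (sym (wd l)) = 𝓲 (θ (sym (wd l))) := by
  intro l
  induction hn : l.length using Nat.strong_induction_on generalizing l with
  | _ m ih =>
  subst hn
  intro hl
  have e : Θ (sym (wd l)) = (conv (𝓲 ∘ₗ θ) Φ + conv (𝓲 ∘ₗ ψ) Θ : _ →ₗ[k] _) (sym (wd l)) := by
    rw [← hΘ]
  rw [e, LinearMap.add_apply, conv_sym, conv_sym]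
  -- Below length `n` the functional `θ` vanishes, so only the term with nothing to the right of it
  -- remains. In the second sum `ψ` takes at least one letter, so `Θ` meets a shorter word, where it
  -- is zero by induction.
  have e1 : unsh l (fun l₁ l₂ => (𝓲 ∘ₗ θ) (sym (wd l₁)) * Φ (sym (wd l₂))) =
      unsh l (fun l₁ l₂ => if l₂ = [] then 𝓲 (θ (sym (wd l₁))) else 0) := by
    apply unsh_congr
    intro l₁ l₂ h1 _
    split_ifs with h2
    · subst h2; simp [hΦ]
    · have : 0 < l₂.length := List.length_pos_iff.2 h2
      rw [LinearMap.comp_apply, h l₁ (by omega)]; simp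
  have e2 : unsh l (fun l₁ l₂ => (𝓲 ∘ₗ ψ) (sym (wd l₁)) * Θ (sym (wd l₂))) =
      unsh l (fun _ _ => 0) := by
    apply unsh_congr
    intro l₁ l₂ h1 _
    cases l₁ with
    | nil => simp [hψ]
    | cons b l₁ =>
      simp only [List.length_cons] at h1
      rw [ih l₂.length (by omega) l₂ rfl (by omega), h l₂ (by omega)]; simp
  rw [e1, e2, unsh_zero, add_zero, unsh_eq_right]
  · simp
  · simp

end Vanish

/-- A unipotent endomorphism of a module with an exhaustive filtration is bijective. -/
theorem bijective_of_unipotent {k : Type u} [CommRing k] {M : Type v} [AddCommGroup M] [Module k M]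
    (S : ℕ → Submodule k M) (h0 : S 0 = ⊥) (hS : ∀ x, ∃ n, x ∈ S n) (f : M →ₗ[k] M)
    (hf : ∀ n, ∀ x ∈ S (n + 1), f x - x ∈ S n) : Function.Bijective f := by
  constructor
  · rw [← LinearMap.ker_eq_bot, LinearMap.ker_eq_bot']
    intro x hx
    obtain ⟨n, hn⟩ := hS x
    induction n with
    | zero => simpa [h0] using hn
    | succ n ih =>
      have := hf n x hn
      rw [hx, zero_sub] at this
      exact ih (neg_mem_iff.1 this)
  · intro y
    obtain ⟨n, hn⟩ := hS y
    induction n generalizing y with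
    | zero => exact ⟨0, by simpa [h0, eq_comm] using hn⟩
    | succ n ih =>
      obtain ⟨x, hx⟩ := ih (f y - y) (hf n y hn)
      exact ⟨y - x, by rw [map_sub, hx]; abel⟩

/-- The successive approximations stay in an invariant submodule `N`. With `N` a graded part, this
shows that the inverse of a coalgebra automorphism has degree zero. -/
theorem exists_preimage_of_unipotent {k : Type u} [CommRing k] {M : Type v} [AddCommGroup M]
    [Module k M] (S : ℕ → Submodule k M) (h0 : S 0 = ⊥) (hS : ∀ x, ∃ n, x ∈ S n) (f : M →ₗ[k] M)
    (hf : ∀ n, ∀ x ∈ S (n + 1), f x - x ∈ S n) (N : Submodule k M) (hN : ∀ x ∈ N, f x ∈ N)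
    {y : M} (hy : y ∈ N) : ∃ x ∈ N, f x = y := by
  obtain ⟨n, hn⟩ := hS y
  induction n generalizing y with
  | zero => exact ⟨0, zero_mem _, by simpa [h0, eq_comm] using hn⟩
  | succ n ih =>
    obtain ⟨x, hxN, hx⟩ := ih (sub_mem (hN y hy) hy) (hf n y hn)
    exact ⟨y - x, sub_mem hy hxN, by rw [map_sub, hx]; abel⟩

/-! ### Filtration by word length and inversion of coalgebra maps -/

section Length

variable {k : Type u} [CommRing k] {V : Type v} [AddCommGroup V] [Module k V] [SignGraded k V]
  {W : Type w} [AddCommGroup W] [Module k W] [SignGraded k W]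

local notation "𝓲" => TensorAlgebra.ι k

variable (k V) in
/-- The span of the words of length less than `n`. -/
noncomputable def wdLt (n : ℕ) : Submodule k (TensorAlgebra k V) :=
  Submodule.span k {x | ∃ l : List (Letter k V), l.length < n ∧ wd l = x}

variable (k V) in
/-- The span of the words of length `n`. -/
noncomputable def wdEq (n : ℕ) : Submodule k (TensorAlgebra k V) :=
  Submodule.span k {x | ∃ l : List (Letter k V), l.length = n ∧ wd l = x}

theorem wd_mem_wdLt {n : ℕ} {l : List (Letter k V)} (h : l.length < n) : wd l ∈ wdLt k V n :=
  Submodule.subset_span ⟨l, h, rfl⟩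

theorem wd_mem_wdEq (l : List (Letter k V)) : wd l ∈ wdEq k V l.length :=
  Submodule.subset_span ⟨l, rfl, rfl⟩

theorem wdLt_mono {m n : ℕ} (h : m ≤ n) : wdLt k V m ≤ wdLt k V n := by
  apply Submodule.span_mono
  rintro x ⟨l, hl, rfl⟩
  exact ⟨l, by omega, rfl⟩

theorem wdEq_le_wdLt {m n : ℕ} (h : m < n) : wdEq k V m ≤ wdLt k V n := by
  apply Submodule.span_mono
  rintro x ⟨l, hl, rfl⟩
  exact ⟨l, by omega, rfl⟩

theorem wdLt_zero : wdLt k V 0 = ⊥ := by simp [wdLt]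

theorem exists_mem_wdLt (x : TensorAlgebra k V) : ∃ n, x ∈ wdLt k V n := by
  induction x using wd_induction with
  | hw l => exact ⟨_, wd_mem_wdLt (Nat.lt_succ_self _)⟩
  | h0 => exact ⟨0, zero_mem _⟩
  | add x y hx hy =>
    obtain ⟨m, hm⟩ := hx
    obtain ⟨n, hn⟩ := hy
    exact ⟨max m n, add_mem (wdLt_mono (le_max_left _ _) hm) (wdLt_mono (le_max_right _ _) hn)⟩
  | smul r x hx => obtain ⟨m, hm⟩ := hx; exact ⟨m, Submodule.smul_mem _ _ hm⟩

theorem ι_mul_mem_wdLt (v : V) {n : ℕ} {x : TensorAlgebra k V} (hx : x ∈ wdLt k V n) :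
    𝓲 v * x ∈ wdLt k V (n + 1) := by
  induction hx using Submodule.span_induction with
  | mem x hx =>
    obtain ⟨l, hl, rfl⟩ := hx
    refine letter_induction (k := k) (C := fun v => 𝓲 v * wd l ∈ wdLt k V (n + 1))
      (by simp) (fun a => ?_) (fun x y hx hy => ?_) v
    · rw [← wd_cons]; exact wd_mem_wdLt (by simpa using hl)
    · rw [map_add, add_mul]; exact add_mem hx hy
  | zero => simp
  | add x y _ _ hx hy => rw [mul_add]; exact add_mem hx hy
  | smul r x _ hx => rw [mul_smul_comm]; exact Submodule.smul_mem _ _ hx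

theorem ι_mul_mem_wdEq (v : V) {n : ℕ} {x : TensorAlgebra k V} (hx : x ∈ wdEq k V n) :
    𝓲 v * x ∈ wdEq k V (n + 1) := by
  induction hx using Submodule.span_induction with
  | mem x hx =>
    obtain ⟨l, hl, rfl⟩ := hx
    refine letter_induction (k := k) (C := fun v => 𝓲 v * wd l ∈ wdEq k V (n + 1))
      (by simp) (fun a => ?_) (fun x y hx hy => ?_) v
    · rw [← wd_cons]; exact Submodule.subset_span ⟨a :: l, by simpa using hl, rfl⟩
    · rw [map_add, add_mul]; exact add_mem hx hy
  | zero => simp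
  | add x y _ _ hx hy => rw [mul_add]; exact add_mem hx hy
  | smul r x _ hx => rw [mul_smul_comm]; exact Submodule.smul_mem _ _ hx

/-- Cutting a word into blocks of one letter reproduces it because the linear part is the identity;
every other cut into blocks gives fewer letters. -/
theorem IsCo.sub_mem_wdLt {χ : TensorAlgebra k V →ₗ[k] TensorAlgebra k V} (hχ : IsCo χ)
    (h1 : ∀ v, pr (χ (𝓲 v)) = v) {n : ℕ} {x : TensorAlgebra k V} (hx : x ∈ wdLt k V (n + 1)) :
    χ x - x ∈ wdLt k V n := by
  have key : ∀ l : List (Letter k V),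
      (∀ G : TensorAlgebra k V →ₗ[k] V, conv (𝓲 ∘ₗ G) χ (wd l) ∈ wdLt k V (l.length + 2)) ∧
      (∀ G : TensorAlgebra k V →ₗ[k] V, G 1 = 0 →
        conv (𝓲 ∘ₗ G) χ (wd l) ∈ wdLt k V (l.length + 1)) ∧
      χ (wd l) - wd l ∈ wdLt k V l.length := by
    intro l
    induction l with
    | nil =>
      refine ⟨fun G => ?_, fun G hG => by simp [hG], by simp [hχ.one]⟩
      have := ι_mul_mem_wdLt (G 1) (wd_mem_wdLt (k := k) (V := V) (n := 1) (l := []) (by simp))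
      simpa [hχ.one] using this
    | cons a l ih =>
      obtain ⟨ih1, ih2, ih3⟩ := ih
      have e3 : χ (wd (a :: l)) - wd (a :: l) ∈ wdLt k V (l.length + 1) := by
        -- Separates the first block consisting of `a` alone from the longer first blocks; the
        -- latter functional kills `1`, so the sharper of the two bounds applies.
        have e : pr ∘ₗ χ ∘ₗ lmul a.val = LinearMap.toSpanSingleton k V a.val ∘ₗ Tens.eps +
          (pr ∘ₗ χ ∘ₗ lmul a.val - LinearMap.toSpanSingleton k V a.val ∘ₗ Tens.eps) := by abel
        have e' : 𝓲 ∘ₗ LinearMap.toSpanSingleton k V a.val ∘ₗ (Tens.eps : TensorAlgebra k V →ₗ[k] k) =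
            LinearMap.mulLeft k (𝓲 a.val) ∘ₗ convUnit := by
          ext y; simp [convUnit, Algebra.algebraMap_eq_smul_one]
        rw [wd_cons, hχ.ι_mul, e, LinearMap.comp_add, conv_add_left, LinearMap.add_apply, e',
          conv_mulLeft, convUnit_conv, add_sub_right_comm, ← mul_sub]
        refine add_mem (ι_mul_mem_wdLt _ ih3) (ih2 _ ?_)
        have := h1 a.val
        simp [this]
      have e4 : χ (wd (a :: l)) ∈ wdLt k V (l.length + 2) := by
        have := add_mem (wdLt_mono (Nat.le_succ _) e3)
          (wd_mem_wdLt (k := k) (V := V) (n := l.length + 2) (l := a :: l) (by simp))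
        simpa using this
      refine ⟨fun G => ?_, fun G hG => ?_, e3⟩
      · rw [wd_cons, conv_ι_mul]
        exact add_mem (ι_mul_mem_wdLt _ e4) (wdLt_mono (by simp) (ih1 (G ∘ₗ lmul a.val)))
      · rw [wd_cons, conv_ι_mul, LinearMap.comp_apply 𝓲 G, hG, map_zero, zero_mul, zero_add]
        exact ih1 (G ∘ₗ lmul a.val)
  induction hx using Submodule.span_induction with
  | mem x hx =>
    obtain ⟨l, hl, rfl⟩ := hx
    exact wdLt_mono (by omega) (key l).2.2
  | zero => simp
  | add x y _ _ hx hy => rw [map_add, add_sub_add_comm]; exact add_mem hx hy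
  | smul r x _ hx => rw [map_smul, ← smul_sub]; exact Submodule.smul_mem _ _ hx

/-- A coalgebra endomorphism with linear part the identity is invertible. -/
theorem IsCo.exists_inverse {χ : TensorAlgebra k V →ₗ[k] TensorAlgebra k V} (hχ : IsCo χ)
    (hd : Deg 0 χ) (h1 : ∀ v, pr (χ (𝓲 v)) = v) :
    ∃ ψ : TensorAlgebra k V →ₗ[k] TensorAlgebra k V, IsCo ψ ∧ Deg 0 ψ ∧
      χ ∘ₗ ψ = LinearMap.id ∧ ψ ∘ₗ χ = LinearMap.id := by
  have hb := bijective_of_unipotent (wdLt k V) wdLt_zero exists_mem_wdLt χ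
    fun n x hx => hχ.sub_mem_wdLt h1 hx
  let E := LinearEquiv.ofBijective χ hb
  let ψ : TensorAlgebra k V →ₗ[k] TensorAlgebra k V := E.symm.toLinearMap
  have e1 : ∀ x, χ (ψ x) = x := fun x => E.apply_symm_apply x
  have e2 : ∀ x, ψ (χ x) = x := fun x => E.symm_apply_apply x
  refine ⟨ψ, ⟨fun x => ?_, ?_, fun x => ?_⟩, ?_, LinearMap.ext e1, LinearMap.ext e2⟩
  · have : Tens.delta x = TensorProduct.map χ χ (Tens.delta (ψ x)) := by
      rw [← hχ.delta, e1]
    rw [this]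
    generalize Tens.delta (ψ x) = t
    induction t using TensorProduct.induction_on with
    | zero => simp
    | tmul a b => simp [e2]
    | add a b ha hb => simp only [map_add, ← ha, ← hb]
  · rw [← hχ.one, e2, hχ.one]
  · rw [← hχ.eps, e1]
  · intro i x hx
    obtain ⟨y, hy, rfl⟩ := exists_preimage_of_unipotent (wdLt k V) wdLt_zero exists_mem_wdLt χ
      (fun n x hx => hχ.sub_mem_wdLt h1 hx) (gr k V i) (fun x hx => by simpa using hd i x hx) hx
    rw [e2, add_zero]; exact hy

theorem IsCo.apply_ι {Φ : TensorAlgebra k V →ₗ[k] TensorAlgebra k W} (hΦ : IsCo Φ) (v : V) :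
    Φ (𝓲 v) = 𝓲 (pr (Φ (𝓲 v))) := by
  have := hΦ.ι_mul v 1
  simpa [hΦ.one] using this

/-- The linear map on tensors with prescribed values on products of `n` vectors. -/
noncomputable def ofFamily {W : Type w} [AddCommGroup W] [Module k W] (F : MultiFamily k V W) :
    TensorAlgebra k V →ₗ[k] W :=
  DirectSum.toModule k ℕ W (fun n => PiTensorProduct.lift (F n)) ∘ₗ
    TensorAlgebra.toDirectSum.toLinearMap

omit [SignGraded k V] in
theorem ofFamily_tprod {W : Type w} [AddCommGroup W] [Module k W] (F : MultiFamily k V W) (n : ℕ)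
    (x : Fin n → V) : ofFamily F (TensorAlgebra.tprod k V n x) = F n x := by
  rw [ofFamily, LinearMap.comp_apply, AlgHom.toLinearMap_apply,
    TensorAlgebra.toDirectSum_tensorPower_tprod]
  erw [DirectSum.toModule_lof]
  simp

theorem wd_eq_tprod (l : List (Letter k V)) :
    wd l = TensorAlgebra.tprod k V l.length (fun i => (l.get i).val) := by
  rw [TensorAlgebra.tprod_apply]
  induction l with
  | nil => simp
  | cons a l h => simp [h, List.ofFn_succ]

theorem ofFamily_wd {W : Type w} [AddCommGroup W] [Module k W] (F : MultiFamily k V W)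
    (l : List (Letter k V)) : ofFamily F (wd l) = F l.length (fun i => (l.get i).val) := by
  rw [wd_eq_tprod, ofFamily_tprod]

/-- The map agreeing with `g n` on tensors of length `n`. -/
noncomputable def glue {W : Type w} [AddCommGroup W] [Module k W]
    (g : ℕ → TensorAlgebra k V →ₗ[k] W) : TensorAlgebra k V →ₗ[k] W :=
  ofFamily fun n => (g n).compMultilinearMap (TensorAlgebra.tprod k V n)

theorem glue_wd {W : Type w} [AddCommGroup W] [Module k W]
    (g : ℕ → TensorAlgebra k V →ₗ[k] W) (l : List (Letter k V)) :
    glue g (wd l) = g l.length (wd l) := by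
  rw [glue, ofFamily_wd, LinearMap.compMultilinearMap_apply, ← wd_eq_tprod]

theorem glue_apply {W : Type w} [AddCommGroup W] [Module k W]
    (g : ℕ → TensorAlgebra k V →ₗ[k] W) {n : ℕ} {x : TensorAlgebra k V} (hx : x ∈ wdEq k V n) :
    glue g x = g n x := by
  induction hx using Submodule.span_induction with
  | mem x hx => obtain ⟨l, rfl, rfl⟩ := hx; exact glue_wd g l
  | zero => simp
  | add x y _ _ hx hy => simp [hx, hy]
  | smul r x _ hx => simp [hx]

theorem tmap_mem_wdEq (p : V →ₗ[k] W) {n : ℕ} {x : TensorAlgebra k V} (hx : x ∈ wdEq k V n) :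
    tmap p x ∈ wdEq k W n := by
  induction hx using Submodule.span_induction with
  | mem x hx =>
    obtain ⟨l, rfl, rfl⟩ := hx
    induction l with
    | nil => simpa using wd_mem_wdEq (k := k) (V := W) []
    | cons a l h =>
      rw [wd_cons, map_mul, tmap_ι]
      exact ι_mul_mem_wdEq _ h
  | zero => simp
  | add x y _ _ hx hy => rw [map_add]; exact add_mem hx hy
  | smul r x _ hx => rw [map_smul]; exact Submodule.smul_mem _ _ hx

theorem Deg.tmap_psgn {F : TensorAlgebra k V →ₗ[k] TensorAlgebra k W} (hF : Deg 0 F) (i : ℤ)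
    (x : TensorAlgebra k V) : F (tmap (psgn i) x) = tmap (psgn i) (F x) := by
  induction x using wd_induction with
  | hw l =>
    have := hF _ _ (wd_mem_gr l)
    rw [Tens.tmap_psgn i (wd_mem_gr l), Tens.tmap_psgn i this, map_smul, add_zero]
  | h0 => simp
  | add x y hx hy => simp [hx, hy]
  | smul r x hx => simp [hx]

end Length

/-! ### Symmetrization against insertions, linear coderivations and homotopies -/

section SymLength

variable {k : Type u} [CommRing k] [Algebra ℚ k]
  {V : Type v} [AddCommGroup V] [Module k V] [SignGraded k V]
  {W : Type w} [AddCommGroup W] [Module k W] [SignGraded k W]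

local notation "𝓲" => TensorAlgebra.ι k

theorem ins_mem_wdEq (a : Letter k V) {n : ℕ} {x : TensorAlgebra k V} (hx : x ∈ wdEq k V n) :
    ins a.val x ∈ wdEq k V (n + 1) := by
  induction hx using Submodule.span_induction with
  | mem x hx =>
    obtain ⟨l, rfl, rfl⟩ := hx
    induction l with
    | nil => simpa using wd_mem_wdEq [a]
    | cons b l h =>
      rw [wd_cons, ins_letter]
      exact add_mem (wd_mem_wdEq (a :: b :: l)) (Submodule.smul_mem _ _ (ι_mul_mem_wdEq _ h))
  | zero => simp
  | add x y _ _ hx hy => rw [map_add]; exact add_mem hx hy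
  | smul r x _ hx => rw [map_smul]; exact Submodule.smul_mem _ _ hx

theorem sym_wd_mem_wdEq (l : List (Letter k V)) : sym (wd l) ∈ wdEq k V l.length := by
  induction l with
  | nil => simpa using wd_mem_wdEq []
  | cons a l h => rw [wd_cons, sym_ι_mul]; exact ins_mem_wdEq a h

/-- After symmetrization the `n + 1` places of insertion give equal contributions. Iterating yields
`sym_sym`, the factor `n!` that later has to be divided out. -/
theorem sym_ins (a : Letter k V) {n : ℕ} {x : TensorAlgebra k V} (hx : x ∈ wdEq k V n) :
    sym (ins a.val x) = ((n + 1 : ℕ) : k) • ins a.val (sym x) := by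
  induction hx using Submodule.span_induction with
  | mem x hx =>
    obtain ⟨l, rfl, rfl⟩ := hx
    induction l with
    | nil => simp
    | cons b l h =>
      rw [wd_cons, ins_letter, map_add, map_smul, sym_ι_mul, sym_ι_mul, sym_ι_mul, h, map_smul,
        smul_comm (sg k _), ins_comm b a, smul_smul, smul_smul, mul_assoc, mul_comm b.deg a.deg,
        sg_mul_self]
      simp only [List.length_cons]
      push_cast
      module
  | zero => simp
  | add x y _ _ hx hy => simp only [map_add, hx, hy, smul_add]
  | smul r x _ hx => simp only [map_smul, hx]; rw [smul_comm]

theorem sym_sym (l : List (Letter k V)) :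
    sym (sym (wd l)) = (l.length.factorial : k) • sym (wd l) := by
  induction l with
  | nil => simp
  | cons a l h =>
    rw [wd_cons, sym_ι_mul, sym_ins a (sym_wd_mem_wdEq l), h, map_smul, smul_smul,
      List.length_cons, Nat.factorial_succ]
    push_cast
    rfl

theorem tmap_ins {p : V →ₗ[k] W} (hp : LDeg 0 p) (v : V) (x : TensorAlgebra k V) :
    tmap p (ins v x) = ins (p v) (tmap p x) := by
  refine letter_induction (k := k) (C := fun v => tmap p (ins v x) = ins (p v) (tmap p x))
    (by simp) (fun a => ?_) (fun x y hx hy => by simp [hx, hy]) v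
  have hl : ∀ b : Letter k V, p b.val ∈ SignGraded.hdeg (k := k) b.deg := fun b => by
    simpa using hp _ _ b.mem
  induction x using wd_induction with
  | hw l =>
    induction l with
    | nil => simp
    | cons b l h =>
      simp only [wd_cons, ins_letter, map_add, map_mul, map_smul, tmap_ι, h,
        ins_ι_mul (hl a) (hl b)]
  | h0 => simp
  | add x y hx hy => simp [hx, hy]
  | smul r x hx => simp [hx]

theorem tmap_sym {p : V →ₗ[k] W} (hp : LDeg 0 p) (x : TensorAlgebra k V) :
    tmap p (sym x) = sym (tmap p x) := by
  have : (tmap p).toLinearMap ∘ₗ sym = sym ∘ₗ (tmap p).toLinearMap := by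
    apply ext_left
    · simp
    · intro v x hx
      simp only [LinearMap.comp_apply, AlgHom.toLinearMap_apply] at hx ⊢
      simp [tmap_ins hp, hx]
  exact LinearMap.congr_fun this x

/-- The coderivation extending a linear map of degree one. -/
noncomputable def lcod (d : V →ₗ[k] V) : TensorAlgebra k V →ₗ[k] TensorAlgebra k V :=
  cod (psgn 1) (d ∘ₗ pr)

@[simp] theorem lcod_one (d : V →ₗ[k] V) : lcod d 1 = 0 := by simp [lcod]

theorem lcod_ι_mul (d : V →ₗ[k] V) (v : V) (x : TensorAlgebra k V) :
    lcod d (𝓲 v * x) = 𝓲 (d v) * x + 𝓲 (psgn (k := k) 1 v) * lcod d x := by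
  rw [lcod, cod_ι_mul, ← LinearMap.comp_assoc, pr_conv]
  rfl

/-- The graded commutator of `lcod d` with insertion of `a` is insertion of `d a`; hence `lcod d`
commutes with `sym`. -/
theorem lcod_ins {d : V →ₗ[k] V} (hd : LDeg 1 d) (a : Letter k V) (x : TensorAlgebra k V) :
    lcod d (ins a.val x) = ins (d a.val) x + sg k a.deg • ins a.val (lcod d x) := by
  have ps : ∀ b : Letter k V, psgn (k := k) 1 b.val = sg k b.deg • b.val := fun b => by
    rw [psgn_apply 1 b.mem, one_mul]
  induction x using wd_induction with
  | hw l =>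
    induction l with
    | nil =>
      have := lcod_ι_mul d a.val 1
      simp only [mul_one, lcod_one, mul_zero, add_zero] at this
      simp [this]
    | cons b l h =>
      have e1 := ins_ι_mul (hd _ _ a.mem) b.mem (wd l)
      have e2 := ins_ι_mul a.mem (hd _ _ b.mem) (wd l)
      have e3 := ins_letter a b (lcod d (wd l))
      rw [show (a.deg + 1) * b.deg = a.deg * b.deg + b.deg by ring, sg_add] at e1
      rw [show a.deg * (b.deg + 1) = a.deg * b.deg + a.deg by ring, sg_add] at e2
      rw [wd_cons, ins_letter]
      simp only [map_add, map_smul, lcod_ι_mul, h, e1, ps, smul_mul_assoc, mul_add, smul_add,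
        mul_smul_comm, e2, e3, smul_smul]
      have e := sg_mul_self (k := k) a.deg
      linear_combination (norm := module) (-(sg k (a.deg * b.deg)) * e) •
        (𝓲 (d b.val) * ins a.val (wd l))
  | h0 => simp
  | add x y hx hy => simp only [map_add, hx, hy, smul_add]; abel
  | smul r x hx => simp only [map_smul, hx, smul_add]; rw [smul_comm r (sg k _)]

theorem lcod_sym {d : V →ₗ[k] V} (hd : LDeg 1 d) (x : TensorAlgebra k V) :
    lcod d (sym x) = sym (lcod d x) := by
  induction x using wd_induction with
  | hw l =>
    induction l with
    | nil => simp
    | cons a l h =>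
      rw [wd_cons, sym_ι_mul, lcod_ins hd, h, lcod_ι_mul, map_add, sym_ι_mul, sym_ι_mul,
        psgn_apply 1 a.mem]
      simp
  | h0 => simp
  | add x y hx hy => simp only [map_add, hx, hy]
  | smul r x hx => simp only [map_smul, hx]

/-- The homotopy on tensors induced by a homotopy `h` from the identity to `r`. -/
noncomputable def tensHomotopy (h r : V →ₗ[k] V) : TensorAlgebra k V →ₗ[k] TensorAlgebra k V :=
  LinearMap.snd k _ _ ∘ₗ fold (M := TensorAlgebra k V × TensorAlgebra k V)
    (LinearMap.mk₂ k (fun (v : V) p =>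
      (𝓲 v * p.1, 𝓲 (h v) * p.1 + 𝓲 (r (psgn (k := k) 1 v)) * p.2))
      (by intros; simp [add_mul]; abel) (by intros; simp)
      (by intros; simp [mul_add]; abel) (by intros; simp)) (1, 0)

@[simp] theorem tensHomotopy_one (h r : V →ₗ[k] V) : tensHomotopy h r 1 = 0 := by
  simp [tensHomotopy]

theorem tensHomotopy_ι_mul (h r : V →ₗ[k] V) (v : V) (x : TensorAlgebra k V) :
    tensHomotopy h r (𝓲 v * x) =
      𝓲 (h v) * x + 𝓲 (r (psgn (k := k) 1 v)) * tensHomotopy h r x := by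
  have e : LinearMap.fst k _ _ ∘ₗ fold (M := TensorAlgebra k V × TensorAlgebra k V)
    (LinearMap.mk₂ k (fun (v : V) p =>
      (𝓲 v * p.1, 𝓲 (h v) * p.1 + 𝓲 (r (psgn (k := k) 1 v)) * p.2))
      (by intros; simp [add_mul]; abel) (by intros; simp)
      (by intros; simp [mul_add]; abel) (by intros; simp)) (1, 0) = LinearMap.id := by
    apply ext_left
    · simp
    · intro v x hx
      simp only [LinearMap.comp_apply, LinearMap.fst_apply] at hx
      simp [hx]
  have e2 := LinearMap.congr_fun e x
  simp only [LinearMap.comp_apply, LinearMap.fst_apply, LinearMap.id_apply] at e2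
  simp only [tensHomotopy, LinearMap.comp_apply, fold_ι_mul, LinearMap.mk₂_apply,
    LinearMap.snd_apply, e2]

theorem tensHomotopy_mem_wdEq (h r : V →ₗ[k] V) {n : ℕ} {x : TensorAlgebra k V}
    (hx : x ∈ wdEq k V n) : tensHomotopy h r x ∈ wdEq k V n := by
  induction hx using Submodule.span_induction with
  | mem x hx =>
    obtain ⟨l, rfl, rfl⟩ := hx
    induction l with
    | nil => simp
    | cons a l ih =>
      rw [wd_cons, tensHomotopy_ι_mul]
      exact add_mem (ι_mul_mem_wdEq _ (wd_mem_wdEq l)) (ι_mul_mem_wdEq _ ih)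
  | zero => simp
  | add x y _ _ hx hy => rw [map_add]; exact add_mem hx hy
  | smul r x _ hx => rw [map_smul]; exact Submodule.smul_mem _ _ hx

theorem lcod_mem_wdEq (d : V →ₗ[k] V) {n : ℕ} {x : TensorAlgebra k V}
    (hx : x ∈ wdEq k V n) : lcod d x ∈ wdEq k V n := by
  induction hx using Submodule.span_induction with
  | mem x hx =>
    obtain ⟨l, rfl, rfl⟩ := hx
    induction l with
    | nil => simp
    | cons a l ih =>
      rw [wd_cons, lcod_ι_mul]
      exact add_mem (ι_mul_mem_wdEq _ (wd_mem_wdEq l)) (ι_mul_mem_wdEq _ ih)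
  | zero => simp
  | add x y _ _ hx hy => rw [map_add]; exact add_mem hx hy
  | smul r x _ hx => rw [map_smul]; exact Submodule.smul_mem _ _ hx

theorem deg_tensHomotopy {h r : V →ₗ[k] V} (hh : LDeg (-1) h) (hr : LDeg 0 r) :
    Deg (-1) (tensHomotopy h r) := by
  apply deg_of_wd
  intro l
  induction l with
  | nil => simp
  | cons a l ih =>
    rw [wd_cons, tensHomotopy_ι_mul, tdeg_cons]
    refine add_mem ?_ ?_
    · have := ι_mul_mem_gr (hh _ _ a.mem) (wd_mem_gr l)
      convert this using 2; ring
    · have := ι_mul_mem_gr (hr _ _ (ldeg_psgn 1 _ _ a.mem)) ih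
      convert this using 2; ring

theorem psgn_anticomm {s : ℤ} {d : V →ₗ[k] V} (hd : LDeg s d) (hs : ¬ Even s) (v : V) :
    psgn (k := k) 1 (d v) = - d (psgn (k := k) 1 v) := by
  refine letter_induction (k := k)
    (C := fun v => psgn (k := k) 1 (d v) = - d (psgn (k := k) 1 v))
    (by simp) (fun a => ?_) (fun x y hx hy => by simp only [map_add, hx, hy]; abel) v
  rw [psgn_apply 1 (hd _ _ a.mem), psgn_apply 1 a.mem, one_mul, one_mul, sg_add, sg_odd hs]
  simp

/-- The tensor trick: `h` acts on one letter, letters to its left are replaced by their images under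
`r`, and letters to its right are kept, so the commutator telescopes. The formula favours the left,
and symmetry is restored afterwards by applying `sym`. -/
theorem lcod_tensHomotopy {d h r : V →ₗ[k] V} (hd : LDeg 1 d) (hh : LDeg (-1) h)
    (hr : LDeg 0 r) (hdh : ∀ v, d (h v) + h (d v) = v - r v) (hdr : ∀ v, d (r v) = r (d v))
    (x : TensorAlgebra k V) :
    lcod d (tensHomotopy h r x) + tensHomotopy h r (lcod d x) = x - tmap r x := by
  have : lcod d ∘ₗ tensHomotopy h r + tensHomotopy h r ∘ₗ lcod d =
      LinearMap.id - (tmap r).toLinearMap := by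
    apply ext_left
    · simp
    · intro v x hx
      simp only [LinearMap.add_apply, LinearMap.sub_apply, LinearMap.comp_apply,
        LinearMap.id_apply, AlgHom.toLinearMap_apply] at hx ⊢
      have h1 : psgn (k := k) 1 (h v) = - h (psgn (k := k) 1 v) :=
        psgn_anticomm hh (by decide) v
      have h2 : psgn (k := k) 1 (d v) = - d (psgn (k := k) 1 v) :=
        psgn_anticomm hd (by decide) v
      have h3 : ∀ v, psgn (k := k) 1 (r v) = r (psgn (k := k) 1 v) := by
        intro v
        refine letter_induction (k := k)
          (C := fun v => psgn (k := k) 1 (r v) = r (psgn (k := k) 1 v))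
          (by simp) (fun a => ?_) (fun x y hx hy => by simp only [map_add, hx, hy]) v
        rw [psgn_apply 1 (hr _ _ a.mem), psgn_apply 1 a.mem]; simp
      have h4 : psgn (k := k) 1 (psgn (k := k) 1 v) = v := by
        refine letter_induction (k := k)
          (C := fun v => psgn (k := k) 1 (psgn (k := k) 1 v) = v)
          (by simp) (fun a => ?_) (fun x y hx hy => by simp only [map_add, hx, hy]) v
        rw [psgn_apply 1 a.mem, map_smul, psgn_apply 1 a.mem, smul_smul]; simp
      have h5 : d (h v) = v - r v - h (d v) := by rw [← hdh]; abel
      have h6 : lcod d (tensHomotopy h r x) = x - tmap r x - tensHomotopy h r (lcod d x) := by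
        rw [← hx]; abel
      simp only [tensHomotopy_ι_mul, lcod_ι_mul, map_add, h1, h2, h3, h4, hdr, h5, h6, map_neg,
        map_mul, tmap_ι, map_sub, neg_mul, mul_sub, sub_mul]
      abel
  exact LinearMap.congr_fun this x

end SymLength

/-! ### Codifferentials, morphisms and defects -/

section Differentials

variable {k : Type u} [CommRing k] [Algebra ℚ k]
  {V : Type v} [AddCommGroup V] [Module k V] [SignGraded k V]
  {W : Type w} [AddCommGroup W] [Module k W] [SignGraded k W]
  {U : Type x} [AddCommGroup U] [Module k U] [SignGraded k U]

local notation "𝓲" => TensorAlgebra.ι k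

/-- A coderivation of degree one whose square vanishes on symmetric tensors. -/
structure IsDiff (Q : TensorAlgebra k V →ₗ[k] TensorAlgebra k V) : Prop where
  cod : IsCod (psgn 1) Q
  deg : Deg 1 Q
  sq : EqSym (Q ∘ₗ Q) 0

/-- A coalgebra map of degree zero that commutes with the differentials on symmetric tensors. -/
structure IsMor (Q : TensorAlgebra k V →ₗ[k] TensorAlgebra k V)
    (Q' : TensorAlgebra k W →ₗ[k] TensorAlgebra k W)
    (Φ : TensorAlgebra k V →ₗ[k] TensorAlgebra k W) : Prop where
  co : IsCo Φ
  deg : Deg 0 Φ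
  comm : EqSym (Q' ∘ₗ Φ) (Φ ∘ₗ Q)

/-- The linear part of an operator on tensors. -/
noncomputable def linPart (Φ : TensorAlgebra k V →ₗ[k] TensorAlgebra k W) : V →ₗ[k] W :=
  pr ∘ₗ Φ ∘ₗ 𝓲

theorem linPart_apply (Φ : TensorAlgebra k V →ₗ[k] TensorAlgebra k W) (v : V) :
    linPart Φ v = pr (Φ (𝓲 v)) := rfl

theorem ldeg_linPart {s : ℤ} {Φ : TensorAlgebra k V →ₗ[k] TensorAlgebra k W} (hΦ : Deg s Φ) :
    LDeg s (linPart Φ) := by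
  intro i x hx
  have := fdeg_pr _ _ (hΦ _ _ (ι_mem_gr hx))
  rw [add_zero] at this
  exact this

theorem IsCod.eq_cod {p : V →ₗ[k] V} {Q : TensorAlgebra k V →ₗ[k] TensorAlgebra k V}
    (hQ : IsCod p Q) : Q = Tens.cod p (pr ∘ₗ Q) :=
  hQ.ext (isCod_cod _ _) fun x => by rw [pr_cod]; rfl

theorem IsDiff.fdeg {Q : TensorAlgebra k V →ₗ[k] TensorAlgebra k V} (hQ : IsDiff Q) :
    FDeg 1 (pr ∘ₗ Q) := fdeg_pr.comp hQ.deg (by norm_num)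

theorem IsDiff.presSym {Q : TensorAlgebra k V →ₗ[k] TensorAlgebra k V} (hQ : IsDiff Q) :
    PresSym Q := by
  rw [hQ.cod.eq_cod]
  exact presSym_cod hQ.fdeg

theorem ι_mem_range_sym (v : V) : 𝓲 v ∈ LinearMap.range (sym (k := k) (V := V)) := ⟨𝓲 v, by simp⟩

theorem one_mem_range_sym : 1 ∈ LinearMap.range (sym (k := k) (V := V)) := ⟨1, by simp⟩

theorem wd_mem_range_sym (l : List (Letter k V)) :
    sym (wd l) ∈ LinearMap.range (sym (k := k) (V := V)) := ⟨_, rfl⟩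

theorem IsDiff.apply_ι {Q : TensorAlgebra k V →ₗ[k] TensorAlgebra k V} (hQ : IsDiff Q)
    (h1 : Q 1 = 0) (v : V) : Q (𝓲 v) = 𝓲 (linPart Q v) := by
  have h := hQ.cod.eq_conv
  have e : Q (𝓲 v) = (conv (𝓲 ∘ₗ pr ∘ₗ Q) LinearMap.id + conv (𝓲 ∘ₗ psgn 1 ∘ₗ pr) Q : _ →ₗ[k] _)
    (𝓲 v) := by rw [← h]
  rw [e]
  simp [conv_apply, delta_ι, h1, linPart]

theorem IsDiff.linPart_sq {Q : TensorAlgebra k V →ₗ[k] TensorAlgebra k V} (hQ : IsDiff Q)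
    (h1 : Q 1 = 0) (v : V) : linPart Q (linPart Q v) = 0 := by
  have := hQ.sq.apply (ι_mem_range_sym v)
  simp only [LinearMap.comp_apply, hQ.apply_ι h1, LinearMap.zero_apply] at this
  rwa [TensorAlgebra.ι_eq_zero_iff] at this

theorem IsMor.presSym {Q : TensorAlgebra k V →ₗ[k] TensorAlgebra k V}
    {Q' : TensorAlgebra k W →ₗ[k] TensorAlgebra k W}
    {Φ : TensorAlgebra k V →ₗ[k] TensorAlgebra k W} (h : IsMor Q Q' Φ) : PresSym Φ :=
  h.co.presSym h.deg

theorem IsMor.comm_apply {Q : TensorAlgebra k V →ₗ[k] TensorAlgebra k V}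
    {Q' : TensorAlgebra k W →ₗ[k] TensorAlgebra k W}
    {Φ : TensorAlgebra k V →ₗ[k] TensorAlgebra k W} (h : IsMor Q Q' Φ) {x : TensorAlgebra k V}
    (hx : x ∈ LinearMap.range (sym (k := k) (V := V))) : Q' (Φ x) = Φ (Q x) :=
  h.comm.apply hx

theorem IsMor.comp {Q : TensorAlgebra k V →ₗ[k] TensorAlgebra k V}
    {Q' : TensorAlgebra k W →ₗ[k] TensorAlgebra k W}
    {Q'' : TensorAlgebra k U →ₗ[k] TensorAlgebra k U}
    {Ψ : TensorAlgebra k W →ₗ[k] TensorAlgebra k U}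
    {Φ : TensorAlgebra k V →ₗ[k] TensorAlgebra k W} (hΨ : IsMor Q' Q'' Ψ) (hΦ : IsMor Q Q' Φ) :
    IsMor Q Q'' (Ψ ∘ₗ Φ) where
  co := hΨ.co.comp hΦ.co
  deg := hΨ.deg.comp hΦ.deg rfl
  comm := EqSym.of_wd fun l => by
    simp only [LinearMap.comp_apply]
    rw [hΨ.comm_apply (hΦ.presSym _ (wd_mem_range_sym l)), hΦ.comm_apply (wd_mem_range_sym l)]

/-- The defect of a coalgebra map from being a morphism is a coderivation along it. -/
theorem defect_eq {Q : TensorAlgebra k V →ₗ[k] TensorAlgebra k V}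
    {Q' : TensorAlgebra k W →ₗ[k] TensorAlgebra k W} (hQ : IsCod (psgn 1) Q)
    (hQ' : IsCod (psgn 1) Q') {Φ : TensorAlgebra k V →ₗ[k] TensorAlgebra k W} (hΦ : IsCo Φ)
    (hd : Deg 0 Φ) : Q' ∘ₗ Φ - Φ ∘ₗ Q =
      conv (𝓲 ∘ₗ (pr ∘ₗ (Q' ∘ₗ Φ - Φ ∘ₗ Q))) Φ +
        conv (𝓲 ∘ₗ (psgn 1 ∘ₗ pr ∘ₗ Φ)) (Q' ∘ₗ Φ - Φ ∘ₗ Q) := by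
  have e1 : Q' ∘ₗ Φ = conv (𝓲 ∘ₗ pr ∘ₗ Q' ∘ₗ Φ) Φ + conv (𝓲 ∘ₗ psgn 1 ∘ₗ pr ∘ₗ Φ) (Q' ∘ₗ Φ) := by
    conv_lhs => rw [hQ'.eq_conv, LinearMap.add_comp, hΦ.conv_comp, hΦ.conv_comp]
    rfl
  have e2 : Φ ∘ₗ Q = conv (𝓲 ∘ₗ pr ∘ₗ Φ ∘ₗ Q) Φ + conv (𝓲 ∘ₗ psgn 1 ∘ₗ pr ∘ₗ Φ) (Φ ∘ₗ Q) := by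
    conv_lhs => rw [hΦ.eq_conv, LinearMap.add_comp, hQ.conv_comp]
    have h : (convUnit : TensorAlgebra k V →ₗ[k] TensorAlgebra k W) ∘ₗ Q = 0 := by
      ext x; simp [convUnit, hQ.eps]
    -- As `Φ` has degree zero it commutes with the sign twist, so both composites obey a recursion
    -- with the same second factor and can be subtracted.
    have h2 : (𝓲 ∘ₗ pr ∘ₗ Φ) ∘ₗ (tmap (psgn 1)).toLinearMap = 𝓲 ∘ₗ psgn 1 ∘ₗ pr ∘ₗ Φ := by
      ext x
      simp [hd.tmap_psgn]
    rw [h, zero_add, h2]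
    rfl
  have e3 : ∀ a b, conv (𝓲 ∘ₗ (pr ∘ₗ (a - b))) Φ =
      conv (𝓲 ∘ₗ pr ∘ₗ a) Φ - conv (𝓲 ∘ₗ pr ∘ₗ b) Φ := by
    intro a b
    rw [sub_eq_add_neg, LinearMap.comp_add, LinearMap.comp_add, conv_add_left, LinearMap.comp_neg,
      LinearMap.comp_neg, conv_neg_left, sub_eq_add_neg]
  have e4 : ∀ c a b : TensorAlgebra k V →ₗ[k] TensorAlgebra k W,
      conv c (a - b) = conv c a - conv c b := by
    intro c a b
    rw [sub_eq_add_neg, conv_add_right, conv_neg_right, sub_eq_add_neg]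
  rw [e3, e4]
  conv_lhs => rw [e1, e2]
  abel

/-- A coderivation along a coalgebra map vanishes on symmetric tensors if its composite with a map
with identity linear part does. -/
theorem eqSym_zero_of_comp {Θ Φ : TensorAlgebra k V →ₗ[k] TensorAlgebra k W}
    {ψ : TensorAlgebra k V →ₗ[k] W} (hΘ : Θ = conv (𝓲 ∘ₗ (pr ∘ₗ Θ)) Φ + conv (𝓲 ∘ₗ ψ) Θ)
    (hΦ : Φ 1 = 1) (hψ : ψ 1 = 0) (F : TensorAlgebra k W →ₗ[k] W) (hF : ∀ w, F (𝓲 w) = w)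
    (h : EqSym (F ∘ₗ Θ) 0) : EqSym Θ 0 := by
  have key : ∀ n, ∀ l : List (Letter k V), l.length < n → (pr ∘ₗ Θ) (sym (wd l)) = 0 := by
    intro n
    induction n with
    | zero => intro l hl; omega
    | succ n ih =>
      intro l hl
      -- On the shortest tensors not yet treated, `Θ` takes values in length one, where `F` is the
      -- identity.
      have e := eq_ι_pr_of_vanish hΘ hΦ hψ n ih l (by omega)
      have := h.wd l
      rw [LinearMap.comp_apply, e, hF] at this
      simpa using this
  apply EqSym.of_wd
  intro l
  rw [eq_ι_pr_of_vanish hΘ hΦ hψ _ (key l.length) l le_rfl, key _ l (Nat.lt_succ_self _)]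
  simp

end Differentials

/-! ### Lifting when the kernel of the right-hand map is contractible -/

section Contraction

variable {k : Type u} [CommRing k] [Algebra ℚ k]
  {A : Type*} [AddCommGroup A] [Module k A] [SignGraded k A]
  {B : Type*} [AddCommGroup B] [Module k B] [SignGraded k B]
  {C : Type*} [AddCommGroup C] [Module k C] [SignGraded k C]
  {D : Type*} [AddCommGroup D] [Module k D] [SignGraded k D]

local notation "𝓲" => TensorAlgebra.ι k

/-- The lifting property for strict maps when the right hand map has a contractible kernel. -/
theorem exists_lift_of_contractible_kernel
    {QA : TensorAlgebra k A →ₗ[k] TensorAlgebra k A} {QB : TensorAlgebra k B →ₗ[k] TensorAlgebra k B}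
    {QC : TensorAlgebra k C →ₗ[k] TensorAlgebra k C} {QD : TensorAlgebra k D →ₗ[k] TensorAlgebra k D}
    (hQB : IsDiff QB) (hQC : IsDiff QC)
    {c : TensorAlgebra k A →ₗ[k] TensorAlgebra k C} (hc : IsMor QA QC c)
    {d : TensorAlgebra k B →ₗ[k] TensorAlgebra k D} (hd : IsMor QB QD d)
    {f : A →ₗ[k] B} (hf : IsMor QA QB (tmap f).toLinearMap)
    {p : B →ₗ[k] A} (hp : LDeg 0 p) (hpf : ∀ a, p (f a) = a)
    {e : C →ₗ[k] D} (hedeg : LDeg 0 e) (he : IsMor QC QD (tmap e).toLinearMap)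
    {s : D →ₗ[k] C} (hs : LDeg 0 s) (hes : ∀ x, e (s x) = x)
    (hsq : EqSym ((tmap e).toLinearMap ∘ₗ c) (d ∘ₗ (tmap f).toLinearMap))
    (h1 : QC 1 = 0) {h : C →ₗ[k] C} (hh : LDeg (-1) h) (heh : ∀ x, e (h x) = 0)
    (hdh : ∀ x, linPart QC (h x) + h (linPart QC x) = x - s (e x)) :
    ∃ g : TensorAlgebra k B →ₗ[k] TensorAlgebra k C, IsMor QB QC g ∧
      EqSym (g ∘ₗ (tmap f).toLinearMap) c ∧ EqSym ((tmap e).toLinearMap ∘ₗ g) d := by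
  set δ := linPart QC with hδ
  have hδdeg : LDeg 1 δ := ldeg_linPart hQC.deg
  have hδδ : ∀ x, δ (δ x) = 0 := hQC.linPart_sq h1
  have heδ : ∀ x, e x = 0 → e (δ x) = 0 := by
    intro x hx
    have h2 := he.comm_apply (ι_mem_range_sym x)
    simp only [AlgHom.toLinearMap_apply, tmap_ι, hQC.apply_ι h1, hx, map_zero] at h2
    rwa [eq_comm, TensorAlgebra.ι_eq_zero_iff] at h2
  -- the component of `C` in the contractible direction
  let κ : TensorAlgebra k C →ₗ[k] C := δ ∘ₗ h ∘ₗ pr + h ∘ₗ pr ∘ₗ QC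
  have κ_apply : ∀ x, κ x = δ (h (pr x)) + h (pr (QC x)) := fun x => rfl
  have hpr : FDeg (-1) (h ∘ₗ pr) := hh.comp_fdeg fdeg_pr (by norm_num)
  have κdeg : FDeg 0 κ :=
    FDeg.add (hδdeg.comp_fdeg hpr (by norm_num)) (hh.comp_fdeg hQC.fdeg (by norm_num))
  have κ1 : κ 1 = 0 := by rw [κ_apply, h1]; simp
  have eκ : ∀ x, e (κ x) = 0 := by
    intro x; rw [κ_apply, map_add, heδ _ (heh _), heh, add_zero]
  -- Being a boundary, `κ` intertwines the codifferential with `δ`: it is a morphism from `C` to the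
  -- complex `ker e` with no higher operations.
  have κQ : ∀ x ∈ LinearMap.range (sym (k := k) (V := C)), κ (QC x) = δ (κ x) := by
    intro x hx
    have := hQC.sq.apply hx
    simp only [LinearMap.comp_apply, LinearMap.zero_apply] at this
    rw [κ_apply, κ_apply, this, map_add, hδδ]; simp
  -- Coordinates in which `C` is the product of `D` and the complex `ker e`. By the homotopy formula
  -- the linear part of `F` is the identity, so `hat F` is invertible.
  let F : TensorAlgebra k C →ₗ[k] C := s ∘ₗ e ∘ₗ pr + κ
  have F_apply : ∀ x, F x = s (e (pr x)) + κ x := fun x => rfl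
  have F1 : F 1 = 0 := by rw [F_apply, κ1]; simp
  have Fdeg : FDeg 0 F :=
    FDeg.add (hs.comp_fdeg (hedeg.comp_fdeg fdeg_pr (add_zero 0).symm) (add_zero 0).symm) κdeg
  have Fι : ∀ x, F (𝓲 x) = x := by
    intro x
    have : κ (𝓲 x) = x - s (e x) := by rw [κ_apply, pr_ι, ← linPart_apply, ← hδ, hdh]
    rw [F_apply, this, pr_ι]; abel
  have eF : ∀ x, e (F x) = e (pr x) := fun x => by rw [F_apply, map_add, eκ, hes, add_zero]
  obtain ⟨ψ, hψco, hψdeg, hθψ, hψθ⟩ := (isCo_hat F F1).exists_inverse (deg_hat F1 Fdeg)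
    (fun v => by rw [pr_hat F F1, Fι])
  -- the extension of the contractible component
  let H : TensorAlgebra k B →ₗ[k] C := h ∘ₗ κ ∘ₗ c ∘ₗ (tmap p).toLinearMap
  have H_apply : ∀ x, H x = h (κ (c (tmap p x))) := fun x => rfl
  have Hf : ∀ x, H (tmap f x) = h (κ (c x)) := by
    intro x
    have : p ∘ₗ f = LinearMap.id := LinearMap.ext hpf
    rw [H_apply, tmap_tmap, this, tmap_id]; rfl
  have Hdeg : FDeg (-1) H :=
    hh.comp_fdeg (κdeg.comp (hc.deg.comp (deg_tmap hp) rfl) rfl) (by norm_num)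
  have eH : ∀ x, e (H x) = 0 := fun x => heh _
  -- A boundary commutes with the differentials whatever `H` is. Along `f` it restricts to `δ h κ c
  -- + h δ κ c`, which is `κ c` because its values lie in `ker e`.
  let γ : TensorAlgebra k B →ₗ[k] C := δ ∘ₗ H + H ∘ₗ QB
  have γ_apply : ∀ x, γ x = δ (H x) + H (QB x) := fun x => rfl
  have γdeg : FDeg 0 γ := (hδdeg.comp_fdeg Hdeg (by norm_num)).add (Hdeg.comp hQB.deg (by norm_num))
  have eγ : ∀ x, e (γ x) = 0 := by
    intro x; rw [γ_apply, map_add, heδ _ (eH _), eH, add_zero]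
  have γQ : ∀ x ∈ LinearMap.range (sym (k := k) (V := B)), γ (QB x) = δ (γ x) := by
    intro x hx
    have := hQB.sq.apply hx
    simp only [LinearMap.comp_apply, LinearMap.zero_apply] at this
    rw [γ_apply, γ_apply, this, map_add, hδδ]; simp
  have γf : ∀ x ∈ LinearMap.range (sym (k := k) (V := A)), γ (tmap f x) = κ (c x) := by
    intro x hx
    have e1 := hf.comm_apply hx
    simp only [AlgHom.toLinearMap_apply] at e1
    rw [γ_apply, e1, Hf, Hf, ← hc.comm_apply hx, κQ _ (hc.presSym _ hx), hdh, eκ]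
    simp
  have γ1 : γ 1 = 0 := by
    rw [← map_one (tmap f), γf 1 one_mem_range_sym, hc.co.one, κ1]
  let ω : TensorAlgebra k B →ₗ[k] C := s ∘ₗ pr ∘ₗ d + γ
  have ω_apply : ∀ x, ω x = s (pr (d x)) + γ x := fun x => rfl
  have ω1 : ω 1 = 0 := by rw [ω_apply, γ1, hd.co.one]; simp
  have ωdeg : FDeg 0 ω :=
    FDeg.add (hs.comp_fdeg (fdeg_pr.comp hd.deg (add_zero 0).symm) (add_zero 0).symm) γdeg
  -- The map with coordinates `d` and `γ`, moved back through the inverse of `hat F`.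
  let g := ψ ∘ₗ hat ω
  have gco : IsCo g := hψco.comp (isCo_hat ω ω1)
  have gdeg : Deg 0 g := hψdeg.comp (deg_hat ω1 ωdeg) rfl
  have gpres : PresSym g := gco.presSym gdeg
  have θg : ∀ x, F (g x) = ω x := by
    intro x
    have : hat F (g x) = hat ω x := LinearMap.congr_fun hθψ _
    rw [← pr_hat F F1, this, pr_hat ω ω1]
  have eg : ∀ x, e (pr (g x)) = pr (d x) := by
    intro x
    rw [← eF, θg, ω_apply, map_add, hes, eγ, add_zero]
  have κg : ∀ x, κ (g x) = γ x := by
    intro x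
    have := θg x
    rw [F_apply, eg, ω_apply] at this
    exact add_left_cancel this
  have heg : (tmap e).toLinearMap ∘ₗ g = d :=
    ((isCo_tmap e).comp gco).ext hd.co fun x => by
      rw [LinearMap.comp_apply, AlgHom.toLinearMap_apply, pr_tmap, eg]
  refine ⟨g, ⟨gco, gdeg, ?_⟩, ?_, ?_⟩
  -- The morphism equation is tested through `F`, where it splits into the one for `d` and the one
  -- for `γ`.
  · have := eqSym_zero_of_comp (defect_eq hQB.cod hQC.cod gco gdeg) gco.one
      (by simp [gco.one]) F Fι (EqSym.of_wd fun l => ?_)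
    · apply EqSym.of_wd
      intro l
      have := this.wd l
      simpa [sub_eq_zero] using this
    · have hx := wd_mem_range_sym l
      have hgx := gpres _ hx
      have e1 : tmap e (QC (g (sym (wd l)))) = QD (d (sym (wd l))) := by
        have := he.comm_apply hgx
        simp only [AlgHom.toLinearMap_apply] at this
        rw [← this, ← heg]; rfl
      simp only [LinearMap.comp_apply, LinearMap.sub_apply, map_sub, LinearMap.zero_apply]
      rw [F_apply, F_apply, κg, κQ _ hgx, κg, γQ _ hx, eg, ← pr_tmap, e1, hd.comm_apply hx,
        sub_self]
  · have h2 : EqSym (hat F ∘ₗ (g ∘ₗ (tmap f).toLinearMap)) (hat F ∘ₗ c) := by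
      refine ((isCo_hat F F1).comp (gco.comp (isCo_tmap f))).eqSym
        ((deg_hat F1 Fdeg).comp (gdeg.comp hf.deg rfl) rfl) ((isCo_hat F F1).comp hc.co)
        ((deg_hat F1 Fdeg).comp hc.deg rfl) (EqSym.of_wd fun l => ?_)
      have hx := wd_mem_range_sym l
      have e1 := hsq.wd l
      simp only [LinearMap.comp_apply, AlgHom.toLinearMap_apply] at e1 ⊢
      rw [pr_hat F F1, pr_hat F F1, θg, ω_apply, γf _ hx, ← e1, F_apply, pr_tmap]
    have h3 := h2.comp_left ψ
    rwa [← LinearMap.comp_assoc, hψθ, LinearMap.id_comp, ← LinearMap.comp_assoc, hψθ,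
      LinearMap.id_comp] at h3
  · rw [heg]; exact EqSym.refl _

end Contraction

/-! ### The obstruction to being a morphism -/

section Defect

variable {k : Type u} [CommRing k] [Algebra ℚ k]
  {B : Type v} [AddCommGroup B] [Module k B] [SignGraded k B]
  {C : Type w} [AddCommGroup C] [Module k C] [SignGraded k C]

local notation "𝓲" => TensorAlgebra.ι k

theorem symLt_le_wdLt (n : ℕ) : symLt k B n ≤ wdLt k B n := by
  rw [symLt, Submodule.span_le]
  rintro _ ⟨l, hl, rfl⟩
  exact wdEq_le_wdLt hl (sym_wd_mem_wdEq l)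

/-- A codifferential without constant term agrees with its linear part up to shorter symmetric
tensors. -/
theorem IsDiff.sub_lcod_mem {Q : TensorAlgebra k B →ₗ[k] TensorAlgebra k B} (hQ : IsDiff Q)
    (h1 : Q 1 = 0) (l : List (Letter k B)) :
    Q (sym (wd l)) - lcod (linPart Q) (sym (wd l)) ∈ symLt k B l.length := by
  have hd : FDeg 1 (linPart Q ∘ₗ pr) := (ldeg_linPart hQ.deg).comp_fdeg fdeg_pr (zero_add 1)
  have e1 : Q (sym (wd l)) = _ :=
    (LinearMap.congr_fun hQ.cod.eq_cod _).trans (cod_sym hQ.fdeg l)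
  have e2 : lcod (linPart Q) (sym (wd l)) = _ := cod_sym hd l
  have e3 : Q (sym (wd l)) - lcod (linPart Q) (sym (wd l)) = unsh l fun l₁ l₂ =>
      ins ((pr ∘ₗ Q - linPart Q ∘ₗ pr) (sym (wd l₁))) (sym (wd l₂)) := by
    rw [e1, e2, sub_eq_iff_eq_add, ← unsh_add]
    refine unsh_congr _ fun l₁ l₂ _ _ => ?_
    rw [← LinearMap.add_apply, ← map_add, LinearMap.sub_apply, sub_add_cancel]
  rw [e3]
  refine unsh_mem _ _ fun l₁ l₂ hl _ => ?_
  match l₁, hl with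
  | [], _ => simp [h1]
  | [a], _ => simp [linPart]
  | a :: b :: l₁, hl =>
    simp only [List.length_cons] at hl
    exact symLt_mono (by omega) (ins_mem_symLt _ (sym_mem_symLt (Nat.lt_succ_self _)))

theorem IsDiff.mem_wdLt {Q : TensorAlgebra k B →ₗ[k] TensorAlgebra k B} (hQ : IsDiff Q)
    (h1 : Q 1 = 0) (l : List (Letter k B)) : Q (sym (wd l)) ∈ wdLt k B (l.length + 1) := by
  have h2 := symLt_le_wdLt _ (symLt_mono (Nat.le_succ _) (hQ.sub_lcod_mem h1 l))
  have h3 := wdEq_le_wdLt (Nat.lt_succ_self _)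
    (lcod_mem_wdEq (linPart Q) (sym_wd_mem_wdEq (k := k) l))
  simpa using add_mem h2 h3

/-- The failure of the coalgebra map with components `g` to be a morphism. -/
noncomputable def defect (QB : TensorAlgebra k B →ₗ[k] TensorAlgebra k B)
    (QC : TensorAlgebra k C →ₗ[k] TensorAlgebra k C) (g : TensorAlgebra k B →ₗ[k] C) :
    TensorAlgebra k B →ₗ[k] C :=
  pr ∘ₗ QC ∘ₗ hat g - g ∘ₗ QB

variable {QB : TensorAlgebra k B →ₗ[k] TensorAlgebra k B}
  {QC : TensorAlgebra k C →ₗ[k] TensorAlgebra k C}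

theorem defect_apply (g : TensorAlgebra k B →ₗ[k] C) (x : TensorAlgebra k B) :
    defect QB QC g x = pr (QC (hat g x)) - g (QB x) := rfl

theorem pr_comp_defect {g : TensorAlgebra k B →ₗ[k] C} (g1 : g 1 = 0) :
    pr ∘ₗ (QC ∘ₗ hat g - hat g ∘ₗ QB) = defect QB QC g := by
  ext1 x
  simp [defect_apply, pr_hat g g1]

theorem fdeg_defect (hQB : IsDiff QB) (hQC : IsDiff QC) {g : TensorAlgebra k B →ₗ[k] C}
    (g1 : g 1 = 0) (hg : FDeg 0 g) : FDeg 1 (defect QB QC g) :=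
  FDeg.sub (hQC.fdeg.comp (deg_hat g1 hg) (zero_add 1)) (hg.comp hQB.deg (add_zero 1))

/-- The difference of the two coalgebra maps obeys the recursion of a coderivation with projection
`X`. Up to length `n`, a block on which `X` is nonzero leaves no room for others. -/
theorem hat_add_apply {g X : TensorAlgebra k B →ₗ[k] C} (g1 : g 1 = 0) (X1 : X 1 = 0) {n : ℕ}
    (hX : ∀ l : List (Letter k B), l.length < n → X (sym (wd l)) = 0) (l : List (Letter k B))
    (hl : l.length ≤ n) :
    hat (g + X) (sym (wd l)) = hat g (sym (wd l)) + 𝓲 (X (sym (wd l))) := by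
  have gX1 : (g + X) 1 = 0 := by simp [g1, X1]
  have e : hat (g + X) - hat g =
      conv (𝓲 ∘ₗ X) (hat g) + conv (𝓲 ∘ₗ (g + X)) (hat (g + X) - hat g) := by
    conv_lhs => rw [hat_eq (g + X) gX1, hat_eq g g1]
    rw [sub_eq_add_neg (hat (g + X)), conv_add_right, conv_neg_right]
    conv_rhs => rw [LinearMap.comp_add, conv_add_left, conv_add_left]
    rw [LinearMap.comp_add, conv_add_left]
    abel
  have := eq_ι_pr_of_vanish e (hat_one g g1) gX1 n hX l hl
  rw [LinearMap.sub_apply] at this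
  rw [← this]; abel

/-- In the lowest length the correction `X` changes the defect linearly, through the differential of
the complex of maps. -/
theorem defect_add_apply (hQC : IsDiff QC) (hC1 : QC 1 = 0)
    {g X : TensorAlgebra k B →ₗ[k] C} (g1 : g 1 = 0) (X1 : X 1 = 0) {n : ℕ}
    (hX : ∀ l : List (Letter k B), l.length < n → X (sym (wd l)) = 0) (l : List (Letter k B))
    (hl : l.length ≤ n) :
    defect QB QC (g + X) (sym (wd l)) = defect QB QC g (sym (wd l)) +
      (linPart QC (X (sym (wd l))) - X (QB (sym (wd l)))) := by
  rw [defect_apply, defect_apply, hat_add_apply g1 X1 hX l hl, map_add, hQC.apply_ι hC1, map_add,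
    pr_ι, LinearMap.add_apply]
  abel

theorem symLt_vanish {M : Type*} [AddCommGroup M] [Module k M] {E : TensorAlgebra k B →ₗ[k] M}
    {n : ℕ} (hE : ∀ l : List (Letter k B), l.length < n → E (sym (wd l)) = 0)
    {x : TensorAlgebra k B} (hx : x ∈ symLt k B n) : E x = 0 := by
  have : symLt k B n ≤ LinearMap.ker E := by
    rw [symLt, Submodule.span_le]
    rintro _ ⟨l, hl, rfl⟩
    exact hE l hl
  exact this hx

/-- For `Θ = QC Φ - Φ QB` the vanishing squares give `QC Θ = - Θ QB`. In the lowest length where `Θ`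
may be nonzero, only the linear parts of the codifferentials contribute. -/
theorem defect_closed (hQB : IsDiff QB) (hQC : IsDiff QC) (hB1 : QB 1 = 0) (hC1 : QC 1 = 0)
    {g : TensorAlgebra k B →ₗ[k] C} (g1 : g 1 = 0) (hg : FDeg 0 g) {n : ℕ}
    (hE : ∀ l : List (Letter k B), l.length < n → defect QB QC g (sym (wd l)) = 0)
    (l : List (Letter k B)) (hl : l.length = n) :
    linPart QC (defect QB QC g (sym (wd l))) =
      - defect QB QC g (lcod (linPart QB) (sym (wd l))) := by
  have hco := isCo_hat g g1
  have hdeg := deg_hat g1 hg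
  have e := defect_eq hQB.cod hQC.cod hco hdeg
  rw [pr_comp_defect g1] at e
  have e1 := eq_ι_pr_of_vanish e hco.one (by simp [hco.one]) n hE l hl.le
  have e2 : QB (sym (wd l)) = lcod (linPart QB) (sym (wd l)) +
      (QB (sym (wd l)) - lcod (linPart QB) (sym (wd l))) := by abel
  have e3 : defect QB QC g (QB (sym (wd l))) = defect QB QC g (lcod (linPart QB) (sym (wd l))) := by
    have := symLt_vanish hE (symLt_mono hl.le (hQB.sub_lcod_mem hB1 l))
    rw [e2, map_add, this, add_zero]
  rw [← e3, ← pr_ι (k := k) (linPart QC _), ← hQC.apply_ι hC1, ← e1, ← pr_comp_defect g1]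
  have e4 := hQC.sq.apply (hco.presSym hdeg _ (wd_mem_range_sym l))
  have e5 := hQB.sq.wd l
  simp only [LinearMap.comp_apply, LinearMap.sub_apply, LinearMap.zero_apply, map_sub] at e4 e5 ⊢
  rw [e4, e5]
  simp

theorem tensHomotopy_tmap {A : Type*} [AddCommGroup A] [Module k A] {f : A →ₗ[k] B}
    {h r : B →ₗ[k] B} (hf : ∀ a, h (f a) = 0) (x : TensorAlgebra k A) :
    tensHomotopy h r (tmap f x) = 0 := by
  induction x using left_induction with
  | one => simp [tensHomotopy_one]
  | mul v x ih => rw [map_mul, tmap_ι, tensHomotopy_ι_mul, ih, hf]; simp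
  | add x y hx hy => simp [hx, hy]
  | smul r x hx => simp [hx]

theorem isMor_hat (hQB : IsDiff QB) (hQC : IsDiff QC) {g : TensorAlgebra k B →ₗ[k] C}
    (g1 : g 1 = 0) (hg : FDeg 0 g) (hE : EqSym (defect QB QC g) 0) : IsMor QB QC (hat g) where
  co := isCo_hat g g1
  deg := deg_hat g1 hg
  comm := by
    have hco := isCo_hat g g1
    have h := eqSym_zero_of_comp (defect_eq hQB.cod hQC.cod hco (deg_hat g1 hg)) hco.one
      (by simp [hco.one]) pr (pr_ι) (by rwa [pr_comp_defect g1])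
    apply EqSym.of_wd
    intro l
    have := h.wd l
    simpa [sub_eq_zero] using this

end Defect

/-! ### Lifting by obstruction theory when the left-hand map is a deformation retract -/

section Retraction

variable {k : Type u} [CommRing k] [Algebra ℚ k]
  {A : Type*} [AddCommGroup A] [Module k A] [SignGraded k A]
  {B : Type*} [AddCommGroup B] [Module k B] [SignGraded k B]
  {C : Type*} [AddCommGroup C] [Module k C] [SignGraded k C]
  {D : Type*} [AddCommGroup D] [Module k D] [SignGraded k D]

local notation "𝓲" => TensorAlgebra.ι k

/-- The components of a coalgebra map that solves a lifting problem, up to being a morphism. -/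
structure IsPreLift (c : TensorAlgebra k A →ₗ[k] TensorAlgebra k C)
    (d : TensorAlgebra k B →ₗ[k] TensorAlgebra k D) (f : A →ₗ[k] B) (e : C →ₗ[k] D)
    (g : TensorAlgebra k B →ₗ[k] C) : Prop where
  one : g 1 = 0
  deg : FDeg 0 g
  left : EqSym (g ∘ₗ (tmap f).toLinearMap) (pr ∘ₗ c)
  right : e ∘ₗ g = pr ∘ₗ d

section

variable {QA : TensorAlgebra k A →ₗ[k] TensorAlgebra k A}
    {QB : TensorAlgebra k B →ₗ[k] TensorAlgebra k B}
    {QC : TensorAlgebra k C →ₗ[k] TensorAlgebra k C}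
    {QD : TensorAlgebra k D →ₗ[k] TensorAlgebra k D}
    {c : TensorAlgebra k A →ₗ[k] TensorAlgebra k C}
    {d : TensorAlgebra k B →ₗ[k] TensorAlgebra k D}
    {f : A →ₗ[k] B} {e : C →ₗ[k] D} {g : TensorAlgebra k B →ₗ[k] C}

theorem IsPreLift.tmap_hat (hg : IsPreLift c d f e g) (hd : IsCo d) :
    (tmap e).toLinearMap ∘ₗ hat g = d :=
  ((isCo_tmap e).comp (isCo_hat g hg.one)).ext hd fun x => by
    rw [LinearMap.comp_apply, AlgHom.toLinearMap_apply, pr_tmap, pr_hat g hg.one]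
    exact LinearMap.congr_fun hg.right x

theorem IsPreLift.hat_tmap (hg : IsPreLift c d f e g) (hf : Deg 0 (tmap f).toLinearMap)
    (hc : IsCo c) (hcd : Deg 0 c) : EqSym (hat g ∘ₗ (tmap f).toLinearMap) c :=
  ((isCo_hat g hg.one).comp (isCo_tmap f)).eqSym ((deg_hat hg.one hg.deg).comp hf rfl) hc hcd
    (EqSym.of_wd fun l => by
      have := hg.left.wd l
      rw [← this]
      simp [pr_hat g hg.one])

theorem IsPreLift.map_defect (hg : IsPreLift c d f e g) (hd : IsMor QB QD d)
    (he : IsMor QC QD (tmap e).toLinearMap) {x : TensorAlgebra k B}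
    (hx : x ∈ LinearMap.range (sym (k := k) (V := B))) : e (defect QB QC g x) = 0 := by
  have h1 := he.comm_apply ((isCo_hat g hg.one).presSym (deg_hat hg.one hg.deg) _ hx)
  have h2 : tmap e (hat g x) = d x := LinearMap.congr_fun (hg.tmap_hat hd.co) x
  have h3 : ∀ y, e (g y) = pr (d y) := fun y => LinearMap.congr_fun hg.right y
  simp only [AlgHom.toLinearMap_apply] at h1
  rw [defect_apply, map_sub, ← pr_tmap, ← h1, h2, hd.comm_apply hx, h3, sub_self]

theorem IsPreLift.defect_map (hg : IsPreLift c d f e g) (hc : IsMor QA QC c)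
    (hf : IsMor QA QB (tmap f).toLinearMap) (hA : IsDiff QA) {x : TensorAlgebra k A}
    (hx : x ∈ LinearMap.range (sym (k := k) (V := A))) : defect QB QC g (tmap f x) = 0 := by
  have h1 := (hg.hat_tmap hf.deg hc.co hc.deg).apply hx
  have h2 := hf.comm_apply hx
  have h3 := hg.left.apply (hA.presSym _ hx)
  simp only [AlgHom.toLinearMap_apply, LinearMap.comp_apply] at h1 h2 h3
  rw [defect_apply, h1, h2, h3, hc.comm_apply hx, sub_self]

/-- One step of the construction of a lift by induction on the number of arguments. -/
theorem IsPreLift.step (hg : IsPreLift c d f e g)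
    (hQA : IsDiff QA) (hQB : IsDiff QB) (hQC : IsDiff QC) (hB1 : QB 1 = 0) (hC1 : QC 1 = 0)
    (hc : IsMor QA QC c) (hd : IsMor QB QD d)
    (hf : IsMor QA QB (tmap f).toLinearMap) (he : IsMor QC QD (tmap e).toLinearMap)
    {p : B →ₗ[k] A} (hfp : LDeg 0 (f ∘ₗ p))
    {h : B →ₗ[k] B} (hh : LDeg (-1) h) (hhf : ∀ a, h (f a) = 0) (hfdeg : LDeg 0 f)
    (hdfp : ∀ b, linPart QB (f (p b)) = f (p (linPart QB b)))
    (hdh : ∀ b, linPart QB (h b) + h (linPart QB b) = b - f (p b)) (n : ℕ)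
    (hE : ∀ l : List (Letter k B), l.length < n → defect QB QC g (sym (wd l)) = 0) :
    ∃ g' : TensorAlgebra k B →ₗ[k] C, IsPreLift c d f e g' ∧
      (∀ l : List (Letter k B), l.length < n + 1 → defect QB QC g' (sym (wd l)) = 0) ∧
      ∀ l : List (Letter k B), l.length ≠ n → g' (wd l) = g (wd l) := by
  set E := defect QB QC g with hEdef
  set H := tensHomotopy h (f ∘ₗ p) with hH
  set r : k := algebraMap ℚ k ((n.factorial : ℚ)⁻¹) with hr
  have hr1 : r * (n.factorial : k) = 1 := by
    rw [hr, ← map_natCast (algebraMap ℚ k), ← map_mul,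
      inv_mul_cancel₀ (by exact_mod_cast n.factorial_ne_zero), map_one]
  -- Solves `δ Y - Y lcod = -E` on symmetric tensors of length `n`: closedness moves `δ` across `E`,
  -- and the homotopy formula then applies. The factor `r = 1 / n!` cancels `sym ∘ sym = n! sym`.
  set Y : TensorAlgebra k B →ₗ[k] C := r • (E ∘ₗ sym ∘ₗ H) with hY
  have Y_apply : ∀ x, Y x = r • E (sym (H x)) := fun x => rfl
  -- Only the component with `n` arguments is altered, so each component changes at one step of the
  -- construction only.
  set X : TensorAlgebra k B →ₗ[k] C := glue (fun m => if m = n then Y else 0) with hX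
  have Xn : ∀ {x}, x ∈ wdEq k B n → X x = Y x := fun hx => by rw [hX, glue_apply _ hx, if_pos rfl]
  have Xm : ∀ {m x}, x ∈ wdEq k B m → m ≠ n → X x = 0 := fun hx hm => by
    rw [hX, glue_apply _ hx, if_neg hm]; rfl
  have Ydeg : FDeg 0 Y := by
    have h1 : FDeg 0 (E ∘ₗ sym ∘ₗ H) :=
      (fdeg_defect hQB hQC hg.one hg.deg).comp
        (deg_sym.comp (deg_tensHomotopy hh hfp) (add_zero (-1))) (by norm_num)
    exact h1.smul r
  have Xdeg : FDeg 0 X := fdeg_of_wd fun l => by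
    by_cases hl : l.length = n
    · rw [Xn (hl ▸ wd_mem_wdEq l)]; exact Ydeg _ _ (wd_mem_gr l)
    · rw [Xm (wd_mem_wdEq l) hl]; exact zero_mem _
  have X1 : X 1 = 0 := by
    by_cases hn : n = 0
    · rw [Xn (hn ▸ wd_mem_wdEq (k := k) []), Y_apply, hH, tensHomotopy_one]; simp
    · exact Xm (wd_mem_wdEq (k := k) []) (Ne.symm hn)
  have eY : ∀ x, e (Y x) = 0 := fun x => by
    rw [Y_apply, map_smul, hg.map_defect hd he ⟨_, rfl⟩, smul_zero]
  have eX : e ∘ₗ X = 0 := ext_wd fun l => by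
    rw [LinearMap.comp_apply, LinearMap.zero_apply]
    by_cases hl : l.length = n
    · rw [Xn (hl ▸ wd_mem_wdEq l), eY]
    · rw [Xm (wd_mem_wdEq l) hl, map_zero]
  have Xf : ∀ l : List (Letter k A), X (tmap f (wd l)) = 0 := fun l => by
    by_cases hl : l.length = n
    · rw [Xn (tmap_mem_wdEq f (hl ▸ wd_mem_wdEq l)), Y_apply, hH, tensHomotopy_tmap hhf]; simp
    · exact Xm (tmap_mem_wdEq f (wd_mem_wdEq l)) hl
  have Xf' : X ∘ₗ (tmap f).toLinearMap = 0 := ext_wd Xf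
  have Xsym : ∀ l : List (Letter k B), l.length < n → X (sym (wd l)) = 0 := fun l hl =>
    Xm (sym_wd_mem_wdEq l) hl.ne
  have XQ : ∀ l : List (Letter k B), l.length ≤ n →
      X (QB (sym (wd l))) = X (lcod (linPart QB) (sym (wd l))) := fun l hl => by
    have := symLt_vanish Xsym (symLt_mono hl (hQB.sub_lcod_mem hB1 l))
    rwa [map_sub, sub_eq_zero] at this
  have hdB : LDeg 1 (linPart QB) := ldeg_linPart hQB.deg
  -- Needed for arbitrary tensors of length `n`, because `H` need not preserve symmetric ones.
  have closed : ∀ x ∈ wdEq k B n, linPart QC (E (sym x)) = - E (sym (lcod (linPart QB) x)) := by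
    intro x hx
    rw [← lcod_sym hdB]
    have h2 : wdEq k B n ≤ LinearMap.eqLocus (linPart QC ∘ₗ E ∘ₗ sym)
        (-(E ∘ₗ lcod (linPart QB) ∘ₗ sym)) := by
      rw [wdEq, Submodule.span_le]
      rintro _ ⟨l, hl, rfl⟩
      exact defect_closed hQB hQC hB1 hC1 hg.one hg.deg hE l hl
    exact h2 hx
  refine ⟨g + X, ⟨by simp [hg.one, X1], hg.deg.add Xdeg, ?_, ?_⟩, ?_, ?_⟩
  · rw [LinearMap.add_comp, Xf', add_zero]; exact hg.left
  · rw [LinearMap.comp_add, eX, add_zero]; exact hg.right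
  · intro l hl
    rw [defect_add_apply hQC hC1 hg.one X1 Xsym l (by omega), XQ l (by omega)]
    by_cases hn : l.length = n
    · have hx : sym (wd l) ∈ wdEq k B n := hn ▸ sym_wd_mem_wdEq l
      have key := lcod_tensHomotopy hdB hh hfp hdh hdfp (sym (wd l))
      have key2 := congrArg (fun y => r • E (sym y)) key
      simp only [map_add, map_sub, smul_add, smul_sub] at key2
      rw [sym_sym, hn, map_smul, smul_smul, hr1, one_smul] at key2
      -- The projection term of the homotopy formula lies in the image of `A`, where the defect
      -- vanishes.
      have h3 : E (sym (tmap (f ∘ₗ p) (sym (wd l)))) = 0 := by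
        rw [← tmap_tmap, ← tmap_sym hfdeg]
        exact hg.defect_map hc hf hQA ⟨_, rfl⟩
      rw [h3, smul_zero, sub_zero] at key2
      rw [Xn hx, Xn (lcod_mem_wdEq _ hx), Y_apply, Y_apply, map_smul,
        closed _ (tensHomotopy_mem_wdEq _ _ hx), ← hEdef, smul_neg, ← key2]
      abel
    · rw [Xm (sym_wd_mem_wdEq l) hn, Xm (lcod_mem_wdEq _ (sym_wd_mem_wdEq l)) hn,
        hE l (by omega)]
      simp
  · intro l hl
    rw [LinearMap.add_apply, Xm (wd_mem_wdEq l) hl, add_zero]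

end

/-- The lifting property for strict maps when the left hand map is a deformation retract. -/
theorem exists_lift_of_deformation_retract
    {QA : TensorAlgebra k A →ₗ[k] TensorAlgebra k A} {QB : TensorAlgebra k B →ₗ[k] TensorAlgebra k B}
    {QC : TensorAlgebra k C →ₗ[k] TensorAlgebra k C} {QD : TensorAlgebra k D →ₗ[k] TensorAlgebra k D}
    (hQA : IsDiff QA) (hQB : IsDiff QB) (hQC : IsDiff QC) (hB1 : QB 1 = 0) (hC1 : QC 1 = 0)
    {c : TensorAlgebra k A →ₗ[k] TensorAlgebra k C} (hc : IsMor QA QC c)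
    {d : TensorAlgebra k B →ₗ[k] TensorAlgebra k D} (hd : IsMor QB QD d)
    {f : A →ₗ[k] B} (hfdeg : LDeg 0 f) (hf : IsMor QA QB (tmap f).toLinearMap)
    {p : B →ₗ[k] A} (hp : LDeg 0 p) (hpf : ∀ a, p (f a) = a)
    {e : C →ₗ[k] D} (hedeg : LDeg 0 e) (he : IsMor QC QD (tmap e).toLinearMap)
    {s : D →ₗ[k] C} (hs : LDeg 0 s) (hes : ∀ x, e (s x) = x)
    (hsq : EqSym ((tmap e).toLinearMap ∘ₗ c) (d ∘ₗ (tmap f).toLinearMap))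
    {h : B →ₗ[k] B} (hh : LDeg (-1) h) (hhf : ∀ a, h (f a) = 0)
    (hdfp : ∀ b, linPart QB (f (p b)) = f (p (linPart QB b)))
    (hdh : ∀ b, linPart QB (h b) + h (linPart QB b) = b - f (p b)) :
    ∃ g : TensorAlgebra k B →ₗ[k] TensorAlgebra k C, IsMor QB QC g ∧
      EqSym (g ∘ₗ (tmap f).toLinearMap) c ∧ EqSym ((tmap e).toLinearMap ∘ₗ g) d := by
  -- The components `s d + (1 - s e) c p`: the second summand lies in `ker e`, and along `f` the sum
  -- becomes `s e c + (1 - s e) c = c`.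
  let g₀ : TensorAlgebra k B →ₗ[k] C :=
    s ∘ₗ pr ∘ₗ d + (pr ∘ₗ (c ∘ₗ (tmap p).toLinearMap) -
      s ∘ₗ e ∘ₗ (pr ∘ₗ (c ∘ₗ (tmap p).toLinearMap)))
  have g₀_apply : ∀ x, g₀ x = s (pr (d x)) + (pr (c (tmap p x)) - s (e (pr (c (tmap p x))))) :=
    fun x => rfl
  have hcp : FDeg 0 (pr ∘ₗ (c ∘ₗ (tmap p).toLinearMap)) :=
    fdeg_pr.comp (hc.deg.comp (deg_tmap hp) rfl) rfl
  have hg₀ : IsPreLift c d f e g₀ := by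
    refine ⟨?_, FDeg.add (hs.comp_fdeg (fdeg_pr.comp hd.deg rfl) rfl)
      (hcp.sub (hs.comp_fdeg (hedeg.comp_fdeg hcp rfl) rfl)), EqSym.of_wd fun l => ?_, ?_⟩
    · rw [g₀_apply, hd.co.one, map_one (tmap p), hc.co.one]; simp
    · have e1 := hsq.wd l
      have e2 : tmap p (tmap f (sym (wd l))) = sym (wd l) := by
        have : p ∘ₗ f = LinearMap.id := LinearMap.ext hpf
        rw [tmap_tmap, this, tmap_id]; rfl
      simp only [LinearMap.comp_apply, AlgHom.toLinearMap_apply] at e1 ⊢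
      rw [g₀_apply, e2, ← e1, pr_tmap]; abel
    · ext1 x
      rw [LinearMap.comp_apply, g₀_apply, map_add, map_sub, hes, hes, sub_self, add_zero]; rfl
  let P : ℕ → (TensorAlgebra k B →ₗ[k] C) → Prop := fun n g => IsPreLift c d f e g ∧
    ∀ l : List (Letter k B), l.length < n → defect QB QC g (sym (wd l)) = 0
  have step : ∀ n g, P n g → ∃ g', P (n + 1) g' ∧
      ∀ l : List (Letter k B), l.length ≠ n → g' (wd l) = g (wd l) := by
    rintro n g ⟨hg, hE⟩
    obtain ⟨g', h1, h2, h3⟩ := hg.step hQA hQB hQC hB1 hC1 hc hd hf he (hfdeg.comp hp rfl) hh hhf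
      hfdeg hdfp hdh n hE
    exact ⟨g', ⟨h1, h2⟩, h3⟩
  choose! next hnext hagree using step
  let G : ℕ → TensorAlgebra k B →ₗ[k] C := fun n => Nat.rec g₀ (fun m g => next m g) n
  have hG : ∀ n, P n (G n) := fun n => by
    induction n with
    | zero => exact ⟨hg₀, fun l hl => absurd hl (Nat.not_lt_zero _)⟩
    | succ n ih => exact hnext n _ ih
  have hGl : ∀ m (l : List (Letter k B)), l.length < m → G m (wd l) = G (l.length + 1) (wd l) := by
    intro m l hl
    induction m with
    | zero => omega
    | succ m ih =>
      rcases Nat.lt_succ_iff_lt_or_eq.mp hl with h' | h'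
      · rw [← ih h']; exact hagree m _ (hG m) l h'.ne
      · rw [h']
  -- Step `n` fixes the component with `n` arguments, so that component is final from `G (n + 1)`
  -- on.
  let g := glue (fun n => G (n + 1))
  have hgl : ∀ m, ∀ x ∈ wdLt k B m, g x = G m x := by
    intro m x hx
    have : wdLt k B m ≤ LinearMap.eqLocus g (G m) := by
      rw [wdLt, Submodule.span_le]
      rintro _ ⟨l, hl, rfl⟩
      exact (glue_wd _ l).trans (hGl m l hl).symm
    exact this hx
  have hg : IsPreLift c d f e g := by
    refine ⟨?_, fdeg_of_wd fun l => ?_, EqSym.of_wd fun l => ?_, ext_wd fun l => ?_⟩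
    · rw [hgl 1 1 (wd_mem_wdLt (l := []) zero_lt_one)]; exact (hG 1).1.one
    · rw [glue_wd]; exact (hG (l.length + 1)).1.deg _ _ (wd_mem_gr l)
    · rw [LinearMap.comp_apply, AlgHom.toLinearMap_apply, hgl (l.length + 1) _
        (wdEq_le_wdLt (Nat.lt_succ_self _) (tmap_mem_wdEq f (sym_wd_mem_wdEq l)))]
      exact (hG (l.length + 1)).1.left.wd l
    · rw [LinearMap.comp_apply, glue_wd]
      exact LinearMap.congr_fun (hG (l.length + 1)).1.right (wd l)
  have hE : EqSym (defect QB QC g) 0 := EqSym.of_wd fun l => by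
    have hgm := hG (l.length + 1)
    -- The second summand vanishes on all words of length at most that of `l`, and the defect on `l`
    -- involves no others.
    have e1 : g = G (l.length + 1) + (g - G (l.length + 1)) := by abel
    have hv : ∀ x ∈ wdLt k B (l.length + 1), (g - G (l.length + 1)) x = 0 := fun x hx => by
      rw [LinearMap.sub_apply, hgl _ x hx, sub_self]
    rw [e1, defect_add_apply hQC hC1 hgm.1.one (by rw [LinearMap.sub_apply, hg.one, hgm.1.one,
      sub_self]) (n := l.length + 1) (fun l' hl' => hv _ (wdEq_le_wdLt hl' (sym_wd_mem_wdEq l')))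
      l (Nat.le_succ _), hv _ (hQB.mem_wdLt hB1 l), hgm.2 l (Nat.lt_succ_self _),
      hv _ (wdEq_le_wdLt (Nat.lt_succ_self _) (sym_wd_mem_wdEq l))]
    simp
  refine ⟨hat g, isMor_hat hQB hQC hg.one hg.deg hE, hg.hat_tmap hf.deg hc.co hc.deg, ?_⟩
  rw [hg.tmap_hat hd.co]
  exact EqSym.refl _

end Retraction

/-! ### Reduction to linear vertical maps -/

section Strictification

variable {k : Type u} [CommRing k] [Algebra ℚ k]
  {A : Type*} [AddCommGroup A] [Module k A] [SignGraded k A]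
  {B : Type*} [AddCommGroup B] [Module k B] [SignGraded k B]
  {C : Type*} [AddCommGroup C] [Module k C] [SignGraded k C]
  {D : Type*} [AddCommGroup D] [Module k D] [SignGraded k D]

local notation "𝓲" => TensorAlgebra.ι k

/-- Transport of a codifferential along a coalgebra automorphism with identity linear part. -/
theorem IsDiff.exists_conj {Q : TensorAlgebra k B →ₗ[k] TensorAlgebra k B} (hQ : IsDiff Q)
    {χ ψ : TensorAlgebra k B →ₗ[k] TensorAlgebra k B} (hχ : IsCo χ) (hχd : Deg 0 χ)
    (hψ : IsCo ψ) (hψd : Deg 0 ψ) (hχψ : χ ∘ₗ ψ = LinearMap.id) (hψχ : ψ ∘ₗ χ = LinearMap.id)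
    (h1 : ∀ v, pr (χ (𝓲 v)) = v) :
    ∃ Q' : TensorAlgebra k B →ₗ[k] TensorAlgebra k B, IsDiff Q' ∧ IsMor Q' Q χ ∧ IsMor Q Q' ψ ∧
      (Q 1 = 0 → Q' 1 = 0 ∧ linPart Q' = linPart Q) := by
  have a1 : ∀ x, χ (ψ x) = x := LinearMap.congr_fun hχψ
  have a2 : ∀ x, ψ (χ x) = x := LinearMap.congr_fun hψχ
  have pχ : PresSym χ := hχ.presSym hχd
  refine ⟨ψ ∘ₗ Q ∘ₗ χ, ⟨hχ.comp_isCod hψ hQ.cod hψχ ?_, ?_, EqSym.of_wd fun l => ?_⟩,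
    ⟨hχ, hχd, EqSym.of_wd fun l => ?_⟩, ⟨hψ, hψd, EqSym.of_wd fun l => ?_⟩, fun hQ1 => ⟨?_, ?_⟩⟩
  · ext1 x
    simp only [LinearMap.comp_apply, AlgHom.toLinearMap_apply]
    rw [hψd.tmap_psgn, a2]
  · exact hψd.comp (hQ.deg.comp hχd (zero_add 1)) (add_zero 1)
  · have := hQ.sq.apply (pχ _ (wd_mem_range_sym l))
    simp only [LinearMap.comp_apply, LinearMap.zero_apply] at this ⊢
    rw [a1, this, map_zero]
  · simp only [LinearMap.comp_apply]
    rw [a1]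
  · simp only [LinearMap.comp_apply]
    rw [a1]
  · simp only [LinearMap.comp_apply]
    rw [hχ.one, hQ1, map_zero]
  · ext1 v
    have e1 : ∀ v, χ (𝓲 v) = 𝓲 v := fun v => by rw [hχ.apply_ι, h1]
    have e2 : ψ (𝓲 (linPart Q v)) = 𝓲 (linPart Q v) := by
      conv_lhs => rw [← e1, a2]
    rw [linPart_apply, LinearMap.comp_apply, LinearMap.comp_apply, e1, hQ.apply_ι hQ1, e2, pr_ι]

/-- A morphism with split injective linear part is strict up to an automorphism of the target. -/
theorem exists_strict_left {f : TensorAlgebra k A →ₗ[k] TensorAlgebra k B} (hf : IsCo f)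
    (hfd : Deg 0 f) {p : B →ₗ[k] A} (hp : LDeg 0 p) (hpf : ∀ a, p (linPart f a) = a) :
    ∃ χ : TensorAlgebra k B →ₗ[k] TensorAlgebra k B, IsCo χ ∧ Deg 0 χ ∧
      (∀ v, pr (χ (𝓲 v)) = v) ∧ χ ∘ₗ (tmap (linPart f)).toLinearMap = f := by
  -- The first summand extends the components of `f` along `p`. The second vanishes on the image of
  -- the linear part of `f` and makes the linear part of `F` the identity.
  let F : TensorAlgebra k B →ₗ[k] B :=
    pr ∘ₗ (f ∘ₗ (tmap p).toLinearMap) + (pr - linPart f ∘ₗ (p ∘ₗ pr))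
  have F_apply : ∀ x, F x = pr (f (tmap p x)) + (pr x - linPart f (p (pr x))) := fun x => rfl
  have F1 : F 1 = 0 := by rw [F_apply, map_one (tmap p), hf.one]; simp
  have Fd : FDeg 0 F := FDeg.add (fdeg_pr.comp (hfd.comp (deg_tmap hp) rfl) rfl)
    (fdeg_pr.sub ((ldeg_linPart hfd).comp_fdeg (hp.comp_fdeg fdeg_pr rfl) rfl))
  refine ⟨hat F, isCo_hat F F1, deg_hat F1 Fd, fun v => ?_,
    ((isCo_hat F F1).comp (isCo_tmap _)).ext hf fun x => ?_⟩
  · rw [pr_hat F F1, F_apply, tmap_ι, pr_ι, ← linPart_apply]; abel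
  · have h : p ∘ₗ linPart f = LinearMap.id := LinearMap.ext hpf
    rw [LinearMap.comp_apply, AlgHom.toLinearMap_apply, pr_hat F F1, F_apply, tmap_tmap, h, tmap_id,
      pr_tmap, hpf, sub_self, add_zero]
    rfl

/-- A morphism with split surjective linear part is strict up to an automorphism of the source. -/
theorem exists_strict_right {e : TensorAlgebra k C →ₗ[k] TensorAlgebra k D} (he : IsCo e)
    (hed : Deg 0 e) {s : D →ₗ[k] C} (hs : LDeg 0 s) (hes : ∀ x, linPart e (s x) = x) :
    ∃ θ : TensorAlgebra k C →ₗ[k] TensorAlgebra k C, IsCo θ ∧ Deg 0 θ ∧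
      (∀ v, pr (θ (𝓲 v)) = v) ∧ (tmap (linPart e)).toLinearMap ∘ₗ θ = e := by
  -- The first summand lifts the components of `e` along `s`. The second lies in the kernel of the
  -- linear part and makes the linear part of `F` the identity.
  let F : TensorAlgebra k C →ₗ[k] C := s ∘ₗ (pr ∘ₗ e) + (pr - s ∘ₗ (linPart e ∘ₗ pr))
  have F_apply : ∀ x, F x = s (pr (e x)) + (pr x - s (linPart e (pr x))) := fun x => rfl
  have F1 : F 1 = 0 := by rw [F_apply, he.one]; simp
  have Fd : FDeg 0 F := FDeg.add (hs.comp_fdeg (fdeg_pr.comp hed rfl) rfl)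
    (fdeg_pr.sub (hs.comp_fdeg ((ldeg_linPart hed).comp_fdeg fdeg_pr rfl) rfl))
  refine ⟨hat F, isCo_hat F F1, deg_hat F1 Fd, fun v => ?_,
    ((isCo_tmap _).comp (isCo_hat F F1)).ext he fun x => ?_⟩
  · rw [pr_hat F F1, F_apply, pr_ι, ← linPart_apply]; abel
  · rw [LinearMap.comp_apply, AlgHom.toLinearMap_apply, pr_tmap, pr_hat F F1, F_apply, map_add,
      map_sub, hes, hes, sub_self, add_zero]

/-- The lifting property, given contraction data for the linear part of one of the vertical maps. -/
theorem exists_lift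
    {QA : TensorAlgebra k A →ₗ[k] TensorAlgebra k A} {QB : TensorAlgebra k B →ₗ[k] TensorAlgebra k B}
    {QC : TensorAlgebra k C →ₗ[k] TensorAlgebra k C} {QD : TensorAlgebra k D →ₗ[k] TensorAlgebra k D}
    (hQA : IsDiff QA) (hQB : IsDiff QB) (hQC : IsDiff QC)
    {c : TensorAlgebra k A →ₗ[k] TensorAlgebra k C} (hc : IsMor QA QC c)
    {d : TensorAlgebra k B →ₗ[k] TensorAlgebra k D} (hd : IsMor QB QD d)
    {f : TensorAlgebra k A →ₗ[k] TensorAlgebra k B} (hf : IsMor QA QB f)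
    {p : B →ₗ[k] A} (hp : LDeg 0 p) (hpf : ∀ a, p (linPart f a) = a)
    {e : TensorAlgebra k C →ₗ[k] TensorAlgebra k D} (he : IsMor QC QD e)
    {s : D →ₗ[k] C} (hs : LDeg 0 s) (hes : ∀ x, linPart e (s x) = x)
    (hsq : EqSym (e ∘ₗ c) (d ∘ₗ f))
    (hcon : (QB 1 = 0 ∧ QC 1 = 0 ∧ ∃ h : B →ₗ[k] B, LDeg (-1) h ∧
        (∀ a, h (linPart f a) = 0) ∧
        (∀ b, linPart QB (linPart f (p b)) = linPart f (p (linPart QB b))) ∧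
        ∀ b, linPart QB (h b) + h (linPart QB b) = b - linPart f (p b)) ∨
      (QC 1 = 0 ∧ ∃ h : C →ₗ[k] C, LDeg (-1) h ∧ (∀ x, linPart e (h x) = 0) ∧
        ∀ x, linPart QC (h x) + h (linPart QC x) = x - s (linPart e x))) :
    ∃ g : TensorAlgebra k B →ₗ[k] TensorAlgebra k C, IsMor QB QC g ∧
      EqSym (g ∘ₗ f) c ∧ EqSym (e ∘ₗ g) d := by
  obtain ⟨χ, hχ, hχd, hχ1, hχf⟩ := exists_strict_left hf.co hf.deg hp hpf
  obtain ⟨ψ, hψ, hψd, hχψ, hψχ⟩ := hχ.exists_inverse hχd hχ1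
  obtain ⟨QB', hQB', mχ, mψ, hB1⟩ := hQB.exists_conj hχ hχd hψ hψd hχψ hψχ hχ1
  obtain ⟨θ, hθ, hθd, hθ1, heθ⟩ := exists_strict_right he.co he.deg hs hes
  obtain ⟨φ, hφ, hφd, hθφ, hφθ⟩ := hθ.exists_inverse hθd hθ1
  have hφ1 : ∀ v, pr (φ (𝓲 v)) = v := fun v => by
    have e1 : θ (𝓲 v) = 𝓲 v := by rw [hθ.apply_ι, hθ1]
    have e2 : φ (θ (𝓲 v)) = 𝓲 v := LinearMap.congr_fun hφθ _
    rw [e1] at e2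
    rw [e2, pr_ι]
  obtain ⟨QC', hQC', mφ, mθ, hC1⟩ := hQC.exists_conj hφ hφd hθ hθd hφθ hθφ hφ1
  have ef : ψ ∘ₗ f = (tmap (linPart f)).toLinearMap := by
    rw [← hχf, ← LinearMap.comp_assoc, hψχ, LinearMap.id_comp, hχf]
  have ee : e ∘ₗ φ = (tmap (linPart e)).toLinearMap := by
    conv_lhs => rw [← heθ, LinearMap.comp_assoc, hθφ, LinearMap.comp_id]
  have hf' : IsMor QA QB' (tmap (linPart f)).toLinearMap := ef ▸ mψ.comp hf
  have he' : IsMor QC' QD (tmap (linPart e)).toLinearMap := ee ▸ he.comp mφ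
  have hsq' : EqSym ((tmap (linPart e)).toLinearMap ∘ₗ (θ ∘ₗ c))
      ((d ∘ₗ χ) ∘ₗ (tmap (linPart f)).toLinearMap) := by
    rw [← LinearMap.comp_assoc, heθ, LinearMap.comp_assoc, hχf]; exact hsq
  obtain ⟨g, hg, hgf, heg⟩ : ∃ g : TensorAlgebra k B →ₗ[k] TensorAlgebra k C, IsMor QB' QC' g ∧
      EqSym (g ∘ₗ (tmap (linPart f)).toLinearMap) (θ ∘ₗ c) ∧
      EqSym ((tmap (linPart e)).toLinearMap ∘ₗ g) (d ∘ₗ χ) := by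
    -- For codifferentials without constant term, conjugation leaves the linear parts unchanged, so
    -- the contraction data carry over.
    rcases hcon with ⟨hB, hC, h, hh, hhf, hdfp, hdh⟩ | ⟨hC, h, hh, heh, hdh⟩
    · obtain ⟨hB0, hBl⟩ := hB1 hB
      exact exists_lift_of_deformation_retract hQA hQB' hQC' hB0 (hC1 hC).1 (mθ.comp hc)
        (hd.comp mχ) (ldeg_linPart hf.deg) hf' hp hpf (ldeg_linPart he.deg) he' hs hes hsq' hh hhf
        (hBl ▸ hdfp) (hBl ▸ hdh)
    · obtain ⟨hC0, hCl⟩ := hC1 hC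
      exact exists_lift_of_contractible_kernel hQB' hQC' (mθ.comp hc) (hd.comp mχ) hf' hp hpf
        (ldeg_linPart he.deg) he' hs hes hsq' hC0 hh heh (hCl ▸ hdh)
  refine ⟨φ ∘ₗ g ∘ₗ ψ, mφ.comp (hg.comp mψ), ?_, ?_⟩
  · have h2 := hgf.comp_left φ
    rw [← LinearMap.comp_assoc c θ φ, hφθ, LinearMap.id_comp, ← ef] at h2
    exact h2
  · have h2 := heg.comp_right mψ.presSym
    rw [LinearMap.comp_assoc ψ χ d, hχψ, LinearMap.comp_id, ← ee] at h2
    exact h2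

end Strictification

/-! ### Contraction data from split quasi-isomorphisms of complexes -/

section Complexes

variable {k : Type u} [CommRing k]

/-- The homogeneous parts of a graded module admit projections. -/
def HasProj (k : Type u) [CommRing k] (M : Type v) [AddCommGroup M] [Module k M]
    [SignGraded k M] : Prop :=
  ∃ P : ℤ → M →ₗ[k] M, (∀ i x, P i x ∈ SignGraded.hdeg (k := k) (V := M) i) ∧
    (∀ i, ∀ x ∈ SignGraded.hdeg (k := k) (V := M) i, P i x = x) ∧
    ∀ i j, i ≠ j → ∀ x ∈ SignGraded.hdeg (k := k) (V := M) j, P i x = 0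

variable {M : Type v} [AddCommGroup M] [Module k M] [SignGraded k M]
  {N : Type w} [AddCommGroup N] [Module k N] [SignGraded k N]

theorem LDeg.add {s : ℤ} {f g : M →ₗ[k] N} (hf : LDeg s f) (hg : LDeg s g) : LDeg s (f + g) :=
  fun i x hx => add_mem (hf i x hx) (hg i x hx)

theorem LDeg.sub {s : ℤ} {f g : M →ₗ[k] N} (hf : LDeg s f) (hg : LDeg s g) : LDeg s (f - g) :=
  fun i x hx => sub_mem (hf i x hx) (hg i x hx)

theorem LDeg.id : LDeg 0 (LinearMap.id : M →ₗ[k] M) := fun i x hx => by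
  rw [add_zero]; exact hx

theorem LDeg.comp_proj {s : ℤ} {φ : M →ₗ[k] N} (hφ : LDeg s φ) {P : ℤ → M →ₗ[k] M}
    (hP : ∀ i, ∀ x ∈ SignGraded.hdeg (k := k) (V := M) i, P i x = x)
    (hP' : ∀ i j, i ≠ j → ∀ x ∈ SignGraded.hdeg (k := k) (V := M) j, P i x = 0)
    {R : ℤ → N →ₗ[k] N} (hR : ∀ i, ∀ x ∈ SignGraded.hdeg (k := k) (V := N) i, R i x = x)
    (hR' : ∀ i j, i ≠ j → ∀ x ∈ SignGraded.hdeg (k := k) (V := N) j, R i x = 0)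
    (i : ℤ) (x : M) : φ (P i x) = R (i + s) (φ x) := by
  refine letter_induction (k := k) (C := fun x => φ (P i x) = R (i + s) (φ x)) (by simp)
    (fun a => ?_) (fun x y hx hy => by simp only [map_add, hx, hy]) x
  have h := hφ _ _ a.mem
  by_cases hi : i = a.deg
  · subst hi; rw [hP _ _ a.mem, hR _ _ h]
  · rw [hP' _ _ hi _ a.mem, hR' _ _ (by omega) _ h, map_zero]

/-- A total, single-valued linear relation is a graph, so unique existence avoids making linear
choices by hand. -/
theorem exists_linearMap_of_rel (R : Submodule k (N × M)) (ex : ∀ b, ∃ c, (b, c) ∈ R)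
    (uniq : ∀ c, ((0 : N), c) ∈ R → c = 0) : ∃ u : N →ₗ[k] M, ∀ b, (b, u b) ∈ R := by
  have uniq' : ∀ b c c', (b, c) ∈ R → (b, c') ∈ R → c = c' := fun b c c' h h' => by
    rw [← sub_eq_zero]
    apply uniq
    have := R.sub_mem h h'
    simpa using this
  choose u hu using ex
  exact ⟨{ toFun := u
           map_add' := fun x y => uniq' _ _ _ (hu _) (R.add_mem (hu x) (hu y))
           map_smul' := fun r x => uniq' _ _ _ (hu _) (R.smul_mem r (hu x)) }, hu⟩

/-- A quasi-isomorphism of split complexes has a homogeneous inverse up to homology. -/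
theorem exists_homology_inverse (hM : HasProj k M) (hN : HasProj k N)
    {d : M →ₗ[k] M} (hd : LDeg 1 d) (hdd : ∀ x, d (d x) = 0)
    {η : M →ₗ[k] M} (hη : LDeg (-1) η) (hdη : ∀ x, d (η (d x)) = d x)
    {δ : N →ₗ[k] N} (hδ : LDeg 1 δ) {ζ : N →ₗ[k] N} (hζ : LDeg (-1) ζ)
    (hδζ : ∀ x, δ (ζ (δ x)) = δ x)
    {φ : M →ₗ[k] N} (hφ : LDeg 0 φ) (hφd : ∀ x, φ (d x) = δ (φ x))
    (hinj : ∀ a, d a = 0 → (∃ b, δ b = φ a) → ∃ a', d a' = a)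
    (hsurj : ∀ b, δ b = 0 → ∃ a, d a = 0 ∧ ∃ b', φ a - b = δ b') :
    ∃ u : N →ₗ[k] M, LDeg 0 u ∧ (∀ b, d (u b) = 0) ∧
      ∀ b, δ b = 0 → ∃ b', φ (u b) - b = δ b' := by
  -- `b - ζ δ b` projects `b` to the cycles, and `d η c = 0` singles out among cycles a complement
  -- of the boundaries. So `c` is the preferred representative of the class corresponding to that of
  -- the projected `b`.
  let R : Submodule k (N × M) :=
    { carrier := {x | d x.2 = 0 ∧ d (η x.2) = 0 ∧ ∃ y, φ x.2 - (x.1 - ζ (δ x.1)) = δ y}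
      zero_mem' := ⟨by simp, by simp, 0, by simp⟩
      add_mem' := by
        rintro x x' ⟨h1, h2, y, h3⟩ ⟨h1', h2', y', h3'⟩
        refine ⟨by simp [h1, h1'], by simp [h2, h2'], y + y', ?_⟩
        rw [map_add, ← h3, ← h3', Prod.snd_add, Prod.fst_add]
        simp only [map_add]
        abel
      smul_mem' := by
        rintro r x ⟨h1, h2, y, h3⟩
        refine ⟨by simp [h1], by simp [h2], r • y, ?_⟩
        rw [map_smul, ← h3]
        simp [smul_sub] }
  have uniq : ∀ c, ((0 : N), c) ∈ R → c = 0 := by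
    rintro c ⟨h1, h2, y, h3⟩
    obtain ⟨z, rfl⟩ := hinj c h1 ⟨y, by simpa using h3.symm⟩
    simpa [hdη] using h2
  obtain ⟨u, hu⟩ := exists_linearMap_of_rel R (fun b => by
    obtain ⟨c, hc, y, hy⟩ := hsurj (b - ζ (δ b)) (by rw [map_sub, hδζ, sub_self])
    refine ⟨c - d (η c), ?_, ?_, y - φ (η c), ?_⟩
    · simp [hc, hdd]
    · simp [hdη]
    · change φ (c - d (η c)) - (b - ζ (δ b)) = _
      rw [map_sub, map_sub, ← hy, hφd]; abel) uniq
  refine ⟨u, fun i b hb => ?_, fun b => (hu b).1, fun b hb => ?_⟩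
  · obtain ⟨P, hP0, hP, hP'⟩ := hM
    obtain ⟨S, -, hS, hS'⟩ := hN
    obtain ⟨h1, h2, y, h3⟩ := hu b
    have hdη0 : LDeg 0 (d ∘ₗ η) := hd.comp hη (by norm_num)
    have hb' : b - ζ (δ b) ∈ SignGraded.hdeg (k := k) (V := N) i := by
      have := hζ _ _ (hδ _ _ hb)
      rw [add_neg_cancel_right] at this
      exact sub_mem hb this
    have hR : (b, P i (u b)) ∈ R := by
      refine ⟨?_, ?_, S (i - 1) y, ?_⟩
      · change d (P i (u b)) = 0
        rw [hd.comp_proj hP hP' hP hP', h1, map_zero]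
      · change (d ∘ₗ η) (P i (u b)) = 0
        rw [hdη0.comp_proj hP hP' hP hP', LinearMap.comp_apply, h2, map_zero]
      · change φ (P i (u b)) - (b - ζ (δ b)) = _
        rw [hδ.comp_proj hS hS' hS hS', ← h3, hφ.comp_proj hP hP' hS hS', sub_add_cancel, add_zero,
          map_sub (S i), hS _ _ hb']
    -- The homogeneous part of `u b` satisfies the same conditions, so uniqueness shows that `u`
    -- preserves degree.
    have h0 : u b - P i (u b) = 0 := uniq _ (by simpa using R.sub_mem (hu b) hR)
    rw [sub_eq_zero.mp h0, add_zero]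
    exact hP0 _ _
  · obtain ⟨h1, h2, y, h3⟩ := hu b
    exact ⟨y, by simpa [hb] using h3⟩

variable {A : Type*} [AddCommGroup A] [Module k A] [SignGraded k A]
  {B : Type*} [AddCommGroup B] [Module k B] [SignGraded k B]
  {C : Type*} [AddCommGroup C] [Module k C] [SignGraded k C]
  {D : Type*} [AddCommGroup D] [Module k D] [SignGraded k D]

/-- A split surjective quasi-isomorphism of split complexes has a contractible kernel. -/
theorem exists_section_homotopy (hC : HasProj k C) (hD : HasProj k D)
    {d : C →ₗ[k] C} (hd : LDeg 1 d) (hdd : ∀ x, d (d x) = 0)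
    {η : C →ₗ[k] C} (hη : LDeg (-1) η) (hdη : ∀ x, d (η (d x)) = d x)
    {δ : D →ₗ[k] D} (hδ : LDeg 1 δ) {ζ : D →ₗ[k] D} (hζ : LDeg (-1) ζ)
    (hδζ : ∀ x, δ (ζ (δ x)) = δ x)
    {e : C →ₗ[k] D} (he : LDeg 0 e) (hed : ∀ x, e (d x) = δ (e x))
    (hinj : ∀ a, d a = 0 → (∃ b, δ b = e a) → ∃ a', d a' = a)
    (hsurj : ∀ b, δ b = 0 → ∃ a, d a = 0 ∧ ∃ b', e a - b = δ b')
    {s₀ : D →ₗ[k] C} (hs₀ : LDeg 0 s₀) (hes₀ : ∀ x, e (s₀ x) = x) :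
    ∃ s : D →ₗ[k] C, LDeg 0 s ∧ (∀ x, e (s x) = x) ∧
      ∃ h : C →ₗ[k] C, LDeg (-1) h ∧ (∀ x, e (h x) = 0) ∧
        ∀ x, d (h x) + h (d x) = x - s (e x) := by
  obtain ⟨u, hu, hdu, hub⟩ :=
    exists_homology_inverse hC hD hd hdd hη hdη hδ hζ hδζ he hed hinj hsurj
  -- `u` inverts `e` on cycles only up to a boundary; the added boundary, lifted along `s₀`, makes
  -- it exact.
  let σ : D →ₗ[k] C := u + d ∘ₗ s₀ ∘ₗ ζ ∘ₗ (LinearMap.id - e ∘ₗ u)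
  have σ_apply : ∀ b, σ b = u b + d (s₀ (ζ (b - e (u b)))) := fun b => rfl
  have hζ' : LDeg (-1) (ζ ∘ₗ (LinearMap.id - e ∘ₗ u)) :=
    hζ.comp (LDeg.id.sub (he.comp hu (add_zero 0))) (zero_add _)
  have hσ : LDeg 0 σ := hu.add (hd.comp (hs₀.comp hζ' (add_zero _)) (by norm_num))
  have dσ : ∀ b, d (σ b) = 0 := fun b => by rw [σ_apply, map_add, hdu, hdd, add_zero]
  have eσ : ∀ b, δ b = 0 → e (σ b) = b := fun b hb => by
    obtain ⟨b', hb'⟩ := hub b hb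
    have h2 : b - e (u b) = δ (-b') := by rw [map_neg, ← hb']; abel
    rw [σ_apply, map_add, hed, hes₀, h2, hδζ, ← h2]; abel
  -- On cycles in `ker e` the splitting `η` gives a primitive `y` whose image in `D` is a cycle;
  -- subtracting `σ (e y)`, itself a cycle, moves the primitive into `ker e`.
  let κ : C →ₗ[k] C := η - σ ∘ₗ e ∘ₗ η
  have κ_apply : ∀ x, κ x = η x - σ (e (η x)) := fun x => rfl
  have heη : LDeg (-1) (e ∘ₗ η) := he.comp hη (add_zero _)
  have hκ : LDeg (-1) κ := hη.sub (hσ.comp heη (add_zero _))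
  have dηz : ∀ z, d z = 0 → e z = 0 → d (η z) = z := fun z h1 h2 => by
    obtain ⟨y, rfl⟩ := hinj z h1 ⟨0, by rw [h2, map_zero]⟩
    exact hdη y
  have eκ : ∀ z, d z = 0 → e z = 0 → e (κ z) = 0 := fun z h1 h2 => by
    rw [κ_apply, map_sub, eσ _ (by rw [← hed, dηz z h1 h2, h2]), sub_self]
  have dκ : ∀ z, d z = 0 → e z = 0 → d (κ z) = z := fun z h1 h2 => by
    rw [κ_apply, map_sub, dσ, dηz z h1 h2, sub_zero]
  -- A choice of primitives for cycles becomes a contraction: `x - κ d x` is the cycle part of `x`,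
  -- and `h₀ d x = κ d x` supplies the rest.
  let h₀ : C →ₗ[k] C := κ ∘ₗ (LinearMap.id - κ ∘ₗ d)
  have h₀_apply : ∀ x, h₀ x = κ (x - κ (d x)) := fun x => rfl
  have hh₀ : LDeg (-1) h₀ := hκ.comp (LDeg.id.sub (hκ.comp hd (by norm_num))) (zero_add _)
  have edx : ∀ x, e x = 0 → e (d x) = 0 := fun x hx => by rw [hed, hx, map_zero]
  have y1 : ∀ x, e x = 0 → d (x - κ (d x)) = 0 := fun x hx => by
    rw [map_sub, dκ _ (hdd _) (edx x hx), sub_self]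
  have y2 : ∀ x, e x = 0 → e (x - κ (d x)) = 0 := fun x hx => by
    rw [map_sub, eκ _ (hdd _) (edx x hx), hx, sub_self]
  have eh₀ : ∀ x, e x = 0 → e (h₀ x) = 0 := fun x hx => by
    rw [h₀_apply, eκ _ (y1 x hx) (y2 x hx)]
  have dh₀ : ∀ x, e x = 0 → d (h₀ x) + h₀ (d x) = x := fun x hx => by
    rw [h₀_apply, h₀_apply, dκ _ (y1 x hx) (y2 x hx), hdd, map_zero, sub_zero, sub_add_cancel]
  let ρ : D →ₗ[k] C := d ∘ₗ s₀ - s₀ ∘ₗ δ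
  have ρ_apply : ∀ x, ρ x = d (s₀ x) - s₀ (δ x) := fun x => rfl
  have eρ : ∀ x, e (ρ x) = 0 := fun x => by rw [ρ_apply, map_sub, hed, hes₀, hes₀, sub_self]
  have hρ : LDeg 1 ρ := (hd.comp hs₀ (zero_add _)).sub (hs₀.comp hδ (add_zero _))
  -- `ρ` is the failure of `s₀` to be a chain map. It takes values in `ker e` and is a cocycle, so
  -- contracting it corrects `s₀`.
  let s : D →ₗ[k] C := s₀ - h₀ ∘ₗ ρ
  have s_apply : ∀ x, s x = s₀ x - h₀ (ρ x) := fun x => rfl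
  have hs : LDeg 0 s := hs₀.sub (hh₀.comp hρ (by norm_num))
  have es : ∀ x, e (s x) = x := fun x => by rw [s_apply, map_sub, hes₀, eh₀ _ (eρ x), sub_zero]
  have ds : ∀ x, d (s (e x)) = s (e (d x)) := fun x => by
    have h1 := dh₀ _ (eρ (e x))
    have h2 : ρ (e (d x)) = - d (ρ (e x)) := by
      rw [ρ_apply, ρ_apply, map_sub, hdd, hed, ← hed, ← hed, hdd, map_zero, map_zero]; abel
    rw [s_apply, s_apply, map_sub, h2, map_neg, eq_sub_of_add_eq h1, hed, ρ_apply (e x)]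
    abel
  refine ⟨s, hs, es, h₀ ∘ₗ (LinearMap.id - s ∘ₗ e),
    hh₀.comp (LDeg.id.sub (hs.comp he (add_zero _))) (zero_add _), fun x => ?_, fun x => ?_⟩
  · change e (h₀ (x - s (e x))) = 0
    apply eh₀
    rw [map_sub, es, sub_self]
  · change d (h₀ (x - s (e x))) + h₀ (d x - s (e (d x))) = _
    rw [← ds, ← map_sub d]
    apply dh₀
    rw [map_sub, es, sub_self]

/-- A split injective quasi-isomorphism of split complexes is a deformation retract. -/
theorem exists_retraction_homotopy (hA : HasProj k A) (hB : HasProj k B)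
    {d : A →ₗ[k] A} (hd : LDeg 1 d) (hdd : ∀ x, d (d x) = 0)
    {η : A →ₗ[k] A} (hη : LDeg (-1) η) (hdη : ∀ x, d (η (d x)) = d x)
    {δ : B →ₗ[k] B} (hδ : LDeg 1 δ) (hδδ : ∀ x, δ (δ x) = 0)
    {ζ : B →ₗ[k] B} (hζ : LDeg (-1) ζ) (hδζ : ∀ x, δ (ζ (δ x)) = δ x)
    {f : A →ₗ[k] B} (hf : LDeg 0 f) (hfd : ∀ x, f (d x) = δ (f x))
    (hinj : ∀ a, d a = 0 → (∃ b, δ b = f a) → ∃ a', d a' = a)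
    (hsurj : ∀ b, δ b = 0 → ∃ a, d a = 0 ∧ ∃ b', f a - b = δ b')
    {p₀ : B →ₗ[k] A} (hp₀ : LDeg 0 p₀) (hpf₀ : ∀ x, p₀ (f x) = x) :
    ∃ p : B →ₗ[k] A, LDeg 0 p ∧ (∀ a, p (f a) = a) ∧
      ∃ h : B →ₗ[k] B, LDeg (-1) h ∧ (∀ a, h (f a) = 0) ∧
        (∀ b, δ (f (p b)) = f (p (δ b))) ∧ ∀ b, δ (h b) + h (δ b) = b - f (p b) := by
  obtain ⟨v, hv, hdv, hvb⟩ :=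
    exists_homology_inverse hA hB hd hdd hη hdη hδ hζ hδζ hf hfd hinj hsurj
  -- The quotient of `B` by the image of `f` is represented by the image of `q₀`, with differential
  -- `q₀ δ`.
  let q₀ : B →ₗ[k] B := LinearMap.id - f ∘ₗ p₀
  have q₀_apply : ∀ b, q₀ b = b - f (p₀ b) := fun b => rfl
  have hq₀ : LDeg 0 q₀ := LDeg.id.sub (hf.comp hp₀ (add_zero _))
  have q₀f : ∀ a, q₀ (f a) = 0 := fun a => by rw [q₀_apply, hpf₀, sub_self]
  have q₀q₀ : ∀ b, q₀ (q₀ b) = q₀ b := fun b => by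
    rw [q₀_apply b, map_sub, q₀f, sub_zero, q₀_apply]
  have q₀δ : ∀ b, q₀ (δ (q₀ b)) = q₀ (δ b) := fun b => by
    rw [q₀_apply b, map_sub, ← hfd, map_sub, q₀f, sub_zero]
  -- If `δ b` lies in the image of `f`, its preimage is a boundary by injectivity on homology.
  -- Subtracting the image of a primitive turns `b` into a true cycle with the same class in the
  -- quotient.
  let z : B →ₗ[k] B := LinearMap.id - f ∘ₗ η ∘ₗ p₀ ∘ₗ δ
  have z_apply : ∀ b, z b = b - f (η (p₀ (δ b))) := fun b => rfl
  have hp₀δ : LDeg 1 (p₀ ∘ₗ δ) := hp₀.comp hδ (add_zero _)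
  have hηp₀δ : LDeg 0 (η ∘ₗ p₀ ∘ₗ δ) := hη.comp hp₀δ (by norm_num)
  have hz : LDeg 0 z := LDeg.id.sub (hf.comp hηp₀δ (add_zero _))
  -- The cycle `z b` differs from the image of a cycle of `A` by a boundary, whose primitive is
  -- given by `ζ`. So `κ` chooses primitives of cycles of the quotient.
  let κ : B →ₗ[k] B := q₀ ∘ₗ ζ ∘ₗ (LinearMap.id - f ∘ₗ v) ∘ₗ z
  have κ_apply : ∀ b, κ b = q₀ (ζ (z b - f (v (z b)))) := fun b => rfl
  have hκ : LDeg (-1) κ := by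
    have h1 : LDeg 0 ((LinearMap.id - f ∘ₗ v) ∘ₗ z) :=
      (LDeg.id.sub (hf.comp hv (add_zero _))).comp hz (add_zero _)
    have h2 : LDeg (-1) (ζ ∘ₗ (LinearMap.id - f ∘ₗ v) ∘ₗ z) := hζ.comp h1 (zero_add _)
    exact hq₀.comp h2 (add_zero _)
  have q₀κ : ∀ b, q₀ (κ b) = κ b := fun b => by rw [κ_apply, q₀q₀]
  have δκ : ∀ b, q₀ (δ b) = 0 → q₀ (δ (κ b)) = q₀ b := fun b hb => by
    have h1 : f (p₀ (δ b)) = δ b := by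
      rw [q₀_apply, sub_eq_zero] at hb
      exact hb.symm
    have h2 : d (p₀ (δ b)) = 0 := by
      rw [← hpf₀ (d (p₀ (δ b))), hfd, h1, hδδ, map_zero]
    have h3 : d (η (p₀ (δ b))) = p₀ (δ b) := by
      obtain ⟨a', ha'⟩ := hinj _ h2 ⟨b, h1.symm⟩
      rw [← ha', hdη]
    have h4 : δ (z b) = 0 := by rw [z_apply, map_sub, ← hfd, h3, h1, sub_self]
    obtain ⟨b', hb'⟩ := hvb _ h4
    have h5 : z b - f (v (z b)) = δ (-b') := by rw [map_neg, ← hb']; abel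
    rw [κ_apply, q₀δ, h5, hδζ, ← h5, map_sub, q₀f, z_apply, map_sub, q₀f, sub_zero, sub_zero]
  let h₀ : B →ₗ[k] B := κ ∘ₗ (q₀ - κ ∘ₗ q₀ ∘ₗ δ)
  have h₀_apply : ∀ b, h₀ b = κ (q₀ b - κ (q₀ (δ b))) := fun b => rfl
  have hh₀ : LDeg (-1) h₀ := by
    have h1 : LDeg 1 (q₀ ∘ₗ δ) := hq₀.comp hδ (add_zero _)
    exact hκ.comp (hq₀.sub (hκ.comp h1 (by norm_num))) (zero_add _)
  have h₀f : ∀ a, h₀ (f a) = 0 := fun a => by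
    rw [h₀_apply, q₀f, ← hfd, q₀f]; simp
  have δh₀ : ∀ b, q₀ (δ (h₀ b)) + h₀ (δ b) = q₀ b := fun b => by
    have h1 : q₀ (δ (q₀ (δ b))) = 0 := by rw [q₀δ, hδδ, map_zero]
    have h2 : q₀ (δ (q₀ b - κ (q₀ (δ b)))) = 0 := by
      rw [map_sub, map_sub, δκ _ h1, q₀δ, q₀q₀, sub_self]
    rw [h₀_apply, h₀_apply, δκ _ h2, hδδ, map_zero, map_zero, sub_zero, map_sub, q₀q₀, q₀κ,
      sub_add_cancel]
  let ρ : B →ₗ[k] A := p₀ ∘ₗ δ - d ∘ₗ p₀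
  have ρ_apply : ∀ b, ρ b = p₀ (δ b) - d (p₀ b) := fun b => rfl
  have hρ : LDeg 1 ρ := hp₀δ.sub (hd.comp hp₀ (zero_add _))
  have ρf : ∀ a, ρ (f a) = 0 := fun a => by rw [ρ_apply, ← hfd, hpf₀, hpf₀, sub_self]
  have ρq₀ : ∀ b, ρ (q₀ b) = ρ b := fun b => by rw [q₀_apply, map_sub, ρf, sub_zero]
  -- The defect `ρ` of `p₀` vanishes on the image of `f`, so it can be contracted on the quotient
  -- without losing `p f = 1`.
  let p : B →ₗ[k] A := p₀ - ρ ∘ₗ h₀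
  have p_apply : ∀ b, p b = p₀ b - ρ (h₀ b) := fun b => rfl
  have hp : LDeg 0 p := hp₀.sub (hρ.comp hh₀ (by norm_num))
  have pf : ∀ a, p (f a) = a := fun a => by rw [p_apply, h₀f, map_zero, sub_zero, hpf₀]
  have dp : ∀ b, d (p b) = p (δ b) := fun b => by
    have h1 : d (ρ (h₀ b)) = - ρ (δ (h₀ b)) := by
      rw [ρ_apply, ρ_apply, map_sub, hdd, hδδ, map_zero]; abel
    have h2 : ρ (δ (h₀ b)) + ρ (h₀ (δ b)) = ρ b := by
      rw [← ρq₀ (δ _), ← map_add, δh₀, ρq₀]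
    rw [p_apply, p_apply, map_sub, h1, eq_sub_of_add_eq h2, ρ_apply b]
    abel
  let q : B →ₗ[k] B := LinearMap.id - f ∘ₗ p
  have q_apply : ∀ b, q b = b - f (p b) := fun b => rfl
  have hq : LDeg 0 q := LDeg.id.sub (hf.comp hp (add_zero _))
  have qf : ∀ a, q (f a) = 0 := fun a => by rw [q_apply, pf, sub_self]
  have qq₀ : ∀ b, q (q₀ b) = q b := fun b => by rw [q₀_apply, map_sub, qf, sub_zero]
  refine ⟨p, hp, pf, q ∘ₗ h₀, hq.comp hh₀ (add_zero _), fun a => ?_, fun b => ?_, fun b => ?_⟩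
  · rw [LinearMap.comp_apply, h₀f, map_zero]
  · rw [← hfd, dp]
  · have δq : ∀ b, δ (q b) = q (δ b) := fun b => by rw [q_apply, map_sub, ← hfd, dp, q_apply]
    change δ (q (h₀ b)) + q (h₀ (δ b)) = _
    rw [δq, ← qq₀ (δ _), ← map_add, δh₀, qq₀, q_apply]

end Complexes

/-! ### Permutations, Koszul signs, decalage and shuffles -/

section Permutations

/-- The permutation of `Fin (n + 1)` that takes the value `0` at `i` and is given by `τ`
elsewhere. -/
def insPerm {n : ℕ} (i : Fin (n + 1)) (τ : Equiv.Perm (Fin n)) : Equiv.Perm (Fin (n + 1)) :=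
  Equiv.Perm.decomposeFin.symm (0, τ) * Fin.cycleRange i

@[simp] theorem insPerm_self {n : ℕ} (i : Fin (n + 1)) (τ : Equiv.Perm (Fin n)) :
    insPerm i τ i = 0 := by
  simp [insPerm]

@[simp] theorem insPerm_succAbove {n : ℕ} (i : Fin (n + 1)) (τ : Equiv.Perm (Fin n)) (j : Fin n) :
    insPerm i τ (i.succAbove j) = (τ j).succ := by
  simp [insPerm, Fin.cycleRange_succAbove]

theorem sign_insPerm {n : ℕ} (i : Fin (n + 1)) (τ : Equiv.Perm (Fin n)) :
    Equiv.Perm.sign (insPerm i τ) = Equiv.Perm.sign τ * ((i : ℕ) : ℤ).negOnePow := by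
  rw [insPerm, map_mul, Fin.sign_cycleRange, Equiv.Perm.decomposeFin.symm_sign, if_pos rfl, one_mul]
  congr 1

/-- A permutation is determined by the position of the value `0` and by the rest. This matches
insertion of the first letter of a word, and supports induction on `n`. -/
theorem insPerm_bijective (n : ℕ) :
    Function.Bijective (fun p : Fin (n + 1) × Equiv.Perm (Fin n) => insPerm p.1 p.2) := by
  rw [Fintype.bijective_iff_injective_and_card]
  constructor
  · rintro ⟨i, τ⟩ ⟨i', τ'⟩ h
    simp only at h
    have hi : i = i' := by
      apply (insPerm i τ).injective
      rw [insPerm_self, h, insPerm_self]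
    subst hi
    congr 1
    ext j
    have := insPerm_succAbove i τ j
    rw [h, insPerm_succAbove] at this
    rw [Fin.succ_injective _ this]
  · simp [Fintype.card_perm, Nat.factorial_succ]

theorem sum_perm_succ {n : ℕ} {M : Type*} [AddCommMonoid M] (F : Equiv.Perm (Fin (n + 1)) → M) :
    ∑ σ, F σ = ∑ i : Fin (n + 1), ∑ τ : Equiv.Perm (Fin n), F (insPerm i τ) := by
  rw [← Fintype.sum_prod_type' (fun i τ => F (insPerm i τ))]
  exact (Fintype.sum_bijective _ (insPerm_bijective n) _ _ fun _ => rfl).symm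

theorem perm_cases {n : ℕ} (σ : Equiv.Perm (Fin (n + 1))) : ∃ i τ, σ = insPerm i τ := by
  obtain ⟨⟨i, τ⟩, h⟩ := (insPerm_bijective n).2 σ
  exact ⟨i, τ, h.symm⟩

/-- The sum of the first `i` values of `d`. -/
def preSum {n : ℕ} (i : ℕ) (d : Fin n → ℤ) : ℤ := ∑ j : Fin n, if (j : ℕ) < i then d j else 0

theorem negOnePow_sum {ι : Type*} (s : Finset ι) (f : ι → ℤ) :
    (∑ i ∈ s, f i).negOnePow = ∏ i ∈ s, (f i).negOnePow := by
  classical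
  induction s using Finset.induction_on with
  | empty => simp
  | insert a s ha ih => rw [Finset.sum_insert ha, Finset.prod_insert ha, Int.negOnePow_add, ih]

theorem koszulSign_eq {n : ℕ} (σ : Equiv.Perm (Fin n)) (d : Fin n → ℤ) :
    koszulSign σ d = ∏ a, ∏ b, if a < b ∧ σ b < σ a then (d (σ a) * d (σ b)).negOnePow else 1 := by
  rw [koszulSign, Finset.prod_filter, Fintype.prod_prod_type]

/-- The inversions involving the value `0` are those with the entries placed before it. -/
theorem koszulSign_insPerm {n : ℕ} (i : Fin (n + 1)) (τ : Equiv.Perm (Fin n))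
    (d : Fin (n + 1) → ℤ) :
    koszulSign (insPerm i τ) d = koszulSign τ (fun j => d j.succ) *
      (d 0 * preSum i (fun j => d (τ j).succ)).negOnePow := by
  rw [koszulSign_eq, koszulSign_eq, Fin.prod_univ_succAbove _ i]
  simp only [Fin.prod_univ_succAbove _ i, insPerm_self, insPerm_succAbove, Fin.not_lt_zero,
    and_false, if_false, Finset.prod_const_one, one_mul, Fin.succ_pos, and_true,
    Fin.succAbove_lt_succAbove_iff, Fin.succ_lt_succ_iff, Finset.prod_mul_distrib]
  rw [mul_comm, preSum, Finset.mul_sum, negOnePow_sum]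
  congr 1
  refine Finset.prod_congr rfl fun j _ => ?_
  have h : i.succAbove j < i ↔ (j : ℕ) < i := Fin.succAbove_lt_iff_castSucc_lt i j
  by_cases hj : (j : ℕ) < i
  · rw [if_pos (h.mpr hj), if_pos hj, mul_comm]
  · rw [if_neg (mt h.mp hj), if_neg hj]; simp

theorem koszulSign_mul_self {n : ℕ} (σ : Equiv.Perm (Fin n)) (d : Fin n → ℤ) :
    koszulSign σ d * koszulSign σ d = 1 := Int.units_mul_self _

theorem preSum_sub_one {n : ℕ} (i : Fin (n + 1)) (d : Fin n → ℤ) :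
    preSum i (fun j => d j - 1) = preSum i d - i := by
  have h : ∀ m i : ℕ, i ≤ m → (∑ j : Fin m, if (j : ℕ) < i then (1 : ℤ) else 0) = i := by
    intro m
    induction m with
    | zero => intro i hi; simp; omega
    | succ m ih =>
      intro i hi
      rw [Fin.sum_univ_castSucc]
      simp only [Fin.val_castSucc, Fin.val_last]
      by_cases h : i = m + 1
      · subst h
        have := ih m le_rfl
        rw [if_pos (Nat.lt_succ_self m)]
        have e : ∀ j : Fin m, (if (j : ℕ) < m + 1 then (1 : ℤ) else 0) =
            if (j : ℕ) < m then 1 else 0 := fun j => by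
          rw [if_pos j.2, if_pos (by omega)]
        simp only [e, this]
        push_cast; ring
      · rw [if_neg (by omega), ih i (by omega), add_zero]
  rw [preSum, preSum, eq_sub_iff_add_eq, ← h n i (Nat.lt_succ_iff.mp i.2), ← Finset.sum_add_distrib]
  refine Finset.sum_congr rfl fun j _ => ?_
  split_ifs <;> ring

/-- The exponent of the decalage sign. -/
def decExp {n : ℕ} (c : Fin n → ℤ) : ℤ := ∑ j : Fin n, ((n : ℤ) - 1 - (j : ℕ)) * c j

theorem decExp_insPerm {n : ℕ} (i : Fin (n + 1)) (τ : Equiv.Perm (Fin n)) (c : Fin (n + 1) → ℤ) :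
    decExp (fun j => c (insPerm i τ j)) = ((n : ℤ) - (i : ℕ)) * c 0 +
      decExp (fun j => c (τ j).succ) + preSum i (fun j => c (τ j).succ) := by
  rw [decExp, Fin.sum_univ_succAbove _ i, decExp, preSum, add_assoc, ← Finset.sum_add_distrib]
  simp only [insPerm_self, insPerm_succAbove]
  congr 1
  · push_cast; ring
  refine Finset.sum_congr rfl fun j _ => ?_
  by_cases h : (j : ℕ) < i
  · rw [if_pos h, Fin.succAbove_of_castSucc_lt _ _ h]
    push_cast [Fin.val_castSucc]; ring
  · rw [if_neg h, Fin.succAbove_of_le_castSucc _ _ (not_lt.mp h)]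
    push_cast [Fin.val_succ]; ring

/-- Decalage turns graded antisymmetry into graded symmetry. -/
theorem sign_mul_koszulSign {n : ℕ} (σ : Equiv.Perm (Fin n)) (c : Fin n → ℤ) :
    Equiv.Perm.sign σ * koszulSign σ c * (decExp (fun j => c (σ j))).negOnePow =
      koszulSign σ (fun j => c j - 1) * (decExp c).negOnePow := by
  induction n with
  | zero => simp [Subsingleton.elim σ 1, koszulSign_eq, decExp]
  | succ n ih =>
    obtain ⟨i, τ, rfl⟩ := perm_cases σ
    have h := ih τ (fun j => c j.succ)
    have e : decExp c = n * c 0 + decExp (fun j => c j.succ) := by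
      have := decExp_insPerm 0 1 c
      have h1 : insPerm (0 : Fin (n + 1)) 1 = 1 := by
        ext j
        refine Fin.cases ?_ (fun j => ?_) j
        · simp
        · have := insPerm_succAbove (0 : Fin (n + 1)) 1 j
          rw [Fin.succAbove_zero] at this
          rw [this]; rfl
      rw [h1] at this
      simpa [preSum] using this
    rw [sign_insPerm, koszulSign_insPerm, koszulSign_insPerm, decExp_insPerm, preSum_sub_one, e]
    simp only [Int.negOnePow_add] at h ⊢
    -- The contribution of the value `0`. With `P` the sum of the degrees placed before it, the two
    -- exponents differ by `2 P`.
    have key : ((i : ℕ) : ℤ).negOnePow * (c 0 * preSum i (fun j => c (τ j).succ)).negOnePow *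
        ((((n : ℤ) - (i : ℕ)) * c 0).negOnePow * (preSum i (fun j => c (τ j).succ)).negOnePow) =
        ((c 0 - 1) * (preSum i (fun j => c (τ j).succ) - (i : ℕ))).negOnePow *
          ((n : ℤ) * c 0).negOnePow := by
      simp only [← Int.negOnePow_add]
      rw [Int.negOnePow_eq_iff]
      exact ⟨preSum i (fun j => c (τ j).succ), by ring⟩
    rw [← mul_assoc, mul_comm _ ((n : ℤ) * c 0).negOnePow] at key
    generalize ((n : ℤ) * c 0).negOnePow = t₀ at *
    generalize (decExp fun j => c j.succ).negOnePow = t₁ at *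
    generalize (decExp fun j => c (τ j).succ).negOnePow = t₂ at *
    generalize ((i : ℕ) : ℤ).negOnePow = t₃ at *
    generalize (c 0 * preSum i (fun j => c (τ j).succ)).negOnePow = t₄ at *
    generalize (((n : ℤ) - (i : ℕ)) * c 0).negOnePow = t₅ at *
    generalize (preSum i (fun j => c (τ j).succ)).negOnePow = t₆ at *
    generalize ((c 0 - 1) * (preSum i (fun j => c (τ j).succ) - (i : ℕ))).negOnePow = t₇ at *
    generalize Equiv.Perm.sign τ = t₈ at *
    generalize koszulSign τ (fun j => c j.succ) = t₉ at *
    generalize koszulSign τ (fun j => c j.succ - 1) = t₁₀ at *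
    calc _ = t₈ * t₉ * t₂ * (t₃ * t₄ * t₅ * t₆) := by ac_rfl
      _ = t₁₀ * t₁ * (t₀ * t₇) := by rw [h, key]
      _ = _ := by ac_rfl

theorem isShuffle_insPerm_zero {n : ℕ} (p : ℕ) (τ : Equiv.Perm (Fin n)) :
    IsShuffle (p + 1) (insPerm 0 τ) ↔ IsShuffle p τ := by
  have h0 : ∀ j : Fin n, insPerm 0 τ j.succ = (τ j).succ := fun j => by
    have := insPerm_succAbove (0 : Fin (n + 1)) τ j
    rwa [Fin.succAbove_zero] at this
  constructor
  · intro h i j hij hp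
    have := h i.succ j.succ (Fin.succ_lt_succ_iff.mpr hij) (by simpa using hp)
    rwa [h0, h0, Fin.succ_lt_succ_iff] at this
  · intro h i j
    refine Fin.cases ?_ (fun i => ?_) i
    · refine Fin.cases ?_ (fun j => ?_) j
      · intro h; exact absurd h (lt_irrefl _)
      · intro _ _; rw [insPerm_self, h0]; exact Fin.succ_pos _
    · refine Fin.cases ?_ (fun j => ?_) j
      · intro h; exact absurd h (Fin.not_lt_zero _)
      · intro hij hp
        rw [h0, h0, Fin.succ_lt_succ_iff]
        exact h i j (Fin.succ_lt_succ_iff.mp hij) (by simpa using hp)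

theorem isShuffle_insPerm_self {n : ℕ} (p : Fin (n + 1)) (τ : Equiv.Perm (Fin n)) :
    IsShuffle p (insPerm p τ) ↔ IsShuffle p τ := by
  have hlt : ∀ j : Fin n, (p.succAbove j : ℕ) < p ↔ (j : ℕ) < p := fun j =>
    Fin.succAbove_lt_iff_castSucc_lt p j
  constructor
  · intro h i j hij hp
    have := h (p.succAbove i) (p.succAbove j) (Fin.succAbove_lt_succAbove_iff.mpr hij)
      (by
        rw [hlt, ← not_lt, hlt, not_lt]; exact hp)
    rwa [insPerm_succAbove, insPerm_succAbove, Fin.succ_lt_succ_iff] at this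
  · intro h i j hij hp
    rcases eq_or_ne i p with rfl | hi
    · rw [insPerm_self]
      obtain ⟨j, rfl⟩ := Fin.exists_succAbove_eq hij.ne'
      rw [insPerm_succAbove]; exact Fin.succ_pos _
    · obtain ⟨i, rfl⟩ := Fin.exists_succAbove_eq hi
      rcases eq_or_ne j p with rfl | hj
      · exact absurd hp (by rw [not_or]; exact ⟨lt_irrefl _, not_le.mpr hij⟩)
      · obtain ⟨j, rfl⟩ := Fin.exists_succAbove_eq hj
        rw [insPerm_succAbove, insPerm_succAbove, Fin.succ_lt_succ_iff]
        exact h i j (Fin.succAbove_lt_succAbove_iff.mp hij)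
          (by rwa [hlt, ← not_lt, hlt, not_lt] at hp)

/-- In a shuffle the smallest value heads one of the two blocks. For `p = 0` position `0` heads the
second block, since the first is empty. -/
theorem not_isShuffle_insPerm {n : ℕ} {p : ℕ} {i : Fin (n + 1)} (τ : Equiv.Perm (Fin n))
    (h0 : (i : ℕ) ≠ 0 ∨ p = 0) (hp : (i : ℕ) ≠ p) : ¬ IsShuffle p (insPerm i τ) := by
  intro h
  have hi : i ≠ 0 := fun e => by
    rcases h0 with h0 | h0
    · exact h0 (by simp [e])
    · exact hp (by simp [e, h0])
  have hi0 : (0 : ℕ) < i := Nat.pos_of_ne_zero fun e => hi (Fin.ext e)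
  have key : ∀ j : Fin (n + 1), j < i → ((i : ℕ) < p ∨ p ≤ (j : ℕ)) → False := fun j hj hp => by
    have := h j i hj hp
    rw [insPerm_self] at this
    exact absurd this (Fin.not_lt_zero _)
  rcases lt_or_gt_of_ne hp with h1 | h1
  · exact key 0 (Fin.pos_iff_ne_zero.mpr hi) (Or.inl h1)
  · exact key ⟨p, by omega⟩ h1 (Or.inr le_rfl)

end Permutations

/-! ### Symmetrizations and unshuffles as sums over permutations -/

section SymmetricSums

variable {k : Type u} [CommRing k] {V : Type v} [AddCommGroup V] [Module k V] [SignGraded k V]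

local notation "𝓲" => TensorAlgebra.ι k

theorem ofFn_insPerm {α : Type*} {n : ℕ} (i : Fin (n + 1)) (τ : Equiv.Perm (Fin n))
    (a : Fin (n + 1) → α) : List.ofFn (fun j => a (insPerm i τ j)) =
      (List.ofFn (fun j => a (τ j).succ)).take i ++
        a 0 :: (List.ofFn (fun j => a (τ j).succ)).drop i := by
  have hi := i.2
  apply List.ext_getElem
  · simp; omega
  intro m h1 h2
  simp only [List.length_ofFn] at h1
  rw [List.getElem_ofFn, List.getElem_append]
  split_ifs with h
  · simp only [List.length_take, List.length_ofFn] at h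
    have e : (⟨m, h1⟩ : Fin (n + 1)) = i.succAbove ⟨m, by omega⟩ := by
      rw [Fin.succAbove_of_castSucc_lt _ _ (by rw [Fin.lt_def]; simp; omega)]; rfl
    rw [e, insPerm_succAbove]
    simp
  · simp only [List.length_take, List.length_ofFn] at h ⊢
    have hmin : min (i : ℕ) n = i := by omega
    rcases Nat.eq_or_lt_of_le (show (i : ℕ) ≤ m by omega) with h' | h'
    · have e : (⟨m, h1⟩ : Fin (n + 1)) = i := Fin.ext h'.symm
      rw [e, insPerm_self]
      simp [hmin, ← h']
    · have e : (⟨m, h1⟩ : Fin (n + 1)) = i.succAbove ⟨m - 1, by omega⟩ := by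
        rw [Fin.succAbove_of_le_castSucc _ _ (by rw [Fin.le_def]; simp; omega)]
        ext; simp; omega
      rw [e, insPerm_succAbove, List.getElem_cons]
      rw [dif_neg (by omega)]
      simp only [List.getElem_drop, List.getElem_ofFn, hmin]
      congr 4
      omega

theorem tdeg_take_ofFn {n : ℕ} (i : ℕ) (a : Fin n → Letter k V) :
    tdeg ((List.ofFn a).take i) = preSum i (fun j => (a j).deg) := by
  induction n generalizing i with
  | zero => simp [preSum]
  | succ n ih =>
    rw [preSum, Fin.sum_univ_succ, List.ofFn_succ]
    cases i with
    | zero => simp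
    | succ i =>
      rw [List.take_succ_cons, tdeg_cons, ih]
      simp [preSum]

theorem units_smul_negOnePow {M : Type*} [AddCommGroup M] [Module k M] (c : ℤˣ) (i : ℤ) (m : M) :
    (c * i.negOnePow) • m = c • sg k i • m := by
  rw [mul_smul, negOnePow_smul (k := k)]

theorem units_smul_comm {M N : Type*} [AddCommGroup M] [Module k M] [AddCommGroup N] [Module k N]
    (φ : M →ₗ[k] N) (c : ℤˣ) (m : M) : φ (c • m) = c • φ m := by
  rw [units_smul_eq (k := k), units_smul_eq (k := k), map_smul]

theorem units_smul_smul {M : Type*} [AddCommGroup M] [Module k M]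
    (c : ℤˣ) (r : k) (m : M) : c • r • m = r • c • m := by
  rw [units_smul_eq (k := k), units_smul_eq (k := k), smul_comm]

variable [Algebra ℚ k]

theorem ins_wd (a : Letter k V) (l : List (Letter k V)) :
    ins a.val (wd l) = ∑ i : Fin (l.length + 1), sg k (a.deg * tdeg (l.take i)) •
      wd (l.take i ++ a :: l.drop i) := by
  induction l with
  | nil => simp
  | cons b l ih =>
    conv_rhs => rw [Fin.sum_univ_succ]
    rw [wd_cons, ins_letter, ih]
    congr 1
    · simp
    · rw [Finset.mul_sum, Finset.smul_sum]
      refine Finset.sum_congr rfl fun i _ => ?_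
      simp only [Fin.val_succ, List.take_succ_cons, List.drop_succ_cons, List.cons_append, wd_cons,
        tdeg_cons, mul_add, sg_add, mul_smul]
      rw [mul_smul_comm]

theorem sym_wd_append_cons (l₁ : List (Letter k V)) (a : Letter k V) (l₂ : List (Letter k V)) :
    sym (wd (l₁ ++ a :: l₂)) = sg k (a.deg * tdeg l₁) • sym (wd (a :: (l₁ ++ l₂))) := by
  induction l₁ with
  | nil => simp
  | cons b l ih =>
    simp only [List.cons_append, wd_cons, sym_ι_mul] at ih ⊢
    rw [ih, map_smul, ins_comm, smul_smul, ← sg_add, tdeg_cons]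
    congr 2
    ring

theorem sym_wd_ofFn {n : ℕ} (a : Fin n → Letter k V) :
    sym (wd (List.ofFn a)) = ∑ σ : Equiv.Perm (Fin n),
      koszulSign σ (fun j => (a j).deg) • wd (List.ofFn (fun j => a (σ j))) := by
  induction n with
  | zero => simp [koszulSign_eq]
  | succ n ih =>
    rw [List.ofFn_succ, wd_cons, sym_ι_mul, ih, map_sum, sum_perm_succ, Finset.sum_comm]
    refine Finset.sum_congr rfl fun τ _ => ?_
    rw [units_smul_comm, ins_wd, Finset.smul_sum]
    refine Fintype.sum_equiv (finCongr (by simp)) _ _ fun i => ?_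
    rw [ofFn_insPerm, koszulSign_insPerm, units_smul_negOnePow (k := k)]
    simp only [finCongr_apply, Fin.val_cast]
    rw [tdeg_take_ofFn]

theorem sym_wd_perm {n : ℕ} (a : Fin n → Letter k V) (σ : Equiv.Perm (Fin n)) :
    sym (wd (List.ofFn (fun j => a (σ j)))) =
      koszulSign σ (fun j => (a j).deg) • sym (wd (List.ofFn a)) := by
  induction n with
  | zero => simp [koszulSign_eq]
  | succ n ih =>
    obtain ⟨i, τ, rfl⟩ := perm_cases σ
    rw [ofFn_insPerm, sym_wd_append_cons, List.take_append_drop, wd_cons, sym_ι_mul,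
      ih (fun j => a j.succ) τ, units_smul_comm, koszulSign_insPerm, units_smul_negOnePow (k := k),
      List.ofFn_succ, wd_cons, sym_ι_mul, tdeg_take_ofFn, units_smul_smul]

-- The recursion of `unsh` decides which list receives the first letter; correspondingly, in a
-- shuffle the index `0` heads the first or the second block.
omit [Algebra ℚ k] in
theorem unsh_ofFn {M : Type*} [AddCommGroup M] [Module k M] {n : ℕ} (a : Fin n → Letter k V)
    (X : List (Letter k V) → List (Letter k V) → M) :
    unsh (List.ofFn a) X = ∑ p : Fin (n + 1), ∑ σ : Equiv.Perm (Fin n),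
      if IsShuffle p σ then koszulSign σ (fun j => (a j).deg) •
        X ((List.ofFn fun j => a (σ j)).take p) ((List.ofFn fun j => a (σ j)).drop p) else 0 := by
  induction n generalizing X with
  | zero => simp [unsh, koszulSign_eq, IsShuffle]
  | succ n ih =>
    rw [List.ofFn_succ, unsh, ih, ih]
    set Y : Fin (n + 2) → Fin (n + 1) → Equiv.Perm (Fin n) → M := fun p i τ =>
      if IsShuffle p (insPerm i τ) then koszulSign (insPerm i τ) (fun j => (a j).deg) •
        X ((List.ofFn fun j => a (insPerm i τ j)).take p)
          ((List.ofFn fun j => a (insPerm i τ j)).drop p) else 0 with hY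
    have h1 : ∀ (p : Fin (n + 1)) τ, Y p.succ 0 τ = if IsShuffle p τ then
        koszulSign τ (fun j => (a j.succ).deg) • X (a 0 :: (List.ofFn fun j => a (τ j).succ).take p)
          ((List.ofFn fun j => a (τ j).succ).drop p) else 0 := by
      intro p τ
      simp only [hY, Fin.val_succ, isShuffle_insPerm_zero, ofFn_insPerm, koszulSign_insPerm]
      simp [preSum]
    have h2 : ∀ (p : Fin (n + 1)) τ, Y p.castSucc p τ = if IsShuffle p τ then
        koszulSign τ (fun j => (a j.succ).deg) •
          sg k ((a 0).deg * tdeg ((List.ofFn fun j => a (τ j).succ).take p)) •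
          X ((List.ofFn fun j => a (τ j).succ).take p)
          (a 0 :: (List.ofFn fun j => a (τ j).succ).drop p) else 0 := by
      intro p τ
      have hp : min (p : ℕ) n = p := by have := p.2; omega
      simp only [hY, Fin.val_castSucc, isShuffle_insPerm_self, ofFn_insPerm, koszulSign_insPerm,
        units_smul_negOnePow (k := k), tdeg_take_ofFn]
      rw [List.take_append_of_le_length (by simp [hp]), List.take_take, min_self,
        List.drop_append_of_le_length (by simp [hp]), List.drop_eq_nil_of_le (by simp [hp]),
        List.nil_append]
    have h3 : ∀ (p : Fin (n + 2)) (i : Fin (n + 1)) τ, ((i : ℕ) ≠ 0 ∨ (p : ℕ) = 0) → (i : ℕ) ≠ p → Y p i τ = 0 :=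
      fun p i τ h h' => if_neg (not_isShuffle_insPerm τ h h')
    have h4 : ∀ τ, ∑ p : Fin (n + 2), ∑ i, Y p i τ = (∑ p : Fin (n + 1), Y p.succ 0 τ) +
        ∑ p : Fin (n + 1), Y p.castSucc p τ := by
      intro τ
      -- Only the positions `0` and `p` contribute; for `p = 0` they coincide and must be counted
      -- once.
      have e1 : ∀ p : Fin (n + 2), ∑ i, Y p i τ = (if (p : ℕ) = 0 then 0 else Y p 0 τ) +
          ∑ i : Fin (n + 1), if (i : ℕ) = p then Y p i τ else 0 := by
        intro p
        rw [Fin.sum_univ_succ, Fin.sum_univ_succ (fun i : Fin (n + 1) => ite ((i : ℕ) = p) _ _),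
          ← add_assoc]
        congr 1
        · by_cases hp : (p : ℕ) = 0
          · simp [hp]
          · simp [hp, Ne.symm hp]
        · refine Finset.sum_congr rfl fun i _ => ?_
          split_ifs with h
          · rfl
          · exact h3 _ _ _ (Or.inl (by simp)) h
      simp only [e1, Finset.sum_add_distrib]
      congr 1
      · rw [Fin.sum_univ_succ]; simp
      · rw [Finset.sum_comm]
        refine Finset.sum_congr rfl fun i _ => ?_
        rw [Finset.sum_eq_single i.castSucc]
        · simp
        · intro p _ hp
          rw [if_neg]
          intro h
          exact hp (Fin.ext (by simpa using h.symm))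
        · simp
    have h5 : ∀ p : Fin (n + 2), (∑ σ : Equiv.Perm (Fin (n + 1)),
        if IsShuffle p σ then koszulSign σ (fun j => (a j).deg) •
        X ((List.ofFn fun j => a (σ j)).take p) ((List.ofFn fun j => a (σ j)).drop p) else 0) =
        ∑ τ : Equiv.Perm (Fin n), ∑ i, Y p i τ := fun p => by
      rw [sum_perm_succ, Finset.sum_comm]
    simp only [h5]
    conv_rhs => rw [Finset.sum_comm]
    simp only [h4, Finset.sum_add_distrib, h1, h2]
    congr 1 <;> exact Finset.sum_comm

end SymmetricSums

/-! ### Coalgebra maps as sums over compositions -/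

section Compositions

/-- Sums over compositions, organised by the first block. -/
theorem sum_composition_succ {M : Type*} [AddCommMonoid M] (n : ℕ) (φ : List ℕ → M) :
    ∑ c : Composition (n + 1), φ c.blocks =
      ∑ i : Fin (n + 1), ∑ c : Composition (n - i), φ (((i : ℕ) + 1) :: c.blocks) := by
  rw [← Fintype.sum_sigma' (fun (i : Fin (n + 1)) (c : Composition (n - i)) =>
    φ (((i : ℕ) + 1) :: c.blocks))]
  symm
  refine Fintype.sum_bijective (fun p : (Σ i : Fin (n + 1), Composition (n - i)) =>
    (⟨((p.1 : ℕ) + 1) :: p.2.blocks, fun h => ?_, ?_⟩ : Composition (n + 1))) ⟨?_, ?_⟩ _ _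
    fun _ => rfl
  · rcases List.mem_cons.mp h with h | h
    · omega
    · exact p.2.blocks_pos h
  · have := p.1.2
    rw [List.sum_cons, p.2.blocks_sum]; omega
  · rintro ⟨i, c⟩ ⟨i', c'⟩ h
    have h1 := congrArg Composition.blocks h
    simp only [List.cons.injEq, Nat.add_right_cancel_iff] at h1
    obtain rfl : i = i' := Fin.ext h1.1
    rw [Composition.ext h1.2]
  · rintro ⟨l, hpos, hsum⟩
    rcases l with _ | ⟨m, l⟩
    · simp at hsum
    · have hm : 0 < m := hpos (by simp)
      rw [List.sum_cons] at hsum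
      refine ⟨⟨⟨m - 1, by omega⟩, ⟨l, fun h => hpos (by simp [h]), by simp; omega⟩⟩, ?_⟩
      apply Composition.ext
      simp; omega

variable {k : Type u} [CommRing k] {V : Type v} [AddCommGroup V] [Module k V]
  {W : Type w} [AddCommGroup W] [Module k W]

local notation "𝓲" => TensorAlgebra.ι k

/-- The product of a list of vectors. -/
noncomputable def vprod (k : Type u) [CommRing k] {V : Type v} [AddCommGroup V] [Module k V]
    (l : List V) : TensorAlgebra k V := (l.map (TensorAlgebra.ι k)).prod

@[simp] theorem vprod_nil : vprod k ([] : List V) = 1 := rfl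

@[simp] theorem vprod_cons (v : V) (l : List V) : vprod k (v :: l) = 𝓲 v * vprod k l := rfl

theorem vprod_ofFn {n : ℕ} (x : Fin n → V) :
    vprod k (List.ofFn x) = TensorAlgebra.tprod k V n x := by
  rw [vprod, TensorAlgebra.tprod_apply, List.map_ofFn]; rfl

theorem conv_vprod {A : Type*} [Ring A] [Algebra k A] (a b : TensorAlgebra k V →ₗ[k] A)
    (l : List V) : conv a b (vprod k l) =
      ∑ i : Fin (l.length + 1), a (vprod k (l.take i)) * b (vprod k (l.drop i)) := by
  induction l generalizing a with
  | nil => simp [conv_one]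
  | cons v l ih =>
    rw [vprod_cons, conv_ι_mul, ih]
    conv_rhs => rw [Fin.sum_univ_succ]
    congr 1

/-- Unfolding the recursion block by block: the first block has length `i + 1`, and the rest is cut
by a composition of the remaining length. -/
theorem hat_vprod (F : TensorAlgebra k V →ₗ[k] W) (hF : F 1 = 0) (m : ℕ) :
    ∀ l : List V, l.length = m → hat F (vprod k l) = ∑ c : Composition m,
      ((l.splitWrtCompositionAux c.blocks).map fun b => 𝓲 (F (vprod k b))).prod := by
  induction m using Nat.strong_induction_on with
  | _ m ih =>
    intro l hl
    match l, m, hl with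
    | [], _, rfl =>
      have : ∀ c : Composition 0, c.blocks = [] := fun c => by
        have := c.blocks_sum
        rcases hb : c.blocks with _ | ⟨b, t⟩
        · rfl
        · have h1 : 0 < b := c.blocks_pos (by simp [hb])
          rw [hb, List.sum_cons] at this
          omega
      simp [hat_one F hF, this, List.splitWrtCompositionAux, composition_card]
    | v :: l, _, rfl =>
      rw [List.length_cons, sum_composition_succ l.length
        (fun bs => ((List.splitWrtCompositionAux (v :: l) bs).map fun b => 𝓲 (F (vprod k b))).prod),
        vprod_cons, hat_ι_mul F hF, conv_vprod]
      refine Finset.sum_congr rfl fun i _ => ?_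
      rw [ih (l.length - i) (by rw [List.length_cons]; omega) _ (by simp), Finset.mul_sum]
      refine Finset.sum_congr rfl fun c _ => ?_
      rw [List.splitWrtCompositionAux_cons, List.map_cons, List.prod_cons]
      simp

theorem splitWrtComposition_ofFn {α : Type*} {n : ℕ} (x : Fin n → α) (c : Composition n) :
    (List.ofFn x).splitWrtComposition c =
      List.ofFn fun i => List.ofFn fun j => x (c.embedding i j) := by
  apply List.ext_getElem
  · simp
  intro i h1 h2
  rw [List.getElem_splitWrtComposition, List.getElem_ofFn]
  have hi : i < c.length := by simpa using h2
  have hs := c.sizeUpTo_succ hi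
  have hle := c.sizeUpTo_le (i + 1)
  have hb : c.blocksFun ⟨i, hi⟩ = c.blocks[i] := rfl
  apply List.ext_getElem
  · simp only [List.length_drop, List.length_take, List.length_ofFn]
    rw [hb]; omega
  intro j h3 h4
  simp only [List.getElem_drop, List.getElem_take, List.getElem_ofFn]
  congr 1

theorem hat_tprod (F : TensorAlgebra k V →ₗ[k] W) (hF : F 1 = 0) {n : ℕ} (x : Fin n → V) :
    hat F (TensorAlgebra.tprod k V n x) = ∑ c : Composition n,
      TensorAlgebra.tprod k W c.length fun i =>
        F (TensorAlgebra.tprod k V (c.blocksFun i) fun j => x (c.embedding i j)) := by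
  rw [← vprod_ofFn, hat_vprod F hF n _ (by simp)]
  refine Finset.sum_congr rfl fun c _ => ?_
  change (((List.ofFn x).splitWrtComposition c).map fun b => 𝓲 (F (vprod k b))).prod = _
  rw [splitWrtComposition_ofFn, List.map_ofFn, TensorAlgebra.tprod_apply]
  simp only [Function.comp_def, vprod_ofFn]

end Compositions

/-! ### From families of multilinear maps to operators on tensors -/

section Families

variable {k : Type u} [CommRing k] [Algebra ℚ k] {V : Type v} [AddCommGroup V] [Module k V]
  {W : Type w} [AddCommGroup W] [Module k W] {U : Type x} [AddCommGroup U] [Module k U]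

local notation "𝓲" => TensorAlgebra.ι k

/-- The functional on tensors whose values on symmetric tensors are given by a symmetric family. -/
noncomputable def ofSymm (F : MultiFamily k V W) : TensorAlgebra k V →ₗ[k] W :=
  -- `sym` is a sum over all permutations without normalization, and the factor `1 / n!` compensates
  -- for it.
  ofFamily fun n => algebraMap ℚ k (n.factorial : ℚ)⁻¹ • F n

theorem ofSymm_tprod (F : MultiFamily k V W) (n : ℕ) (x : Fin n → V) :
    ofSymm F (TensorAlgebra.tprod k V n x) = algebraMap ℚ k (n.factorial : ℚ)⁻¹ • F n x := by
  rw [ofSymm, ofFamily_tprod]; rfl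

theorem ofSymm_one (F : MultiFamily k V W) : ofSymm F 1 = F 0 ![] := by
  have : (1 : TensorAlgebra k V) = TensorAlgebra.tprod k V 0 ![] := by
    rw [TensorAlgebra.tprod_apply]; simp
  rw [this, ofSymm_tprod]; simp

theorem ofSymm_ι (F : MultiFamily k V W) (v : V) : ofSymm F (𝓲 v) = F 1 fun _ => v := by
  have : 𝓲 v = TensorAlgebra.tprod k V 1 fun _ => v := by
    rw [TensorAlgebra.tprod_apply]; simp
  rw [this, ofSymm_tprod]; simp

/-- The block normalizations and that of `G` multiply to exactly `1 / (l! i₁! ⋯ i_l!)`. The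
remaining sum over permutations is supplied by `sym` in `compMap_eq`. -/
theorem compMap_tprod (G : MultiFamily k W U) (F : MultiFamily k V W) (hF : F 0 = 0) {n : ℕ}
    (x : Fin n → V) : ofSymm G (hat (ofSymm F) (TensorAlgebra.tprod k V n x)) =
      ∑ c : Composition n,
        algebraMap ℚ k ((c.length.factorial * ∏ i, (c.blocksFun i).factorial : ℕ) : ℚ)⁻¹ •
          G c.length (fun i => F (c.blocksFun i) (fun j => x (c.embedding i j))) := by
  rw [hat_tprod _ (by rw [ofSymm_one, hF]; rfl), map_sum]
  refine Finset.sum_congr rfl fun c _ => ?_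
  simp only [ofSymm_tprod]
  rw [MultilinearMap.map_smul_univ, smul_smul, ← map_prod, ← map_mul]
  congr 2
  push_cast
  rw [mul_inv, Finset.prod_inv_distrib]

variable [SignGraded k V] [SignGraded k W]

/-- Graded symmetry of a family of multilinear maps. -/
def IsSymmFamily (F : MultiFamily k V W) : Prop :=
  ∀ (n : ℕ) (a : Fin n → Letter k V) (σ : Equiv.Perm (Fin n)),
    F n (fun j => (a (σ j)).val) = koszulSign σ (fun j => (a j).deg) • F n (fun j => (a j).val)

theorem wd_ofFn {n : ℕ} (a : Fin n → Letter k V) :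
    wd (List.ofFn a) = TensorAlgebra.tprod k V n fun j => (a j).val := by
  rw [← vprod_ofFn]
  induction n with
  | zero => simp
  | succ n ih => rw [List.ofFn_succ, List.ofFn_succ, wd_cons, vprod_cons, ih]

theorem compMap_eq (G : MultiFamily k W U) (F : MultiFamily k V W) (hF : F 0 = 0) {n : ℕ}
    (a : Fin n → Letter k V) :
    compMap G F n (fun j => (a j).deg) (fun j => (a j).val) =
      ofSymm G (hat (ofSymm F) (sym (wd (List.ofFn a)))) := by
  rw [sym_wd_ofFn, map_sum, map_sum, compMap]
  simp only [Finset.smul_sum]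
  rw [Finset.sum_comm]
  refine Finset.sum_congr rfl fun σ _ => ?_
  rw [units_smul_comm, units_smul_comm, wd_ofFn, compMap_tprod G F hF, Finset.smul_sum]
  refine Finset.sum_congr rfl fun c _ => ?_
  rw [units_smul_smul]

/-- By symmetry the `n!` terms of the symmetrization agree and cancel the normalization. -/
theorem IsSymmFamily.ofSymm_sym {F : MultiFamily k V W} (hF : IsSymmFamily F)
    (l : List (Letter k V)) : ofSymm F (sym (wd l)) = ofFamily F (wd l) := by
  rw [← List.ofFn_get l]
  generalize l.get = a
  rw [sym_wd_ofFn, map_sum, wd_ofFn, ofFamily_tprod]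
  have h : ∀ σ : Equiv.Perm (Fin l.length), ofSymm F (koszulSign σ (fun j => (a j).deg) •
      wd (List.ofFn fun j => a (σ j))) = algebraMap ℚ k (l.length.factorial : ℚ)⁻¹ •
        F l.length (fun j => (a j).val) := fun σ => by
    rw [units_smul_comm, wd_ofFn, ofSymm_tprod, hF, units_smul_smul, smul_smul,
      koszulSign_mul_self, one_smul]
  simp only [h]
  rw [Finset.sum_const, Finset.card_univ, Fintype.card_perm, Fintype.card_fin, ← Nat.cast_smul_eq_nsmul k,
    smul_smul, ← map_natCast (algebraMap ℚ k), ← map_mul,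
    mul_inv_cancel₀ (by exact_mod_cast l.length.factorial_ne_zero), map_one, one_smul]

theorem IsSymmFamily.ofSymm_sym_ofFn {F : MultiFamily k V W} (hF : IsSymmFamily F) {n : ℕ}
    (a : Fin n → Letter k V) : ofSymm F (sym (wd (List.ofFn a))) = F n fun j => (a j).val := by
  rw [hF.ofSymm_sym, wd_ofFn, ofFamily_tprod]

theorem take_ofFn_eq {α : Type*} {n p : ℕ} (hp : p ≤ n) (x : Fin n → α) :
    (List.ofFn x).take p = List.ofFn fun i : Fin p => x ⟨i, by omega⟩ := by
  apply List.ext_getElem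
  · simp [hp]
  · intro i h1 h2
    simp

theorem drop_ofFn_eq {α : Type*} {n p : ℕ} (hp : p ≤ n) (x : Fin n → α) :
    (List.ofFn x).drop p = List.ofFn fun i : Fin (n - p) => x ⟨p + i, by omega⟩ := by
  apply List.ext_getElem
  · simp
  · intro i h1 h2
    simp

theorem ofFamily_ι_mul_tprod (G : MultiFamily k V W) {m : ℕ} (x : V) (y : Fin m → V) :
    ofFamily G (𝓲 x * TensorAlgebra.tprod k V m y) = G (m + 1) (Fin.cons x y) := by
  rw [← vprod_ofFn, ← vprod_cons, ← ofFamily_tprod, ← vprod_ofFn, List.ofFn_succ]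
  simp

/-- By `cod_sym` the coderivation inserts `Q` of an unshuffled part into the symmetrized rest. Such
an insertion is the symmetrization of a longer word, so symmetry of both families leaves one term
per shuffle. -/
theorem compCoder_eq {G : MultiFamily k V W} (hG : IsSymmFamily G) {Q : MultiFamily k V V}
    (hQ : IsSymmFamily Q) (hQd : FDeg 1 (ofSymm Q)) {n : ℕ} (a : Fin n → Letter k V) :
    compCoder G Q n (fun j => (a j).deg) (fun j => (a j).val) =
      ofSymm G (cod (psgn 1) (ofSymm Q) (sym (wd (List.ofFn a)))) := by
  have h1 : ∀ l₁ l₂ : List (Letter k V), ofSymm G (ins (ofSymm Q (sym (wd l₁))) (sym (wd l₂))) =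
      ofFamily G (𝓲 (ofFamily Q (wd l₁)) * wd l₂) := fun l₁ l₂ => by
    rw [← hQ.ofSymm_sym]
    have h := hG.ofSymm_sym (⟨_, _, hQd _ _ (sym_mem_gr l₁)⟩ :: l₂)
    rwa [wd_cons, sym_ι_mul] at h
  rw [cod_sym hQd, map_unsh]
  simp only [h1]
  rw [unsh_ofFn, compCoder]
  refine Finset.sum_congr rfl fun p _ => ?_
  rw [Finset.sum_filter]
  refine Finset.sum_congr rfl fun σ _ => ?_
  have hp : (p : ℕ) ≤ n := Nat.lt_succ_iff.mp p.2
  rw [take_ofFn_eq hp, drop_ofFn_eq hp, wd_ofFn, wd_ofFn, ofFamily_tprod, ofFamily_ι_mul_tprod]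

end Families

/-! ### The dictionary between `L_∞`-structures and operators on tensors -/

section Shift

variable {k : Type u} [CommRing k]

/-- The shift `L[1]` of a graded module. -/
noncomputable instance shiftGraded (L : GradedModule.{u, v} k) : SignGraded k L.carrier where
  hdeg i := L.deg (i + 1)
  -- Degrees in the shift are lower by one, which reverses the sign.
  par := - L.parity
  par_apply := by
    intro i x hx
    rw [LinearMap.neg_apply, L.parity_apply hx, negOnePow_smul (k := k), sg_add, sg_one]
    simp
  iSup_hdeg := by
    have h := (DirectSum.Decomposition.isInternal L.deg).submodule_iSup_eq_top
    rw [eq_top_iff, ← h]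
    refine iSup_le fun i => ?_
    have := le_iSup (fun i => L.deg (i + 1)) (i - 1)
    simpa using this

theorem mem_hdeg {L : GradedModule.{u, v} k} {i : ℤ} {x : L.carrier} :
    x ∈ SignGraded.hdeg (k := k) (V := L.carrier) i ↔ x ∈ L.deg (i + 1) := Iff.rfl

theorem hasProj_shift (L : GradedModule.{u, v} k) : HasProj k L.carrier := by
  refine ⟨fun i => (L.deg (i + 1)).subtype ∘ₗ DirectSum.component k ℤ (fun i => L.deg i) (i + 1) ∘ₗ
    (DirectSum.decomposeLinearEquiv L.deg).toLinearMap, fun i x => ?_, fun i x hx => ?_,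
    fun i j hij x hx => ?_⟩
  · exact Subtype.mem _
  · have := DirectSum.decompose_of_mem_same L.deg (mem_hdeg.mp hx)
    exact this
  · have := DirectSum.decompose_of_mem_ne L.deg (mem_hdeg.mp hx)
      (show j + 1 ≠ i + 1 by omega)
    exact this

/-- A homogeneous element of `L`, as a letter of the shift. -/
def letterOfMem (L : GradedModule.{u, v} k) (i : ℤ) (x : L.carrier) (hx : x ∈ L.deg i) :
    Letter k L.carrier :=
  ⟨i - 1, x, mem_hdeg.mpr (by rw [sub_add_cancel]; exact hx)⟩

theorem parity_pow_apply (L : GradedModule.{u, v} k) (m : ℕ) {i : ℤ} {x : L.carrier}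
    (hx : x ∈ L.deg i) : (L.parity ^ m) x = sg k (m * i) • x := by
  induction m with
  | zero => simp
  | succ m ih =>
    rw [pow_succ', Module.End.mul_apply, ih, map_smul, L.parity_apply hx,
      negOnePow_smul (k := k), smul_smul, ← sg_add]
    congr 2
    push_cast; ring

theorem parity_mul_parity (L : GradedModule.{u, v} k) : L.parity * L.parity = 1 := by
  ext x
  refine letter_induction (k := k) (C := fun x => (L.parity * L.parity) x = x) (by simp)
    (fun a => ?_) (fun x y hx hy => by rw [map_add, hx, hy]) x
  have := parity_pow_apply L 2 (mem_hdeg.mp a.mem)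
  rw [pow_two] at this
  rw [this, sg_even ⟨a.deg + 1, by push_cast; ring⟩, one_smul]

/-- The decalage signs square to one, so the same operation recovers the antisymmetric family from
the symmetric one. -/
theorem decalage_decalage (L : GradedModule.{u, v} k) {V : Type w} [AddCommGroup V] [Module k V]
    (φ : MultiFamily k L.carrier V) : L.decalage (L.decalage φ) = φ := by
  funext n
  ext x
  simp only [GradedModule.decalage, MultilinearMap.compLinearMap_apply]
  congr 1
  funext j
  rw [← Module.End.mul_apply, ← (Commute.refl L.parity).mul_pow, parity_mul_parity, one_pow]
  rfl

theorem sg_sum {ι : Type*} (s : Finset ι) (f : ι → ℤ) :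
    sg k (∑ i ∈ s, f i) = ∏ i ∈ s, sg k (f i) := by
  classical
  induction s using Finset.induction_on with
  | empty => simp
  | insert a s ha ih => rw [Finset.sum_insert ha, Finset.prod_insert ha, sg_add, ih]

theorem decalage_apply (L : GradedModule.{u, v} k) {V : Type w} [AddCommGroup V] [Module k V]
    (φ : MultiFamily k L.carrier V) {n : ℕ} (c : Fin n → ℤ) (x : Fin n → L.carrier)
    (hx : ∀ j, x j ∈ L.deg (c j)) : L.decalage φ n x = (decExp c).negOnePow • φ n x := by
  have h : ∀ j : Fin n, (L.parity ^ (n - 1 - (j : ℕ))) (x j) =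
      sg k (((n : ℤ) - 1 - (j : ℕ)) * c j) • x j := fun j => by
    have hj := j.2
    rw [parity_pow_apply L _ (hx j)]
    congr 3
    omega
  rw [negOnePow_smul (k := k), GradedModule.decalage, MultilinearMap.compLinearMap_apply]
  simp only [h]
  rw [MultilinearMap.map_smul_univ, decExp, sg_sum]

theorem tdeg_ofFn {V : Type v} [AddCommGroup V] [Module k V] [SignGraded k V] {n : ℕ}
    (a : Fin n → Letter k V) : tdeg (List.ofFn a) = ∑ j, (a j).deg := by
  induction n with
  | zero => simp
  | succ n ih => rw [List.ofFn_succ, tdeg_cons, ih, Fin.sum_univ_succ]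

variable {L : GradedModule.{u, v} k} {L' : GradedModule.{u, w} k}

theorem isSymmFamily_decalage {φ : MultiFamily k L.carrier L'.carrier} (h : L.IsAntisymm L' φ) :
    IsSymmFamily (L.decalage φ) := by
  intro n a σ
  have ha : ∀ j, (a j).val ∈ L.deg ((a j).deg + 1) := fun j => mem_hdeg.mp (a j).mem
  rw [decalage_apply L φ (fun j => (a (σ j)).deg + 1) _ fun j => ha (σ j), decalage_apply L φ _ _ ha,
    h n _ _ ha, ← mul_smul, ← mul_smul]
  congr 1
  have := sign_mul_koszulSign σ fun j => (a j).deg + 1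
  simp only [add_sub_cancel_right] at this
  rw [← this, mul_comm]

theorem isAntisymm_decalage {φ : MultiFamily k L.carrier L'.carrier} (h : IsSymmFamily φ) :
    L.IsAntisymm L' (L.decalage φ) := by
  intro n d a ha σ
  have h1 := h n (fun j => letterOfMem L _ _ (ha j)) σ
  simp only [letterOfMem] at h1
  rw [decalage_apply L φ (fun j => d (σ j)) _ fun j => ha (σ j), decalage_apply L φ _ _ ha,
    h1, ← mul_smul, ← mul_smul]
  congr 1
  have h2 := sign_mul_koszulSign σ d
  have h3 := Int.units_mul_self (decExp fun j => d (σ j)).negOnePow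
  have h4 := Int.units_mul_self (decExp d).negOnePow
  generalize (decExp fun j => d (σ j)).negOnePow = t at *
  generalize (decExp d).negOnePow = r at *
  calc t * koszulSign σ (fun j => d j - 1) = t * (koszulSign σ (fun j => d j - 1) * r) * r := by
        rw [mul_assoc, mul_assoc, h4, mul_one]
    _ = Equiv.Perm.sign σ * koszulSign σ d * r * (t * t) := by rw [← h2]; ac_rfl
    _ = _ := by rw [h3, mul_one]

theorem decalage_mem {φ : MultiFamily k L.carrier L'.carrier} {s : ℕ → ℤ}
    (h : L.IsHomogeneous L' φ s) {n : ℕ} {t : ℤ} (hs : s n = t + 1 - n)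
    (a : Fin n → Letter k L.carrier) : L.decalage φ n (fun j => (a j).val) ∈
      SignGraded.hdeg (k := k) (V := L'.carrier) (tdeg (List.ofFn a) + t) := by
  have ha : ∀ j, (a j).val ∈ L.deg ((a j).deg + 1) := fun j => mem_hdeg.mp (a j).mem
  rw [decalage_apply L φ _ _ ha, mem_hdeg, negOnePow_smul (k := k), tdeg_ofFn]
  apply Submodule.smul_mem
  have := h n _ _ ha
  rw [Finset.sum_add_distrib] at this
  simp only [Finset.sum_const, Finset.card_univ, Fintype.card_fin, nsmul_eq_mul, mul_one] at this
  rw [hs] at this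
  convert this using 2
  ring

theorem isHomogeneous_decalage {φ : MultiFamily k L.carrier L'.carrier} {s : ℕ → ℤ} {t : ℤ}
    (hs : ∀ n, s n = t + 1 - (n : ℤ))
    (h : ∀ (n : ℕ) (a : Fin n → Letter k L.carrier), φ n (fun j => (a j).val) ∈
      SignGraded.hdeg (k := k) (V := L'.carrier) (tdeg (List.ofFn a) + t)) :
    L.IsHomogeneous L' (L.decalage φ) s := by
  intro n d a ha
  have h1 := h n fun j => letterOfMem L _ _ (ha j)
  rw [decalage_apply L φ _ _ ha, negOnePow_smul (k := k)]
  apply Submodule.smul_mem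
  rw [mem_hdeg, tdeg_ofFn] at h1
  simp only [letterOfMem, Finset.sum_sub_distrib, Finset.sum_const, Finset.card_univ,
    Fintype.card_fin, nsmul_eq_mul, mul_one] at h1
  rw [hs]
  convert h1 using 2
  ring

theorem decalage_zero {φ : MultiFamily k L.carrier L'.carrier} (h : φ 0 = 0) :
    L.decalage φ 0 = 0 := by
  rw [GradedModule.decalage, h]; rfl

theorem decalage_one {φ : MultiFamily k L.carrier L'.carrier} (x : Fin 1 → L.carrier) :
    L.decalage φ 1 x = φ 1 x := by
  rw [GradedModule.decalage, MultilinearMap.compLinearMap_apply]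
  congr 1
  funext j
  rw [Nat.sub_self, Nat.zero_sub, pow_zero]; rfl

variable [Algebra ℚ k]

theorem fdeg_ofSymm {V : Type v} [AddCommGroup V] [Module k V] [SignGraded k V]
    {W : Type w} [AddCommGroup W] [Module k W] [SignGraded k W] {Φ : MultiFamily k V W} {t : ℤ}
    (h : ∀ (n : ℕ) (a : Fin n → Letter k V), Φ n (fun j => (a j).val) ∈
      SignGraded.hdeg (k := k) (V := W) (tdeg (List.ofFn a) + t)) : FDeg t (ofSymm Φ) := by
  apply fdeg_of_wd
  intro l
  rw [← List.ofFn_get l, wd_ofFn, ofSymm_tprod]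
  exact Submodule.smul_mem _ _ (h _ _)

theorem FDeg.tmap_psgn_one {V : Type v} [AddCommGroup V] [Module k V] [SignGraded k V]
    {W : Type w} [AddCommGroup W] [Module k W] [SignGraded k W] {F : TensorAlgebra k V →ₗ[k] W}
    (hF : FDeg 1 F) (x : TensorAlgebra k V) :
    F (tmap (psgn 1) x) = - psgn (k := k) 1 (F x) := by
  refine LinearMap.congr_fun (f := F ∘ₗ (tmap (psgn 1)).toLinearMap)
    (g := - (psgn (k := k) 1 ∘ₗ F)) (ext_wd fun l => ?_) x
  have h1 := wd_mem_gr (k := k) l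
  rw [LinearMap.comp_apply, AlgHom.toLinearMap_apply, Tens.tmap_psgn 1 h1, map_smul,
    LinearMap.neg_apply, LinearMap.comp_apply, psgn_apply 1 (hF _ _ h1), one_mul, one_mul, sg_add,
    sg_one]
  simp

theorem psgn_psgn {V : Type v} [AddCommGroup V] [Module k V] [SignGraded k V] (i : ℤ) (x : V) :
    psgn (k := k) i (psgn (k := k) i x) = x := by
  refine letter_induction (k := k) (C := fun x => psgn (k := k) i (psgn (k := k) i x) = x) (by simp)
    (fun a => ?_) (fun x y hx hy => by simp only [map_add, hx, hy]) x
  rw [psgn_apply i a.mem, map_smul, psgn_apply i a.mem, smul_smul, sg_mul_self, one_smul]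

/-- The cross terms in the square of an odd coderivation cancel, so the square is an untwisted
coderivation and vanishes on symmetric tensors as soon as its projection does. -/
theorem isDiff_cod {V : Type v} [AddCommGroup V] [Module k V] [SignGraded k V]
    {Q : TensorAlgebra k V →ₗ[k] V} (hQ : FDeg 1 Q) (h : EqSym (Q ∘ₗ cod (psgn 1) Q) 0) :
    IsDiff (cod (psgn 1) Q) where
  cod := isCod_cod _ _
  deg := deg_cod (ldeg_psgn 1) hQ
  sq := by
    set D := Tens.cod (psgn 1) Q with hD
    have hc : IsCod (psgn 1) D := isCod_cod _ _
    have prD : ∀ x, pr (D x) = Q x := pr_cod _ _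
    have e := hc.eq_conv
    have e1 : (TensorAlgebra.ι k ∘ₗ pr ∘ₗ D) ∘ₗ (tmap (psgn 1)).toLinearMap =
        -((TensorAlgebra.ι k ∘ₗ psgn 1 ∘ₗ pr) ∘ₗ D) := by
      ext1 x
      simp only [LinearMap.comp_apply, AlgHom.toLinearMap_apply, LinearMap.neg_apply, prD,
        hQ.tmap_psgn_one, map_neg]
    have e2 : (TensorAlgebra.ι k ∘ₗ psgn 1 ∘ₗ pr) ∘ₗ (tmap (psgn 1)).toLinearMap =
        TensorAlgebra.ι k ∘ₗ (pr : TensorAlgebra k V →ₗ[k] V) := by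
      ext1 x
      simp only [LinearMap.comp_apply, AlgHom.toLinearMap_apply, pr_tmap, psgn_psgn]
    have e3 : D ∘ₗ D = conv (TensorAlgebra.ι k ∘ₗ (pr ∘ₗ (D ∘ₗ D))) LinearMap.id +
        conv (TensorAlgebra.ι k ∘ₗ pr) (D ∘ₗ D) := by
      have e' : D ∘ₗ D = _ := congrArg (fun φ => φ ∘ₗ D) e
      refine e'.trans ?_
      rw [LinearMap.add_comp, hc.conv_comp, hc.conv_comp, e1, e2, LinearMap.id_comp,
        conv_neg_left]
      simp only [LinearMap.comp_assoc]
      abel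
    refine eqSym_zero_of_comp e3 rfl (by simp) pr pr_ι (EqSym.of_wd fun l => ?_)
    have := h.wd l
    rw [LinearMap.comp_apply] at this
    rw [LinearMap.comp_apply, LinearMap.comp_apply, prD, this]

/-- The codifferential of an `L_∞`-algebra. -/
noncomputable def algOp (L : LInftyAlgebra.{u, v} k) :
    TensorAlgebra k L.carrier →ₗ[k] TensorAlgebra k L.carrier :=
  cod (psgn 1) (ofSymm L.Q)

/-- The coalgebra map of an `L_∞`-morphism. -/
noncomputable def homOp {L : LInftyAlgebra.{u, v} k} {L' : LInftyAlgebra.{u, w} k}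
    (f : LInftyHom L L') : TensorAlgebra k L.carrier →ₗ[k] TensorAlgebra k L'.carrier :=
  hat (ofSymm f.F)

theorem isSymmFamily_Q (L : LInftyAlgebra.{u, v} k) : IsSymmFamily L.Q :=
  isSymmFamily_decalage L.μ_antisymm

theorem fdeg_Q (L : LInftyAlgebra.{u, v} k) : FDeg 1 (ofSymm L.Q) :=
  fdeg_ofSymm fun n a => decalage_mem (t := 1) L.μ_homogeneous (by ring) a

theorem pr_algOp (L : LInftyAlgebra.{u, v} k) (x : TensorAlgebra k L.carrier) :
    pr (algOp L x) = ofSymm L.Q x := pr_cod _ _ x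

theorem isDiff_algOp (L : LInftyAlgebra.{u, v} k) : IsDiff (algOp L) := by
  refine isDiff_cod (fdeg_Q L) (EqSym.of_wd fun l => ?_)
  have h := L.codifferential l.length (fun j => (l.get j).deg) (fun j => (l.get j).val)
    fun j => mem_hdeg.mp (l.get j).mem
  have h2 := compCoder_eq (isSymmFamily_Q L) (isSymmFamily_Q L) (fdeg_Q L) l.get
  rw [List.ofFn_get] at h2
  rw [LinearMap.comp_apply, ← h2]
  exact h

theorem algOp_one {L : LInftyAlgebra.{u, v} k} (h : L.IsFlat) : algOp L 1 = 0 := by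
  rw [algOp, cod_one, ofSymm_one, LInftyAlgebra.Q, decalage_zero h]
  simp

theorem linPart_algOp (L : LInftyAlgebra.{u, v} k) (x : L.carrier) :
    linPart (algOp L) x = L.d x := by
  rw [linPart_apply, pr_algOp, ofSymm_ι, LInftyAlgebra.Q, decalage_one]
  rfl

variable {M : LInftyAlgebra.{u, v} k} {M' : LInftyAlgebra.{u, w} k}

theorem isSymmFamily_F (f : LInftyHom M M') : IsSymmFamily f.F :=
  isSymmFamily_decalage f.f_antisymm

theorem fdeg_F (f : LInftyHom M M') : FDeg 0 (ofSymm f.F) :=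
  fdeg_ofSymm fun n a => decalage_mem (t := 0) f.f_homogeneous (by ring) a

theorem F_zero (f : LInftyHom M M') : f.F 0 = 0 := decalage_zero f.f_zero

theorem ofSymm_F_one (f : LInftyHom M M') : ofSymm f.F 1 = 0 := by
  rw [ofSymm_one, F_zero]; rfl

theorem pr_homOp (f : LInftyHom M M') (x : TensorAlgebra k M.carrier) :
    pr (homOp f x) = ofSymm f.F x := pr_hat _ (ofSymm_F_one f) x

theorem isMor_homOp (f : LInftyHom M M') : IsMor (algOp M) (algOp M') (homOp f) := by
  refine isMor_hat (isDiff_algOp M) (isDiff_algOp M') (ofSymm_F_one f) (fdeg_F f)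
    (EqSym.of_wd fun l => ?_)
  have h := f.commutes l.length (fun j => (l.get j).deg) (fun j => (l.get j).val)
    fun j => mem_hdeg.mp (l.get j).mem
  have h1 := compMap_eq M'.Q f.F (F_zero f) l.get
  have h2 := compCoder_eq (isSymmFamily_F f) (isSymmFamily_Q M) (fdeg_Q M) l.get
  rw [List.ofFn_get] at h1 h2
  rw [defect_apply, pr_algOp, LinearMap.zero_apply, sub_eq_zero, ← h1, algOp, ← h2]
  exact h

theorem linPart_homOp (f : LInftyHom M M') (x : M.carrier) :
    linPart (homOp f) x = f.linear x := by
  rw [linPart_apply, pr_homOp, ofSymm_ι, LInftyHom.F, decalage_one]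
  rfl

/-- The family of multilinear maps given by a coalgebra map. -/
noncomputable def symFamily {V : Type v} [AddCommGroup V] [Module k V] [SignGraded k V]
    {W : Type w} [AddCommGroup W] [Module k W] (g : TensorAlgebra k V →ₗ[k] W) :
    MultiFamily k V W :=
  fun n => (g ∘ₗ sym).compMultilinearMap (TensorAlgebra.tprod k V n)

section SymFamily

variable {V : Type v} [AddCommGroup V] [Module k V] [SignGraded k V]
    {W : Type w} [AddCommGroup W] [Module k W] [SignGraded k W] (g : TensorAlgebra k V →ₗ[k] W)

theorem symFamily_apply {n : ℕ} (a : Fin n → Letter k V) :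
    symFamily g n (fun j => (a j).val) = g (sym (wd (List.ofFn a))) := by
  rw [wd_ofFn]; rfl

theorem isSymmFamily_symFamily : IsSymmFamily (symFamily g) := by
  intro n a σ
  rw [symFamily_apply g fun j => a (σ j), sym_wd_perm, symFamily_apply, units_smul_comm]

theorem ofSymm_symFamily : EqSym (ofSymm (symFamily g)) g := by
  apply EqSym.of_wd
  intro l
  rw [← List.ofFn_get l, (isSymmFamily_symFamily g).ofSymm_sym_ofFn, symFamily_apply]

theorem symFamily_zero (h : g 1 = 0) : symFamily g 0 = 0 := by
  ext x
  simp [symFamily, TensorAlgebra.tprod_apply, h]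

theorem hat_symFamily {g : TensorAlgebra k V →ₗ[k] TensorAlgebra k W} (hg : IsCo g)
    (hd : Deg 0 g) : EqSym (hat (ofSymm (symFamily (pr ∘ₗ g)))) g := by
  have h1 : ofSymm (symFamily (pr ∘ₗ g)) 1 = 0 := by
    rw [ofSymm_one, symFamily_zero _ (by simp [hg.one])]; rfl
  have hpd : FDeg 0 (pr ∘ₗ g) := fdeg_pr.comp hd (add_zero 0)
  have h2 : FDeg 0 (ofSymm (symFamily (pr ∘ₗ g))) := fdeg_ofSymm fun n a => by
    rw [symFamily_apply]
    exact hpd _ _ (sym_mem_gr _)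
  refine (isCo_hat _ h1).eqSym (deg_hat h1 h2) hg hd (EqSym.of_wd fun l => ?_)
  rw [LinearMap.comp_apply, pr_hat _ h1]
  exact (ofSymm_symFamily _).wd l

end SymFamily

/-- The `L_∞`-morphism given by a morphism of symmetric coalgebras. -/
theorem exists_hom {g : TensorAlgebra k M.carrier →ₗ[k] TensorAlgebra k M'.carrier}
    (hg : IsMor (algOp M) (algOp M') g) :
    ∃ f : LInftyHom M M', EqSym (homOp f) g := by
  -- Only the values of `g` on symmetric tensors are kept. The coalgebra map rebuilt from them
  -- agrees with `g` there, which is all that the morphism equations see.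
  set G : MultiFamily k M.carrier M'.carrier := symFamily (pr ∘ₗ g) with hG
  have hG0 : G 0 = 0 := symFamily_zero _ (by simp [hg.co.one])
  have hdec : M.toGradedModule.decalage (M.toGradedModule.decalage G) = G := decalage_decalage _ _
  have hhat : EqSym (hat (ofSymm G)) g := hat_symFamily hg.co hg.deg
  have hpd : FDeg 0 (pr ∘ₗ g) := fdeg_pr.comp hg.deg (add_zero 0)
  have hsymm : IsSymmFamily G := isSymmFamily_symFamily _
  refine ⟨⟨M.toGradedModule.decalage G, decalage_zero hG0, isHomogeneous_decalage (t := 0)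
    (fun n => by ring) fun n a => ?_, isAntisymm_decalage hsymm, fun n d w hw => ?_⟩, ?_⟩
  · rw [hG, symFamily_apply]
    exact hpd _ _ (sym_mem_gr _)
  · rw [hdec]
    let a : Fin n → Letter k M.carrier := fun j => ⟨d j, w j, hw j⟩
    have h1 := compMap_eq M'.Q G hG0 a
    have h2 := compCoder_eq hsymm (isSymmFamily_Q M) (fdeg_Q M) a
    have h3 := (ofSymm_symFamily (pr ∘ₗ g)).apply
      ((isDiff_algOp M).presSym _ (wd_mem_range_sym (List.ofFn a)))
    rw [hhat.wd, ← pr_algOp, hg.comm_apply (wd_mem_range_sym _)] at h1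
    exact h1.trans (h3.symm.trans h2.symm)
  · change EqSym (hat (ofSymm (M.toGradedModule.decalage (M.toGradedModule.decalage G)))) g
    rwa [hdec]

theorem compAt_eq {M'' : LInftyAlgebra.{u, x} k} (g : LInftyHom M' M'') (f : LInftyHom M M')
    {n : ℕ} (a : Fin n → Letter k M.carrier) :
    g.compAt f n (fun j => (a j).deg) (fun j => (a j).val) =
      pr (homOp g (homOp f (sym (wd (List.ofFn a))))) := by
  rw [pr_homOp]
  exact compMap_eq g.F f.F (F_zero f) a

theorem compEq_of_eqSym {M'' : LInftyAlgebra.{u, x} k} {g : LInftyHom M' M''} {f : LInftyHom M M'}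
    {h : LInftyHom M M''} (hgf : EqSym (homOp g ∘ₗ homOp f) (homOp h)) : g.CompEq f h := by
  intro n d w hw
  let a : Fin n → Letter k M.carrier := fun j => ⟨d j, w j, hw j⟩
  have h1 := compAt_eq g f a
  have h2 := hgf.wd (List.ofFn a)
  rw [LinearMap.comp_apply] at h2
  rw [h2, pr_homOp, (isSymmFamily_F h).ofSymm_sym_ofFn] at h1
  exact h1

theorem eqSym_of_squareCommutes {L₁ : LInftyAlgebra.{u, v} k} {L₂ : LInftyAlgebra.{u, w} k}
    {L₃ : LInftyAlgebra.{u, x} k} {L₄ : LInftyAlgebra.{u, y} k} {c : LInftyHom L₁ L₃}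
    {f : LInftyHom L₁ L₂} {e : LInftyHom L₃ L₄} {d : LInftyHom L₂ L₄}
    (h : LInftyHom.SquareCommutes e c d f) :
    EqSym (homOp e ∘ₗ homOp c) (homOp d ∘ₗ homOp f) := by
  have m1 := (isMor_homOp e).comp (isMor_homOp c)
  have m2 := (isMor_homOp d).comp (isMor_homOp f)
  refine m1.co.eqSym m1.deg m2.co m2.deg (EqSym.of_wd fun l => ?_)
  have h1 := h l.length (fun j => (l.get j).deg) (fun j => (l.get j).val)
    fun j => mem_hdeg.mp (l.get j).mem
  rw [compAt_eq, compAt_eq, List.ofFn_get] at h1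
  exact h1

theorem IsMor.linPart_comm {V : Type v} [AddCommGroup V] [Module k V] [SignGraded k V]
    {W : Type w} [AddCommGroup W] [Module k W] [SignGraded k W]
    {Q : TensorAlgebra k V →ₗ[k] TensorAlgebra k V} {Q' : TensorAlgebra k W →ₗ[k] TensorAlgebra k W}
    {Φ : TensorAlgebra k V →ₗ[k] TensorAlgebra k W} (h : IsMor Q Q' Φ) (hQ : IsDiff Q)
    (hQ1 : Q 1 = 0) (v : V) : linPart Φ (linPart Q v) = linPart Q' (linPart Φ v) := by
  have h1 := h.comm_apply (ι_mem_range_sym v)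
  rw [linPart_apply Q', linPart_apply Φ v, ← h.co.apply_ι, h1, hQ.apply_ι hQ1, linPart_apply Φ]

theorem ldeg_of_deg {L : GradedModule.{u, v} k} {L' : GradedModule.{u, w} k} {s : ℤ}
    {φ : L.carrier →ₗ[k] L'.carrier} (h : ∀ i, ∀ a ∈ L.deg i, φ a ∈ L'.deg (i + s)) :
    LDeg s φ := fun i x hx => by
  have := h _ _ (mem_hdeg.mp hx)
  rw [mem_hdeg]
  rwa [add_right_comm] at this

end Shift

end Tens

end LInf

/-! ### The theorem -/

open LInf LInf.Tens in
theorem exists_linftyHom_of_exists_lift {k : Type u} [CommRing k] [Algebra ℚ k]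
    {A : LInftyAlgebra.{u, v} k} {B : LInftyAlgebra.{u, w} k}
    {C : LInftyAlgebra.{u, x} k} {D : LInftyAlgebra.{u, y} k}
    {c : LInftyHom A C} {f : LInftyHom A B} {e : LInftyHom C D} {d : LInftyHom B D}
    (h : ∃ g : TensorAlgebra k B.carrier →ₗ[k] TensorAlgebra k C.carrier,
      IsMor (algOp B) (algOp C) g ∧ EqSym (g ∘ₗ homOp f) (homOp c) ∧
        EqSym (homOp e ∘ₗ g) (homOp d)) :
    ∃ g : LInftyHom B C, LInftyHom.CompEq g f c ∧ LInftyHom.CompEq e g d := by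
  obtain ⟨g, hg, hgf, heg⟩ := h
  obtain ⟨G, hG⟩ := exists_hom hg
  refine ⟨G, compEq_of_eqSym (EqSym.of_wd fun l => ?_), compEq_of_eqSym (EqSym.of_wd fun l => ?_)⟩
  · rw [← hgf.wd]
    exact (hG.comp_right (isMor_homOp f).presSym).wd l
  · rw [← heg.wd, LinearMap.comp_apply, hG.wd, LinearMap.comp_apply]

theorem mainTheorem6 {k : Type u} [CommRing k] [Algebra ℚ k]
    (A : LInf.LInftyAlgebra.{u, v} k) (B : LInf.LInftyAlgebra.{u, w} k)
    (C : LInf.LInftyAlgebra.{u, x} k) (D : LInf.LInftyAlgebra.{u, y} k)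
    (c : LInf.LInftyHom A C) (f : LInf.LInftyHom A B)
    (e : LInf.LInftyHom C D) (d : LInf.LInftyHom B D)
    (hsquare : LInf.LInftyHom.SquareCommutes e c d f)
    (hf : f.IsSplitInjective) (he : e.IsSplitSurjective)
    (hqi : (f.IsQuasiIso ∧ A.IsSplit ∧ B.IsSplit) ∨ (e.IsQuasiIso ∧ C.IsSplit ∧ D.IsSplit)) :
    ∃ g : LInf.LInftyHom B C,
      LInf.LInftyHom.CompEq g f c ∧ LInf.LInftyHom.CompEq e g d := by
  open LInf LInf.Tens in
  apply exists_linftyHom_of_exists_lift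
  obtain ⟨p₀, hp₀, hpf₀⟩ := hf
  obtain ⟨s₀, hs₀, hes₀⟩ := he
  have hp₀' : LDeg 0 p₀ := ldeg_of_deg fun i a ha => by rw [add_zero]; exact hp₀ i a ha
  have hs₀' : LDeg 0 s₀ := ldeg_of_deg fun i a ha => by rw [add_zero]; exact hs₀ i a ha
  simp only [← linPart_homOp] at hpf₀ hes₀
  have hA := isDiff_algOp A
  have hB := isDiff_algOp B
  have hC := isDiff_algOp C
  have hD := isDiff_algOp D
  have mc := isMor_homOp c
  have md := isMor_homOp d
  have mf := isMor_homOp f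
  have me := isMor_homOp e
  have hsq := eqSym_of_squareCommutes hsquare
  rcases hqi with ⟨⟨hA0, hB0, hinj, hsurj⟩, ⟨η, hη, hdη⟩, ⟨ζ, hζ, hdζ⟩⟩ |
    ⟨⟨hC0, hD0, hinj, hsurj⟩, ⟨η, hη, hdη⟩, ⟨ζ, hζ, hdζ⟩⟩
  · have hA1 := algOp_one hA0
    have hB1 := algOp_one hB0
    -- The coalgebra map of `c` sends `1` to `1` and commutes with the codifferentials, so `C`
    -- inherits flatness from `A`.
    have hC1 : algOp C 1 = 0 := by
      have h := mc.comm_apply one_mem_range_sym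
      rwa [mc.co.one, hA1, map_zero] at h
    simp only [← linPart_algOp, ← linPart_homOp] at hinj hsurj hdη hdζ
    obtain ⟨p, hp, hpf, h, hh, hhf, hdfp, hdh⟩ := exists_retraction_homotopy
      (hasProj_shift _) (hasProj_shift _) (ldeg_linPart hA.deg) (hA.linPart_sq hA1)
      (ldeg_of_deg hη) hdη (ldeg_linPart hB.deg) (hB.linPart_sq hB1) (ldeg_of_deg hζ) hdζ
      (ldeg_linPart mf.deg) (mf.linPart_comm hA hA1) hinj hsurj hp₀' hpf₀
    exact exists_lift hA hB hC mc md mf hp hpf me hs₀' hes₀ hsq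
      (Or.inl ⟨hB1, hC1, h, hh, hhf, hdfp, hdh⟩)
  · have hC1 := algOp_one hC0
    simp only [← linPart_algOp, ← linPart_homOp] at hinj hsurj hdη hdζ
    obtain ⟨s, hs, hes, h, hh, heh, hdh⟩ := exists_section_homotopy
      (hasProj_shift _) (hasProj_shift _) (ldeg_linPart hC.deg) (hC.linPart_sq hC1)
      (ldeg_of_deg hη) hdη (ldeg_linPart hD.deg) (ldeg_of_deg hζ) hdζ
      (ldeg_linPart me.deg) (me.linPart_comm hC hC1) hinj hsurj hs₀' hes₀
    exact exists_lift hA hB hC mc md mf hp₀' hpf₀ me hs hes hsq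
      (Or.inr ⟨hC1, h, hh, heh, hdh⟩)
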